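/- Let $U\subset\mathbb R^2$ be a bounded open neighbourhood of the origin and let $r\ge 3$ be an integer. Let $\mathfrak X^r$ be the space of $C^r$ vector fields on $\overline U$ (fields that are $C^r$ on $U$ and whose derivatives of order $\le r$ extend continuously to $\overline U$) with the $C^r$ norm, and let $\Omega=\mathfrak X^r\times\mathfrak X^r$. An element $Z=(X,Y)\in\Omega$ is regarded as the piecewise smooth vector field equal to $X$ on $U^+=\{x_1x_2>0\}$ and to $Y$ on $U^-=\{x_1x_2<0\}$, with switching set $\Sigma=\{x_1x_2=0\}=\Sigma_1\cup\Sigma_2$, $\Sigma_i=\{x_i=0\}$, and with trajectories defined by Filippov's convention: trajectories of $X$ and $Y$ are concatenated at crossing points ($X_iY_i>0$ on $\Sigma_i$). On the part of $\Sigma_i$ where $Y_i$ and $X_i$ have opposite signs (sliding and escaping regions) the motion is given by the sliding field, whose component along $\Sigma_i$ is $(Y_iX_j-X_iY_j)/(Y_i-X_i)$, $j\ne i$, and trajectories of $X$ and $Y$ do not reach these regions in finite time. A tangency point ($X_iY_i=0$ on $\Sigma_i$, away from the origin) lies on the common limit of the neighbouring trajectories if this limit exists, and is a trajectory by itself otherwise.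 The trajectory through the origin is that of $X$ or $Y$ passing through the origin inside $U^+$ or $U^-$ if $\Sigma$ is the closure of its crossing region near the origin; it is the sliding trajectory of $\Sigma_i$ if the origin is adherent to the sliding or escaping region of $\Sigma_i$ only and to the crossing region of the other line; it is $\{0\}$ in the other cases. Two fields $Z,\tilde Z\in\Omega$ are locally $\Sigma$-equivalent if there is an orientation preserving homeomorphism between two connected neighbourhoods of the origin in $U$ that maps $\Sigma$ to $\Sigma$ and trajectories of $Z$ to trajectories of $\tilde Z$, preserving the direction of time. Let $\Omega_0$ be the set of $Z\in\Omega$ that have a neighbourhood in $\Omega$ all of whose elements are locally $\Sigma$-equivalent to $Z$, and let $\Omega_1=\Omega\setminus\Omega_0$. When $X_1X_2(0)<0<Y_1Y_2(0)$, let $\phi_X$ be the germ at $0$ of the map $y\mapsto x$ for which the orbit of $X$ through $(0,y)$ reaches $(x,0)$ (in positive or negative time) inside $\overline{U^+}$, and $\phi_Y$ the germ at $0$ of the map $x\mapsto y$ for which the orbit of $Y$ through $(x,0)$ reaches $(0,y)$ inside $\overline{U^-}$. Write $\phi_X(y)=a_Xy+b_Xy^2+o(y^2)$, $\phi_Y(x)=a_Yx+b_Yx^2+o(x^2)$,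 let $\phi_Z=(\phi_X\circ\phi_Y)^2$ be the first return map, and put $$\alpha_Z=\frac{X_1Y_2}{X_2Y_1}(0),\qquad \beta_Z=b_Xa_Y^2+a_Xb_Y,\qquad \eta_Z=\tfrac16\,\phi_Z'''(0).$$ Let $\Xi_1^2$ be the set of pseudo-Hopf fields, that is, of all $Z=(X,Y)\in\Omega$ such that $X_iY_i(0)>0$ and $X_jY_j(0)<0$ for some $\{i,j\}=\{1,2\}$, $X_1X_2(0)<0$ (these conditions imply $Y_1Y_2(0)>0$, and $Z$ is transient near the origin), $\alpha_Z=-1$, $\beta_Z\ne0$ and $\eta_Z\neq 0$. Then $\Xi_1^2\subset\Omega_1$, the set $\Xi_1^2$ is an embedded (smooth) submanifold of codimension one of $\Omega$, and it is open in $\Omega_1$ for the induced topology. -/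

import Mathlib

open Set Filter Topology
open scoped ContDiff

noncomputable section

namespace PseudoHopf

/-- The plane with coordinates `p 0` and `p 1` (these are $x_1$ and $x_2$). -/
abbrev Plane : Type := Fin 2 → ℝ

/-- A bounded open neighbourhood of the origin. -/
structure OriginNhd where
  carrier : Set Plane
  isOpen' : IsOpen carrier
  isBounded' : Bornology.IsBounded carrier
  zero_mem' : (0 : Plane) ∈ carrier

/-! ### The Banach space of `C^r` vector fields -/

/-- Vector fields of class `C^r` on `closure U`: they are `C^r` on `U`, and all derivatives of
order `≤ r` extend continuously to the compact set `closure U`. A field is represented by the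
function which is zero outside `U`. -/
def crSubmodule (U : OriginNhd) (r : ℕ) : Submodule ℝ (Plane → Plane) where
  carrier := {f | ContDiffOn ℝ r f U.carrier ∧
    (∀ k : ℕ, k ≤ r → ∃ g : Plane → ContinuousMultilinearMap ℝ (fun _ : Fin k => Plane) Plane,
      ContinuousOn g (closure U.carrier) ∧ EqOn g (iteratedFDeriv ℝ k f) U.carrier) ∧
    ∀ p, p ∉ U.carrier → f p = 0}
  zero_mem' := by
    refine ⟨contDiffOn_const, fun k _ => ⟨fun _ => 0, continuousOn_const, fun p _ => ?_⟩,
      fun _ _ => rfl⟩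
    have h := congrFun (iteratedFDeriv_fun_zero (𝕜 := ℝ) (E := Plane) (F := Plane) (n := k)) p
    exact h.symm
  add_mem' := by
    rintro f g ⟨hf, hf', hf0⟩ ⟨hg, hg', hg0⟩
    refine ⟨hf.add hg, fun k hk => ?_, fun p hp => by simp [hf0 p hp, hg0 p hp]⟩
    obtain ⟨a, ha, ha'⟩ := hf' k hk
    obtain ⟨b, hb, hb'⟩ := hg' k hk
    refine ⟨fun p => a p + b p, ha.add hb, fun p hp => ?_⟩
    have hk' : (k : WithTop ℕ∞) ≤ r := by exact_mod_cast hk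
    have h1 := (hf.contDiffAt (U.isOpen'.mem_nhds hp)).of_le hk'
    have h2 := (hg.contDiffAt (U.isOpen'.mem_nhds hp)).of_le hk'
    simp only [ha' hp, hb' hp]
    exact (iteratedFDeriv_add_apply h1 h2).symm
  smul_mem' := by
    rintro c f ⟨hf, hf', hf0⟩
    refine ⟨contDiffOn_const.smul hf, fun k hk => ?_, fun p hp => by simp [hf0 p hp]⟩
    obtain ⟨a, ha, ha'⟩ := hf' k hk
    refine ⟨fun p => c • a p, ha.const_smul c, fun p hp => ?_⟩
    have hk' : (k : WithTop ℕ∞) ≤ r := by exact_mod_cast hk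
    have h1 := (hf.contDiffAt (U.isOpen'.mem_nhds hp)).of_le hk'
    simp only [ha' hp]
    exact (iteratedFDeriv_const_smul_apply h1).symm

/-- The space of `C^r` vector fields on `closure U`. -/
def CrField (U : OriginNhd) (r : ℕ) : Type := ↥(crSubmodule U r)

instance (U : OriginNhd) (r : ℕ) : AddCommGroup (CrField U r) :=
  inferInstanceAs (AddCommGroup ↥(crSubmodule U r))

instance (U : OriginNhd) (r : ℕ) : Module ℝ (CrField U r) :=
  inferInstanceAs (Module ℝ ↥(crSubmodule U r))

instance (U : OriginNhd) (r : ℕ) : CoeFun (CrField U r) (fun _ => Plane → Plane) :=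
  ⟨fun f => f.1⟩

theorem CrField.exists_bound {U : OriginNhd} {r : ℕ} (f : CrField U r) (k : ℕ) (hk : k ≤ r) :
    ∃ C : ℝ, ∀ p : U.carrier, ‖iteratedFDeriv ℝ k f p‖ ≤ C := by
  obtain ⟨g, hg, hg'⟩ := f.2.2.1 k hk
  obtain ⟨C, hC⟩ := U.isBounded'.isCompact_closure.exists_bound_of_continuousOn hg
  refine ⟨C, fun p => ?_⟩
  have h := hC p (subset_closure p.2)
  rwa [hg' p.2] at h

theorem CrField.continuous_iteratedFDeriv {U : OriginNhd} {r : ℕ} (f : CrField U r) (k : ℕ)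
    (hk : k ≤ r) : Continuous (fun p : U.carrier => iteratedFDeriv ℝ k f (p : Plane)) := by
  obtain ⟨g, hg, hg'⟩ := f.2.2.1 k hk
  have h : ContinuousOn (iteratedFDeriv ℝ k f) U.carrier :=
    (hg.mono subset_closure).congr hg'.symm
  exact continuousOn_iff_continuous_domRestrict.mp h

/-- Bounded continuous functions on `U` with values in the `k`-linear maps. -/
def JetSpace (U : OriginNhd) (k : ℕ) : Type :=
  BoundedContinuousFunction U.carrier (ContinuousMultilinearMap ℝ (fun _ : Fin k => Plane) Plane)

instance (U : OriginNhd) (k : ℕ) : NormedAddCommGroup (JetSpace U k) :=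
  inferInstanceAs (NormedAddCommGroup (BoundedContinuousFunction U.carrier
    (ContinuousMultilinearMap ℝ (fun _ : Fin k => Plane) Plane)))

instance (U : OriginNhd) (k : ℕ) : NormedSpace ℝ (JetSpace U k) :=
  inferInstanceAs (NormedSpace ℝ (BoundedContinuousFunction U.carrier
    (ContinuousMultilinearMap ℝ (fun _ : Fin k => Plane) Plane)))

/-- The derivative of order `k`, a bounded continuous function on `U`. -/
def CrField.jet {U : OriginNhd} {r : ℕ} (f : CrField U r) (k : Fin (r + 1)) :
    JetSpace U k :=
  BoundedContinuousFunction.ofNormedAddCommGroup (fun p => iteratedFDeriv ℝ k f (p : Plane))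
    (f.continuous_iteratedFDeriv k (Nat.lt_succ_iff.mp k.2))
    (f.exists_bound k (Nat.lt_succ_iff.mp k.2)).choose
    (f.exists_bound k (Nat.lt_succ_iff.mp k.2)).choose_spec

theorem CrField.contDiffAt {U : OriginNhd} {r : ℕ} (f : CrField U r) (k : Fin (r + 1))
    (p : U.carrier) : ContDiffAt ℝ (k : ℕ) f (p : Plane) :=
  (f.2.1.contDiffAt (U.isOpen'.mem_nhds p.2)).of_le
    (by exact_mod_cast Nat.lt_succ_iff.mp k.2)

/-- All derivatives of order `≤ r`. -/
def CrField.jetMap (U : OriginNhd) (r : ℕ) :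
    CrField U r →ₗ[ℝ] ((k : Fin (r + 1)) → JetSpace U k) where
  toFun f := f.jet
  map_add' f g := by
    funext k
    refine BoundedContinuousFunction.ext fun p => ?_
    exact iteratedFDeriv_add_apply (f.contDiffAt k p) (g.contDiffAt k p)
  map_smul' c f := by
    funext k
    refine BoundedContinuousFunction.ext fun p => ?_
    exact iteratedFDeriv_const_smul_apply (f.contDiffAt k p)

theorem CrField.jetMap_injective (U : OriginNhd) (r : ℕ) :
    Function.Injective (CrField.jetMap U r) := by
  intro f g h
  apply Subtype.ext
  funext p
  by_cases hp : p ∈ U.carrier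
  · have h1 := BoundedContinuousFunction.ext_iff.mp (congrFun h 0) (⟨p, hp⟩ : U.carrier)
    have h2 : iteratedFDeriv ℝ 0 f p = iteratedFDeriv ℝ 0 g p := h1
    have h3 := congrArg (fun m => m (fun _ => (0 : Plane))) h2
    simpa using h3
  · rw [f.2.2.2 p hp, g.2.2.2 p hp]

/-- The `C^r` norm: the maximum over `k ≤ r` of the supremum over `U` of the norm of the
derivative of order `k`. -/
instance (U : OriginNhd) (r : ℕ) : NormedAddCommGroup (CrField U r) :=
  NormedAddCommGroup.induced (CrField U r) _ (CrField.jetMap U r) (CrField.jetMap_injective U r)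

instance (U : OriginNhd) (r : ℕ) : NormedSpace ℝ (CrField U r) :=
  NormedSpace.induced ℝ (CrField U r) _ (CrField.jetMap U r)

/-- The space `Ω` of piecewise smooth fields `Z = (X, Y)`, with `X` acting where `x₁ x₂ > 0` and
`Y` acting where `x₁ x₂ < 0`. -/
abbrev Omega (U : OriginNhd) (r : ℕ) : Type := CrField U r × CrField U r

/-! ### The switching set and its regions -/

/-- `U⁺`, where `x₁ x₂ > 0`. -/
def regionPos (U : OriginNhd) : Set Plane := {p | p ∈ U.carrier ∧ 0 < p 0 * p 1}

/-- `U⁻`, where `x₁ x₂ < 0`. -/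
def regionNeg (U : OriginNhd) : Set Plane := {p | p ∈ U.carrier ∧ p 0 * p 1 < 0}

/-- The switching set `Σ`. -/
def switching (U : OriginNhd) : Set Plane := {p | p ∈ U.carrier ∧ p 0 * p 1 = 0}

/-- The branch of `Σ` on which the coordinate of index `i` vanishes. -/
def branch (U : OriginNhd) (i : Fin 2) : Set Plane := {p | p ∈ U.carrier ∧ p i = 0}

variable {U : OriginNhd} {r : ℕ}

/-- The crossing region of a branch. -/
def crossing (Z : Omega U r) (i : Fin 2) : Set Plane :=
  {p | p ∈ branch U i ∧ 0 < Z.1 p i * Z.2 p i}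

/-- The sliding region of a branch. -/
def sliding (Z : Omega U r) (i : Fin 2) : Set Plane :=
  {p | p ∈ branch U i ∧
    ((0 < p (1 - i) ∧ Z.1 p i < 0 ∧ 0 < Z.2 p i) ∨ (p (1 - i) < 0 ∧ 0 < Z.1 p i ∧ Z.2 p i < 0))}

/-- The escaping region of a branch. -/
def escaping (Z : Omega U r) (i : Fin 2) : Set Plane :=
  {p | p ∈ branch U i ∧
    ((0 < p (1 - i) ∧ 0 < Z.1 p i ∧ Z.2 p i < 0) ∨ (p (1 - i) < 0 ∧ Z.1 p i < 0 ∧ 0 < Z.2 p i))}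

/-- The sliding vector field on the branch `i`, as a vector tangent to this branch. -/
def slidingField (Z : Omega U r) (i : Fin 2) (p : Plane) : Plane :=
  Pi.single (1 - i)
    ((Z.2 p i * Z.1 p (1 - i) - Z.1 p i * Z.2 p (1 - i)) / (Z.2 p i - Z.1 p i))

/-! ### Trajectories -/

/-- The law of motion at the time `t` of a curve `γ` on the interval `I` when `γ t` is neither the
origin nor a point of tangency. In `U⁺` and `U⁻` this is the equation of `X` or `Y`. At a crossing
point the curve is a concatenation of trajectories of `X` and `Y`: it leaves `Σ` at once in both
time directions. On sliding and escaping regions it is the equation of the sliding field; no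
trajectory of `X` or `Y` reaches these regions, the velocity there being tangent to `Σ`. -/
def RegularLaw (Z : Omega U r) (I : Set ℝ) (γ : ℝ → Plane) (t : ℝ) : Prop :=
  (γ t ∈ regionPos U ∧ HasDerivWithinAt γ (Z.1 (γ t)) I t) ∨
  (γ t ∈ regionNeg U ∧ HasDerivWithinAt γ (Z.2 (γ t)) I t) ∨
  (γ t ≠ 0 ∧ (∃ i, γ t ∈ crossing Z i) ∧
    ∀ᶠ s in 𝓝[I \ {t}] t, γ s ∈ regionPos U ∪ regionNeg U) ∨
  (∃ i, γ t ∈ sliding Z i ∪ escaping Z i ∧ HasDerivWithinAt γ (slidingField Z i (γ t)) I t)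

/-- `c`, on `(-ε, ε)`, is the common limit of the trajectories through the points `q` of the
branch `i` as `q` tends to `p` from either side. -/
def IsLimitTrajectory (Z : Omega U r) (i : Fin 2) (p : Plane) (ε : ℝ) (c : ℝ → Plane) : Prop :=
  0 < ε ∧ c 0 = p ∧ ContinuousOn c (Ioo (-ε) ε) ∧
  ∀ δ > 0, ∀ᶠ q in 𝓝[branch U i \ {p}] p, ∃ γ : ℝ → Plane,
    ContinuousOn γ (Ioo (-ε) ε) ∧ (∀ t ∈ Ioo (-ε) ε, RegularLaw Z (Ioo (-ε) ε) γ t) ∧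
    γ 0 = q ∧ ∀ t ∈ Ioo (-ε) ε, dist (γ t) (c t) < δ

/-- The law at a point of tangency other than the origin: the trajectory through a regular
tangency point is the common limit of the neighbouring ones, and a singular tangency point is a
trajectory by itself. -/
def TangencyLaw (Z : Omega U r) (I : Set ℝ) (γ : ℝ → Plane) (t : ℝ) : Prop :=
  γ t ≠ 0 ∧ ∃ i, γ t ∈ branch U i ∧ Z.1 (γ t) i * Z.2 (γ t) i = 0 ∧
    ((∃ ε c, IsLimitTrajectory Z i (γ t) ε c ∧ ∀ᶠ s in 𝓝[I] t, γ s = c (s - t)) ∨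
      ((¬ ∃ ε c, IsLimitTrajectory Z i (γ t) ε c) ∧ ∀ s ∈ I, γ s = γ t))

/-- Near the origin, `Σ` is the closure of the crossing regions. -/
def OriginCrossing (Z : Omega U r) : Prop :=
  ∀ᶠ p in 𝓝 (0 : Plane), p ∈ switching U → p ∈ closure (crossing Z 0 ∪ crossing Z 1)

/-- The origin is adherent to sliding or escaping points of the branch `i` only, and to crossing
points of the other branch. -/
def OriginSliding (Z : Omega U r) (i : Fin 2) : Prop :=
  (0 : Plane) ∈ closure (sliding Z i ∪ escaping Z i) ∧
  (0 : Plane) ∈ closure (crossing Z (1 - i)) ∧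
  (0 : Plane) ∉ closure (sliding Z (1 - i) ∪ escaping Z (1 - i))

/-- The law at the origin. If `Σ` is the closure of the crossing region, the trajectory is that of
`X` or `Y` that passes through the origin inside the corresponding region. If exactly one branch
slides at the origin, it is the trajectory of its sliding field. In the remaining cases the origin
is a trajectory by itself. -/
def OriginLaw (Z : Omega U r) (I : Set ℝ) (γ : ℝ → Plane) (t : ℝ) : Prop :=
  γ t = 0 ∧
  ((OriginCrossing Z ∧
      ((∀ᶠ s in 𝓝[I] t, γ s ∈ regionPos U ∪ {0} ∧ HasDerivWithinAt γ (Z.1 (γ s)) I s) ∨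
       (∀ᶠ s in 𝓝[I] t, γ s ∈ regionNeg U ∪ {0} ∧ HasDerivWithinAt γ (Z.2 (γ s)) I s))) ∨
   (∃ i, OriginSliding Z i ∧ HasDerivWithinAt γ (slidingField Z i 0) I t ∧
      ∀ᶠ s in 𝓝[I] t, γ s ∈ branch U i) ∨
   (¬ OriginCrossing Z ∧ (¬ ∃ i, OriginSliding Z i) ∧ ∀ s ∈ I, γ s = 0))

/-- `γ`, on the time interval `I`, is a (piece of a) trajectory of `Z` contained in `W`. -/
def IsTrajectory (Z : Omega U r) (W : Set Plane) (I : Set ℝ) (γ : ℝ → Plane) : Prop :=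
  ContinuousOn γ I ∧ ∀ t ∈ I, γ t ∈ W ∧ (RegularLaw Z I γ t ∨ TangencyLaw Z I γ t ∨ OriginLaw Z I γ t)

/-! ### Local equivalence and structural stability -/

/-- `h` preserves the orientation of the plane at the origin: the image of a small positively
oriented circle about the origin winds exactly once, positively, about `h 0`. -/
def OrientationPreservingAtZero (h : Plane → Plane) : Prop :=
  ∀ᶠ ρ in 𝓝[>] (0 : ℝ), ∃ m θ : ℝ → ℝ, Continuous θ ∧ (∀ s, 0 < m s) ∧
    (∀ s, h ![ρ * Real.cos s, ρ * Real.sin s] - h 0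
      = ![m s * Real.cos (θ s), m s * Real.sin (θ s)]) ∧
    ∀ s, θ (s + 2 * Real.pi) = θ s + 2 * Real.pi

/-- `h` sends every oriented arc of trajectory of `Z` inside `W` onto an oriented arc of
trajectory of `Z'` inside `W'`. -/
def MapsTrajectories (h : Plane → Plane) (Z : Omega U r) (W : Set Plane) (Z' : Omega U r)
    (W' : Set Plane) : Prop :=
  ∀ (T : ℝ) (γ : ℝ → Plane), 0 ≤ T → IsTrajectory Z W (Icc 0 T) γ →
    ∃ (T' : ℝ) (γ' : ℝ → Plane), 0 ≤ T' ∧ IsTrajectory Z' W' (Icc 0 T') γ' ∧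
      γ' 0 = h (γ 0) ∧ γ' T' = h (γ T) ∧ γ' '' Icc 0 T' = h '' (γ '' Icc 0 T)

/-- Local `Σ`-equivalence at the origin: an orientation preserving homeomorphism `h` between two
(connected) neighbourhoods of the origin that maps `Σ` to `Σ` (so that the double point of `Σ`, the
origin, is fixed) and trajectories to trajectories, preserving their orientation. -/
def LocallyEquivalent (Z Z' : Omega U r) : Prop :=
  ∃ h : OpenPartialHomeomorph Plane Plane,
    h.source ⊆ U.carrier ∧ h.target ⊆ U.carrier ∧ IsConnected h.source ∧
    (0 : Plane) ∈ h.source ∧ h 0 = 0 ∧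
    OrientationPreservingAtZero h ∧
    (∀ p ∈ h.source, p ∈ switching U ↔ h p ∈ switching U) ∧
    MapsTrajectories h Z h.source Z' h.target ∧
    MapsTrajectories h.symm Z' h.target Z h.source

/-- `Ω₀`: the locally `Σ`-structurally stable fields. -/
def Omega0 (U : OriginNhd) (r : ℕ) : Set (Omega U r) :=
  {Z | ∃ V : Set (Omega U r), IsOpen V ∧ Z ∈ V ∧ ∀ Z' ∈ V, LocallyEquivalent Z' Z}

/-- The bifurcation set `Ω₁`. -/
def Omega1 (U : OriginNhd) (r : ℕ) : Set (Omega U r) := (Omega0 U r)ᶜ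

/-! ### The first return map and the pseudo-Hopf fields -/

/-- The solution of `p' = V p` through `p` joins `p` to `q`, in positive or negative time, inside
the set `R`. -/
def Joins (V : Plane → Plane) (R : Set Plane) (p q : Plane) : Prop :=
  ∃ (t : ℝ) (γ : ℝ → Plane), γ 0 = p ∧ γ t = q ∧
    ∀ s ∈ uIcc 0 t, γ s ∈ R ∧ HasDerivWithinAt γ (V (γ s)) (uIcc 0 t) s

open Classical in
/-- The transition map `φ_X` from the line `x₁ = 0` to the line `x₂ = 0` along `X`, inside the
region `x₁ x₂ ≥ 0` (with value `0` where no transition exists). -/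
def phiX (Z : Omega U r) (y : ℝ) : ℝ :=
  if h : ∃ x : ℝ, Joins Z.1 (regionPos U ∪ switching U) ![0, y] ![x, 0] then h.choose else 0

open Classical in
/-- The transition map `φ_Y` from the line `x₂ = 0` to the line `x₁ = 0` along `Y`, inside the
region `x₁ x₂ ≤ 0` (with value `0` where no transition exists). -/
def phiY (Z : Omega U r) (x : ℝ) : ℝ :=
  if h : ∃ y : ℝ, Joins Z.2 (regionNeg U ∪ switching U) ![x, 0] ![0, y] then h.choose else 0

/-- The first return map `φ_Z = (φ_X ∘ φ_Y)²`. -/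
def phiZ (Z : Omega U r) (x : ℝ) : ℝ := phiX Z (phiY Z (phiX Z (phiY Z x)))

/-- `α_Z = X₁ Y₂ / (X₂ Y₁)` at the origin. -/
def alpha (Z : Omega U r) : ℝ := (Z.1 0 0 * Z.2 0 1) / (Z.1 0 1 * Z.2 0 0)

/-- `β_Z = b_X a_Y² + a_X b_Y`, where `a` and `b` are the Taylor coefficients at `0` of orders one
and two of the transition maps. -/
def beta (Z : Omega U r) : ℝ :=
  (iteratedDeriv 2 (phiX Z) 0 / 2) * (deriv (phiY Z) 0) ^ 2
    + deriv (phiX Z) 0 * (iteratedDeriv 2 (phiY Z) 0 / 2)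

/-- `η_Z`: the Taylor coefficient of order three of the first return map at the origin. -/
def eta (Z : Omega U r) : ℝ := iteratedDeriv 3 (phiZ Z) 0 / 6

/-- The set `Ξ₁²` of pseudo-Hopf fields. -/
def pseudoHopf (U : OriginNhd) (r : ℕ) : Set (Omega U r) :=
  {Z | (∃ i : Fin 2, 0 < Z.1 0 i * Z.2 0 i ∧ Z.1 0 (1 - i) * Z.2 0 (1 - i) < 0) ∧
    Z.1 0 0 * Z.1 0 1 < 0 ∧ alpha Z = -1 ∧ beta Z ≠ 0 ∧ eta Z ≠ 0}

/-- `S` is an embedded smooth submanifold of codimension one of the normed space `B`: around each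
point of `S` there is a smooth chart of `B` that carries `S` to a closed hyperplane. -/
def IsEmbeddedHypersurface {B : Type*} [NormedAddCommGroup B] [NormedSpace ℝ B]
    (S : Set B) : Prop :=
  ∀ z ∈ S, ∃ (Φ : OpenPartialHomeomorph B B) (l : B →L[ℝ] ℝ),
    z ∈ Φ.source ∧ ContDiffOn ℝ ∞ Φ Φ.source ∧ ContDiffOn ℝ ∞ Φ.symm Φ.target ∧ l ≠ 0 ∧
    ∀ w ∈ Φ.source, w ∈ S ↔ l (Φ w) = 0

end PseudoHopf

end

noncomputable section

namespace PseudoHopf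

section

/-! ### Scalar differential equations -/

/-! Let `i` be the index of the crossing branch, `s = p i` and `u = p (1 - i)`. Near the origin `X`,
`Y` and the sliding field all move `s` in one direction `σ`, so orbits off the axis `u = 0` are
graphs over `s`. They solve `du/ds = g (s, u)`, with a negative slope `GX` where `s * u > 0` and a
positive slope `GY` where `s * u < 0`. The axis `u = 0` is a trajectory through the origin, sliding
on one side and escaping on the other, and every trajectory near the origin either lies in it or
avoids it (`LocalModel.slides_or_avoids`). The other orbits, the leaves, are hills above the axis
and valleys below it, labelled by their height over `s = 0`, with one end on each half of the axis.

The invariant is the germ of the map `F` of the axis that carries one end of a leaf to the other. If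
`ell s` is the label of the solution that vanishes at `s`, then `GX.ell (F s) = GY.ell s`. So `F` is
decreasing and `F' (0) = GY.g 0 / GX.g 0`, which is `-1` exactly when `slopeSum i Z = 0`, that is,
when `alpha Z = -1`.

Stability when `slopeSum i Z ≠ 0`: the slopes are cut off so that they are close to constants in the
whole plane, and `F` or its inverse becomes a global contraction. It is linearized by an infinite
product (`exists_linearization`), and two linear contractions with negative ratios are conjugate by
an odd power. This gives a map `h` of the axis and a map `κ` of the labels (`exists_conj`), hence a
homeomorphism of the plane that carries axis to axis and leaves to leaves (`Conj.homeomorph`,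
`LocalModel.locallyEquivalent`).

Instability when `slopeSum i Z = 0`: an equivalence preserves the axis and its direction, the two
half planes (by orientation) and the leaves, so it conjugates the germs of the return maps
(`LocallyEquivalent.exists_conj_return`). Arbitrarily small constant perturbations make `F ∘ F`
contracting or expanding, and the same germ cannot be conjugate to both.

Hence, in the open set of fields with the given signs, `Omega1` is the set `alpha Z = -1`
(`mem_Omega1_iff`). The transition maps have third derivatives at the origin that depend
continuously on the 2-jets of the fields (`Slope.hasJet3_ell`, `Slope.jets_of_eventuallyEq`), so
`beta Z ≠ 0` and `eta Z ≠ 0` are open conditions there, and the pseudo-Hopf set is open in `Omega1`.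
Finally `alpha Z = -1` says that `X₁ + X₂ Y₁ / Y₂` vanishes at the origin, and translating `X` by a
constant field makes this equation linear (`shiftChart`). -/

/-- The right-hand side `g` of a scalar equation `u' = g (t, u)`: of class `C²`, bounded, and with
bounded derivative with respect to `u`. -/
structure Slope where
  g : ℝ × ℝ → ℝ
  contDiff : ContDiff ℝ 2 g
  bound : ∃ M : ℝ, ∀ p, |g p| ≤ M
  bound_u : ∃ K : ℝ, ∀ p, |fderiv ℝ g p (0, 1)| ≤ K

namespace Slope

variable (G : Slope)

/-- The derivative of `g` with respect to the unknown. -/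
def gu (p : ℝ × ℝ) : ℝ := fderiv ℝ G.g p (0, 1)

/-- The derivative of `g` with respect to time. -/
def gs (p : ℝ × ℝ) : ℝ := fderiv ℝ G.g p (1, 0)

theorem continuous : Continuous G.g := G.contDiff.continuous

theorem contDiff_gu : ContDiff ℝ 1 G.gu :=
  (G.contDiff.fderiv_right (m := 1) (by norm_num)).clm_apply contDiff_const

theorem contDiff_gs : ContDiff ℝ 1 G.gs :=
  (G.contDiff.fderiv_right (m := 1) (by norm_num)).clm_apply contDiff_const

theorem hasDerivAt_snd (t x : ℝ) : HasDerivAt (fun x => G.g (t, x)) (G.gu (t, x)) x := by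
  have h1 : HasFDerivAt G.g (fderiv ℝ G.g (t, x)) (t, x) :=
    (G.contDiff.differentiable (by norm_num) _).hasFDerivAt
  exact h1.comp_hasDerivAt x ((hasDerivAt_const x t).prodMk (hasDerivAt_id x))

theorem hasDerivAt_fst (t x : ℝ) : HasDerivAt (fun t => G.g (t, x)) (G.gs (t, x)) t := by
  have h1 : HasFDerivAt G.g (fderiv ℝ G.g (t, x)) (t, x) :=
    (G.contDiff.differentiable (by norm_num) _).hasFDerivAt
  exact h1.comp_hasDerivAt t ((hasDerivAt_id t).prodMk (hasDerivAt_const t x))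

theorem exists_lipschitz : ∃ K : NNReal, ∀ t, LipschitzWith K (fun x => G.g (t, x)) := by
  obtain ⟨K, hK⟩ := G.bound_u
  refine ⟨K.toNNReal, fun t => ?_⟩
  refine lipschitzWith_of_nnnorm_deriv_le (fun x => (G.hasDerivAt_snd t x).differentiableAt) ?_
  intro x
  rw [(G.hasDerivAt_snd t x).deriv]
  have := hK (t, x)
  rw [← NNReal.coe_le_coe, coe_nnnorm, Real.norm_eq_abs]
  exact this.trans (Real.le_coe_toNNReal K)

/-- Since `g` is bounded by `M` everywhere, a solution over an interval of half-length `R` cannot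
leave the ball of radius `M * R`, so the Picard–Lindelöf theorem applies for every `R`. -/
theorem exists_local_solution (s x R : ℝ) (hR : 0 ≤ R) : ∃ v : ℝ → ℝ, v s = x ∧
    ∀ t ∈ Icc (s - R) (s + R), HasDerivWithinAt v (G.g (t, v t)) (Icc (s - R) (s + R)) t := by
  obtain ⟨K, hK⟩ := G.exists_lipschitz
  obtain ⟨M, hM⟩ := G.bound
  have hP : IsPicardLindelof (fun t x => G.g (t, x)) (tmin := s - R) (tmax := s + R)
      ⟨s, by constructor <;> linarith⟩ x (M.toNNReal * R.toNNReal) 0 M.toNNReal K := by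
    refine ⟨fun t _ => (hK t).lipschitzOnWith, fun x _ => ?_, fun t _ x _ => ?_, ?_⟩
    · exact (G.continuous.comp (by fun_prop : Continuous fun t : ℝ => (t, x))).continuousOn
    · exact (hM (t, x)).trans (Real.le_coe_toNNReal M)
    · simp [hR]
  exact hP.exists_eq_forall_mem_Icc_hasDerivWithinAt₀

theorem unique_local {s R : ℝ} {v w : ℝ → ℝ}
    (hv : ∀ t ∈ Icc (s - R) (s + R), HasDerivWithinAt v (G.g (t, v t)) (Icc (s - R) (s + R)) t)
    (hw : ∀ t ∈ Icc (s - R) (s + R), HasDerivWithinAt w (G.g (t, w t)) (Icc (s - R) (s + R)) t)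
    (h : v s = w s) (hR : 0 < R) : EqOn v w (Icc (s - R) (s + R)) := by
  obtain ⟨K, hK⟩ := G.exists_lipschitz
  refine ODE_solution_unique_of_mem_Icc (v := fun t x => G.g (t, x)) (s := fun _ => univ)
    (t₀ := s) (K := K)
    (fun t _ => (hK t).lipschitzOnWith) ⟨by linarith, by linarith⟩
    (fun t ht => (hv t ht).continuousWithinAt) (fun t ht => ?_) (fun _ _ => trivial)
    (fun t ht => (hw t ht).continuousWithinAt) (fun t ht => ?_) (fun _ _ => trivial) h
  · exact (hv t (Ioo_subset_Icc_self ht)).hasDerivAt (Icc_mem_nhds ht.1 ht.2)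
  · exact (hw t (Ioo_subset_Icc_self ht)).hasDerivAt (Icc_mem_nhds ht.1 ht.2)

theorem exists_solution (s x : ℝ) : ∃ v : ℝ → ℝ, v s = x ∧
    ∀ t, HasDerivAt v (G.g (t, v t)) t := by
  choose! v hv0 hv using fun n : ℕ => G.exists_local_solution s x (n + 1) (by positivity)
  have hcons : ∀ m n : ℕ, m ≤ n → EqOn (v m) (v n) (Icc (s - (m + 1)) (s + (m + 1))) := by
    intro m n hmn
    have hmn' : (m : ℝ) ≤ n := by exact_mod_cast hmn
    refine G.unique_local (hv m) (fun t ht => ?_) ((hv0 m).trans (hv0 n).symm) (by positivity)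
    have hsub : Icc (s - ((m : ℝ) + 1)) (s + (m + 1)) ⊆ Icc (s - ((n : ℝ) + 1)) (s + (n + 1)) :=
      Icc_subset_Icc (by linarith) (by linarith)
    exact (hv n t (hsub ht)).mono hsub
  -- The solution of index `m` lives on the interval of half-length `m + 1`, so this choice always
  -- evaluates inside the domain. Near `t` it agrees, by uniqueness, with the single solution of
  -- index `⌊|t - s|⌋₊ + 1`.
  refine ⟨fun t => v ⌊|t - s|⌋₊ t, by simpa using hv0 _, fun t => ?_⟩
  set n := ⌊|t - s|⌋₊ + 1 with hn
  have hlt : |t - s| < n := by simpa [hn] using Nat.lt_floor_add_one |t - s|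
  have hev : ∀ᶠ t' in 𝓝 t, |t' - s| < n :=
    ((continuous_id.sub continuous_const).abs.tendsto t).eventually (gt_mem_nhds hlt)
  have heq : (fun t' => v ⌊|t' - s|⌋₊ t') =ᶠ[𝓝 t] v n := by
    filter_upwards [hev] with t' ht'
    have h1 : ⌊|t' - s|⌋₊ ≤ n := Nat.floor_le_of_le ht'.le
    refine hcons _ _ h1 ?_
    have h2 := (Nat.lt_floor_add_one |t' - s|).le
    have h3 := abs_le.mp h2
    constructor <;> linarith [h3.1, h3.2]
  have h4 := abs_lt.mp hlt
  have hd : HasDerivAt (v n) (G.g (t, v n t)) t :=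
    (hv n t ⟨by linarith [h4.1], by linarith [h4.2]⟩).hasDerivAt
      (Icc_mem_nhds (by linarith [h4.1]) (by linarith [h4.2]))
  have := hd.congr_of_eventuallyEq heq
  rwa [← heq.self_of_nhds] at this

/-- The value at time `t` of the solution with value `x` at time `s`. -/
def flow (s x t : ℝ) : ℝ := (G.exists_solution s x).choose t

@[simp] theorem flow_self (s x : ℝ) : G.flow s x s = x := (G.exists_solution s x).choose_spec.1

theorem hasDerivAt_flow (s x t : ℝ) : HasDerivAt (G.flow s x) (G.g (t, G.flow s x t)) t :=
  (G.exists_solution s x).choose_spec.2 t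

theorem continuous_flow_right (s x : ℝ) : Continuous (G.flow s x) :=
  continuous_iff_continuousAt.mpr fun t => (G.hasDerivAt_flow s x t).continuousAt

theorem eq_flow {v : ℝ → ℝ} (hv : ∀ t, HasDerivAt v (G.g (t, v t)) t) (s : ℝ) :
    v = G.flow s (v s) := by
  obtain ⟨K, hK⟩ := G.exists_lipschitz
  exact ODE_solution_unique_univ (v := fun t x => G.g (t, x)) (s := fun _ => univ) (t₀ := s)
    (K := K) (fun t => (hK t).lipschitzOnWith) (fun t => ⟨hv t, trivial⟩)
    (fun t => ⟨G.hasDerivAt_flow s (v s) t, trivial⟩) (by simp)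

@[simp] theorem flow_flow (s x t t' : ℝ) : G.flow t (G.flow s x t) t' = G.flow s x t' :=
  (congrFun (G.eq_flow (G.hasDerivAt_flow s x) t) t').symm

/-- The mean slope between two points with the same time coordinate. -/
def mean (t a b : ℝ) : ℝ := ∫ θ in (0 : ℝ)..1, G.gu (t, a + θ * (b - a))

theorem continuous_mean : Continuous fun p : ℝ × ℝ × ℝ => G.mean p.1 p.2.1 p.2.2 := by
  refine intervalIntegral.continuous_parametric_intervalIntegral_of_continuous' ?_ _ _
  have := G.contDiff_gu.continuous
  fun_prop

theorem mean_mul (t a b : ℝ) : G.mean t a b * (b - a) = G.g (t, b) - G.g (t, a) := by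
  have h : ∀ θ ∈ uIcc (0 : ℝ) 1, HasDerivAt (fun θ => G.g (t, a + θ * (b - a)))
      (G.gu (t, a + θ * (b - a)) * (b - a)) θ := by
    intro θ _
    have h1 : HasDerivAt (fun θ : ℝ => a + θ * (b - a)) (b - a) θ := by
      simpa using ((hasDerivAt_id θ).mul_const (b - a)).const_add a
    exact (G.hasDerivAt_snd t _).comp θ h1
  have h2 := intervalIntegral.integral_eq_sub_of_hasDerivAt h (Continuous.intervalIntegrable (by
    have := G.contDiff_gu.continuous
    fun_prop) _ _)
  rw [intervalIntegral.integral_mul_const] at h2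
  simpa [mean] using h2

theorem mean_self (t a : ℝ) : G.mean t a a = G.gu (t, a) := by simp [mean]

theorem exists_abs_mean_le : ∃ K : ℝ, 0 ≤ K ∧ ∀ t a b, |G.mean t a b| ≤ K := by
  obtain ⟨K, hK⟩ := G.bound_u
  refine ⟨K, (abs_nonneg _).trans (hK 0), fun t a b => ?_⟩
  have := intervalIntegral.norm_integral_le_of_norm_le_const (a := (0 : ℝ)) (b := 1) (C := K)
    (f := fun θ => G.gu (t, a + θ * (b - a))) (fun θ _ => hK _)
  simpa [mean] using this

/-- The difference of two solutions satisfies a linear equation. -/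
theorem flow_sub_flow (s x s' x' r t : ℝ) :
    G.flow s' x' t - G.flow s x t = (G.flow s' x' r - G.flow s x r) *
      Real.exp (∫ τ in r..t, G.mean τ (G.flow s x τ) (G.flow s' x' τ)) := by
  set m : ℝ → ℝ := fun τ => G.mean τ (G.flow s x τ) (G.flow s' x' τ) with hm
  have hmc : Continuous m := G.continuous_mean.comp
    (continuous_id.prodMk ((G.continuous_flow_right s x).prodMk (G.continuous_flow_right s' x')))
  -- The difference of the solutions times the integrating factor of its linear equation; it is
  -- constant.
  set w : ℝ → ℝ := fun τ => (G.flow s' x' τ - G.flow s x τ) * Real.exp (-∫ σ in r..τ, m σ) with hw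
  have hd : ∀ τ, HasDerivAt w 0 τ := by
    intro τ
    have h1 := (G.hasDerivAt_flow s' x' τ).sub (G.hasDerivAt_flow s x τ)
    have h2 : HasDerivAt (fun τ => ∫ σ in r..τ, m σ) (m τ) τ :=
      intervalIntegral.integral_hasDerivAt_right (hmc.intervalIntegrable _ _)
        (hmc.stronglyMeasurableAtFilter _ _) hmc.continuousAt
    refine (h1.mul h2.neg.exp).congr_deriv ?_
    have := G.mean_mul τ (G.flow s x τ) (G.flow s' x' τ)
    rw [← this]
    simp [hm]
    ring
  have hconst : w t = w r := is_const_of_deriv_eq_zero (fun τ => (hd τ).differentiableAt)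
    (fun τ => (hd τ).deriv) t r
  simp only [hw, intervalIntegral.integral_same, neg_zero, Real.exp_zero, mul_one] at hconst
  rw [← hconst, mul_assoc, ← Real.exp_add]
  simp

theorem flow_strictMono (s t : ℝ) : StrictMono fun x => G.flow s x t := by
  intro x x' h
  have := G.flow_sub_flow s x s x' s t
  rw [flow_self, flow_self] at this
  have h2 : 0 < G.flow s x' t - G.flow s x t := by
    rw [this]; exact mul_pos (sub_pos.mpr h) (Real.exp_pos _)
  simpa using h2

theorem exists_abs_flow_sub_le : ∃ M : ℝ, 0 ≤ M ∧ ∀ s x t t',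
    |G.flow s x t - G.flow s x t'| ≤ M * |t - t'| := by
  obtain ⟨M, hM⟩ := G.bound
  refine ⟨M, (abs_nonneg _).trans (hM 0), fun s x t t' => ?_⟩
  exact convex_univ.norm_image_sub_le_of_norm_hasDerivWithin_le (f := G.flow s x)
    (fun τ _ => (G.hasDerivAt_flow s x τ).hasDerivWithinAt) (fun τ _ => hM _)
    (mem_univ t') (mem_univ t)

/-- The exponential formula `flow_sub_flow`, based at the time `s'`, gives an explicit modulus of
continuity: the mean slope is bounded by `K` and each solution is `M`-Lipschitz in time. -/
theorem continuous_flow : Continuous fun p : ℝ × ℝ × ℝ => G.flow p.1 p.2.1 p.2.2 := by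
  obtain ⟨K, hK0, hK⟩ := G.exists_abs_mean_le
  obtain ⟨M, hM0, hM⟩ := G.exists_abs_flow_sub_le
  rw [continuous_iff_continuousAt]
  rintro ⟨s, x, t⟩
  have hb : ∀ p : ℝ × ℝ × ℝ, |G.flow p.1 p.2.1 p.2.2 - G.flow s x t| ≤
      (|p.2.1 - x| + M * |p.1 - s|) * Real.exp (K * |p.2.2 - p.1|) + M * |p.2.2 - t| := by
    rintro ⟨s', x', t'⟩
    have h1 := G.flow_sub_flow s x s' x' s' t'
    have h2 := hM s x t' t
    have h3 : |∫ τ in s'..t', G.mean τ (G.flow s x τ) (G.flow s' x' τ)| ≤ K * |t' - s'| := by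
      rw [← Real.norm_eq_abs]
      exact intervalIntegral.norm_integral_le_of_norm_le_const fun τ _ => hK _ _ _
    have h4 : |G.flow s' x' s' - G.flow s x s'| ≤ |x' - x| + M * |s' - s| := by
      have := hM s x s' s
      simp only [flow_self] at this ⊢
      calc |x' - G.flow s x s'| = |(x' - x) - (G.flow s x s' - x)| := by ring_nf
        _ ≤ |x' - x| + |G.flow s x s' - x| := abs_sub _ _
        _ ≤ _ := by gcongr
    calc |G.flow s' x' t' - G.flow s x t|
        = |(G.flow s' x' t' - G.flow s x t') + (G.flow s x t' - G.flow s x t)| := by ring_nf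
      _ ≤ |G.flow s' x' t' - G.flow s x t'| + |G.flow s x t' - G.flow s x t| := abs_add_le _ _
      _ ≤ _ := by
        refine add_le_add ?_ h2
        rw [h1, abs_mul, Real.abs_exp]
        gcongr
        exact (le_abs_self _).trans h3
  rw [ContinuousAt, tendsto_iff_dist_tendsto_zero]
  refine squeeze_zero (fun _ => dist_nonneg) hb ?_
  have hc : Continuous fun p : ℝ × ℝ × ℝ =>
      (|p.2.1 - x| + M * |p.1 - s|) * Real.exp (K * |p.2.2 - p.1|) + M * |p.2.2 - t| := by
    fun_prop
  have := hc.tendsto (s, x, t)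
  simpa using this

/-- The derivative of the flow with respect to the initial value. -/
def jac (s x t : ℝ) : ℝ := Real.exp (∫ τ in s..t, G.gu (τ, G.flow s x τ))

theorem continuous_jac : Continuous fun p : ℝ × ℝ × ℝ => G.jac p.1 p.2.1 p.2.2 := by
  have h1 : Continuous fun q : (ℝ × ℝ × ℝ) × ℝ => G.gu (q.2, G.flow q.1.1 q.1.2.1 q.2) := by
    have h2 := G.contDiff_gu.continuous
    have h3 : Continuous fun q : (ℝ × ℝ × ℝ) × ℝ => G.flow q.1.1 q.1.2.1 q.2 :=
      G.continuous_flow.comp (by fun_prop :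
        Continuous fun q : (ℝ × ℝ × ℝ) × ℝ => (q.1.1, q.1.2.1, q.2))
    exact h2.comp (continuous_snd.prodMk h3)
  have h4 : ∀ e : ℝ × ℝ × ℝ → ℝ, Continuous e → Continuous fun p =>
      ∫ τ in (0 : ℝ)..e p, G.gu (τ, G.flow p.1 p.2.1 τ) := fun e he =>
    intervalIntegral.continuous_parametric_intervalIntegral_of_continuous h1 he
  refine Real.continuous_exp.comp ?_
  have h5 := (h4 (fun p => p.2.2) (by fun_prop)).sub (h4 (fun p => p.1) (by fun_prop))
  convert h5 using 2 with p
  rw [Pi.sub_apply, intervalIntegral.integral_interval_sub_left]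
  all_goals
    exact (h1.comp (by fun_prop : Continuous fun τ : ℝ => (p, τ))).intervalIntegrable _ _

/-- By `flow_sub_flow` the increment is a product `A p * B p`, where `A` is differentiable and
vanishes at the base point and `B` is merely continuous. This is enough for a derivative, and `B`
takes the value `jac` there. -/
theorem hasFDerivAt_flow (s x t : ℝ) : HasFDerivAt (fun p : ℝ × ℝ => G.flow p.1 p.2 t)
    (G.jac s x t • (ContinuousLinearMap.snd ℝ ℝ ℝ - G.g (s, x) • ContinuousLinearMap.fst ℝ ℝ ℝ))
    (s, x) := by
  set A : ℝ × ℝ → ℝ := fun p => p.2 - G.flow s x p.1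
  set B : ℝ × ℝ → ℝ := fun p =>
    Real.exp (∫ τ in p.1..t, G.mean τ (G.flow s x τ) (G.flow p.1 p.2 τ))
  have hA : HasFDerivAt A
      (ContinuousLinearMap.snd ℝ ℝ ℝ - G.g (s, x) • ContinuousLinearMap.fst ℝ ℝ ℝ) (s, x) := by
    have h1 : HasDerivAt (G.flow s x) (G.g (s, x)) s := by
      simpa using G.hasDerivAt_flow s x s
    have h2 := h1.comp_hasFDerivAt (s, x) (hasFDerivAt_fst (𝕜 := ℝ) (p := ((s, x) : ℝ × ℝ)))
    exact hasFDerivAt_snd.sub h2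
  have hB : ContinuousAt B (s, x) := by
    have h1 : Continuous fun q : (ℝ × ℝ) × ℝ =>
        G.mean q.2 (G.flow s x q.2) (G.flow q.1.1 q.1.2 q.2) :=
      G.continuous_mean.comp (continuous_snd.prodMk
        (((G.continuous_flow_right s x).comp continuous_snd).prodMk
        (G.continuous_flow.comp (by fun_prop :
          Continuous fun q : (ℝ × ℝ) × ℝ => (q.1.1, q.1.2, q.2)))))
    have h2 := intervalIntegral.continuous_parametric_intervalIntegral_of_continuous (a₀ := t)
      (μ := MeasureTheory.volume)
      (f := fun p τ => G.mean τ (G.flow s x τ) (G.flow p.1 p.2 τ)) h1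
      (s := fun p : ℝ × ℝ => p.1) continuous_fst
    refine Continuous.continuousAt (Real.continuous_exp.comp ?_)
    convert h2.neg using 2 with p
    exact intervalIntegral.integral_symm _ _
  have hB0 : B (s, x) = G.jac s x t := by simp [B, jac, mean_self]
  have hA0 : A (s, x) = 0 := by simp [A]
  have hF : ∀ p : ℝ × ℝ, G.flow p.1 p.2 t = G.flow s x t + A p * B p := by
    intro p
    have := G.flow_sub_flow s x p.1 p.2 p.1 t
    simp only [flow_self] at this
    simp only [A, B]
    linarith
  have hAB : HasFDerivAt (fun p => A p * B p) (B (s, x) •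
      (ContinuousLinearMap.snd ℝ ℝ ℝ - G.g (s, x) • ContinuousLinearMap.fst ℝ ℝ ℝ)) (s, x) := by
    rw [hasFDerivAt_iff_isLittleO] at hA ⊢
    have e : (fun p => A p * B p - A (s, x) * B (s, x) - (B (s, x) •
        (ContinuousLinearMap.snd ℝ ℝ ℝ - G.g (s, x) • ContinuousLinearMap.fst ℝ ℝ ℝ)) (p - (s, x)))
        = fun p => B p * (A p - A (s, x) - (ContinuousLinearMap.snd ℝ ℝ ℝ -
            G.g (s, x) • ContinuousLinearMap.fst ℝ ℝ ℝ) (p - (s, x))) +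
          (B p - B (s, x)) * (ContinuousLinearMap.snd ℝ ℝ ℝ -
            G.g (s, x) • ContinuousLinearMap.fst ℝ ℝ ℝ) (p - (s, x)) := by
      funext p
      simp only [hA0, _root_.smul_apply, smul_eq_mul]
      ring
    rw [e]
    refine Asymptotics.IsLittleO.add ?_ ?_
    · have := (hB.isBigO_one ℝ).mul_isLittleO hA.norm_right
      simpa using this.norm_right
    · have h1 : (fun p => B p - B (s, x)) =o[𝓝 (s, x)] (fun _ => (1 : ℝ)) := by
        rw [Asymptotics.isLittleO_one_iff, tendsto_sub_nhds_zero_iff]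
        exact hB
      have := h1.mul_isBigO (ContinuousLinearMap.isBigO_sub (ContinuousLinearMap.snd ℝ ℝ ℝ -
            G.g (s, x) • ContinuousLinearMap.fst ℝ ℝ ℝ) (𝓝 (s, x)) (s, x)).norm_right
      simpa using this.norm_right
  rw [← hB0]
  exact (hAB.const_add _).congr_of_eventuallyEq (Eventually.of_forall hF)

end Slope

end

section

/-! ### Differentiation of integrals with parameters -/

/-- Hadamard's form: the difference quotient is `B` itself, so no differentiability of `B` is
needed. -/
theorem hasDerivAt_of_eq_add_mul {f B : ℝ → ℝ} {s : ℝ} (hB : ContinuousAt B s)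
    (h : ∀ s', f s' = f s + (s' - s) * B s') : HasDerivAt f (B s) s := by
  rw [hasDerivAt_iff_tendsto_slope]
  refine (hB.tendsto.mono_left nhdsWithin_le_nhds).congr' ?_
  filter_upwards [self_mem_nhdsWithin] with s' hs'
  have : s' - s ≠ 0 := sub_ne_zero.mpr hs'
  rw [slope_def_field, h s']
  field_simp
  ring

/-- Rescaling the interval of integration to `[0, 1]` exhibits the factor `s' - s`. Only continuity
of `q` is used, although the parameter also occurs in the integrand. -/
theorem hasDerivAt_integral_diag {q : ℝ → ℝ → ℝ} (hq : Continuous fun p : ℝ × ℝ => q p.1 p.2)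
    (s : ℝ) : HasDerivAt (fun s' => ∫ τ in s..s', q s' τ) (q s s) s := by
  have hB : Continuous fun s' => ∫ θ in (0 : ℝ)..1, q s' (s + (s' - s) * θ) := by
    refine intervalIntegral.continuous_parametric_intervalIntegral_of_continuous' ?_ _ _
    exact hq.comp (by fun_prop : Continuous fun p : ℝ × ℝ => (p.1, s + (p.1 - s) * p.2))
  have h := hasDerivAt_of_eq_add_mul (f := fun s' => ∫ τ in s..s', q s' τ) hB.continuousAt
    (s := s) fun s' => by
      have := intervalIntegral.smul_integral_comp_add_mul (a := 0) (b := 1) (q s') (s' - s) s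
      simp only [mul_zero, add_zero, mul_one, smul_eq_mul, add_sub_cancel] at this
      rw [← this, intervalIntegral.integral_same, zero_add]
  simpa using h

theorem hasDerivAt_integral_param {q q' : ℝ → ℝ → ℝ}
    (hq : Continuous fun p : ℝ × ℝ => q p.1 p.2) (hq' : Continuous fun p : ℝ × ℝ => q' p.1 p.2)
    (hd : ∀ s τ, HasDerivAt (fun s => q s τ) (q' s τ) s) (a b s : ℝ) :
    HasDerivAt (fun s => ∫ τ in a..b, q s τ) (∫ τ in a..b, q' s τ) s := by
  have hc1 : Continuous fun p : ℝ × ℝ => ∫ θ in (0 : ℝ)..1, q' (s + θ * (p.1 - s)) p.2 := by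
    refine intervalIntegral.continuous_parametric_intervalIntegral_of_continuous' ?_ _ _
    exact hq'.comp (by fun_prop :
      Continuous fun p : (ℝ × ℝ) × ℝ => (s + p.2 * (p.1.1 - s), p.1.2))
  have hB : Continuous fun s' => ∫ τ in a..b, ∫ θ in (0 : ℝ)..1, q' (s + θ * (s' - s)) τ :=
    intervalIntegral.continuous_parametric_intervalIntegral_of_continuous' hc1 _ _
  have hqi : ∀ s', IntervalIntegrable (q s') MeasureTheory.volume a b := fun s' =>
    (hq.comp (by fun_prop : Continuous fun τ : ℝ => (s', τ))).intervalIntegrable _ _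
  have h := hasDerivAt_of_eq_add_mul (f := fun s' => ∫ τ in a..b, q s' τ) hB.continuousAt
    (s := s) fun s' => by
      rw [← intervalIntegral.integral_const_mul, ← sub_eq_iff_eq_add',
        ← intervalIntegral.integral_sub (hqi _) (hqi _)]
      refine intervalIntegral.integral_congr fun τ _ => ?_
      have h1 : ∀ θ ∈ uIcc (0 : ℝ) 1, HasDerivAt (fun θ => q (s + θ * (s' - s)) τ)
          (q' (s + θ * (s' - s)) τ * (s' - s)) θ := by
        intro θ _
        have h1 : HasDerivAt (fun θ : ℝ => s + θ * (s' - s)) (s' - s) θ := by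
          simpa using ((hasDerivAt_id θ).mul_const (s' - s)).const_add s
        exact (hd _ τ).comp θ h1
      have h2 := intervalIntegral.integral_eq_sub_of_hasDerivAt h1
        (Continuous.intervalIntegrable ((hq'.comp (by fun_prop :
          Continuous fun θ : ℝ => (s + θ * (s' - s), τ))).mul_const _) _ _)
      rw [intervalIntegral.integral_mul_const] at h2
      simp only [one_mul, zero_mul, add_zero, add_sub_cancel] at h2
      rw [← h2, mul_comm]
  simpa using h

theorem hasDerivAt_integral_leibniz {q q' : ℝ → ℝ → ℝ}
    (hq : Continuous fun p : ℝ × ℝ => q p.1 p.2) (hq' : Continuous fun p : ℝ × ℝ => q' p.1 p.2)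
    (hd : ∀ s τ, HasDerivAt (fun s => q s τ) (q' s τ) s) (a s : ℝ) :
    HasDerivAt (fun s => ∫ τ in a..s, q s τ) (q s s + ∫ τ in a..s, q' s τ) s := by
  have h := (hasDerivAt_integral_diag hq s).add (hasDerivAt_integral_param hq hq' hd a s s)
  refine h.congr_of_eventuallyEq (Eventually.of_forall fun s' => ?_)
  have hqi : ∀ a b, IntervalIntegrable (q s') MeasureTheory.volume a b := fun a b =>
    (hq.comp (by fun_prop : Continuous fun τ : ℝ => (s', τ))).intervalIntegrable _ _
  simp only [Pi.add_apply]
  rw [add_comm, intervalIntegral.integral_add_adjacent_intervals (hqi _ _) (hqi _ _)]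

/-! ### Jets of order three at the origin -/

/-- `f` vanishes at the origin, is twice differentiable near the origin and three times at the
origin, and its successive derivatives at the origin are `a`, `b` and `c`. -/
def HasJet3 (f : ℝ → ℝ) (a b c : ℝ) : Prop :=
  f 0 = 0 ∧ ∃ f1 f2 : ℝ → ℝ, (∀ᶠ x in 𝓝 0, HasDerivAt f (f1 x) x) ∧
    (∀ᶠ x in 𝓝 0, HasDerivAt f1 (f2 x) x) ∧ HasDerivAt f2 c 0 ∧ f1 0 = a ∧ f2 0 = b

theorem HasJet3.congr {f g : ℝ → ℝ} {a b c : ℝ} (h : HasJet3 f a b c) (hfg : g =ᶠ[𝓝 0] f) :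
    HasJet3 g a b c := by
  obtain ⟨h0, f1, f2, h1, h2, h3, ha, hb⟩ := h
  refine ⟨hfg.self_of_nhds.trans h0, f1, f2, ?_, h2, h3, ha, hb⟩
  filter_upwards [h1, hfg.eventuallyEq_nhds] with x hx hx'
  exact hx.congr_of_eventuallyEq hx'

theorem HasJet3.hasDerivAt {f : ℝ → ℝ} {a b c : ℝ} (h : HasJet3 f a b c) : HasDerivAt f a 0 := by
  obtain ⟨h0, f1, f2, h1, h2, h3, rfl, hb⟩ := h
  exact h1.self_of_nhds

theorem HasJet3.deriv_eq {f : ℝ → ℝ} {a b c : ℝ} (h : HasJet3 f a b c) : deriv f 0 = a :=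
  h.hasDerivAt.deriv

theorem HasJet3.iteratedDeriv_two {f : ℝ → ℝ} {a b c : ℝ} (h : HasJet3 f a b c) :
    iteratedDeriv 2 f 0 = b := by
  obtain ⟨h0, f1, f2, h1, h2, h3, ha, rfl⟩ := h
  have e1 : deriv f =ᶠ[𝓝 0] f1 := h1.mono fun x hx => hx.deriv
  rw [iteratedDeriv_succ, iteratedDeriv_one, e1.deriv_eq, h2.self_of_nhds.deriv]

theorem HasJet3.iteratedDeriv_three {f : ℝ → ℝ} {a b c : ℝ} (h : HasJet3 f a b c) :
    iteratedDeriv 3 f 0 = c := by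
  obtain ⟨h0, f1, f2, h1, h2, h3, ha, hb⟩ := h
  have e1 : deriv f =ᶠ[𝓝 0] f1 := h1.mono fun x hx => hx.deriv
  have e2 : deriv (deriv f) =ᶠ[𝓝 0] f2 :=
    e1.deriv.trans (h2.mono fun x hx => hx.deriv)
  rw [iteratedDeriv_succ, iteratedDeriv_succ, iteratedDeriv_one, e2.deriv_eq, h3.deriv]

theorem HasJet3.comp {f g : ℝ → ℝ} {a b c a' b' c' : ℝ} (hf : HasJet3 f a b c)
    (hg : HasJet3 g a' b' c') : HasJet3 (f ∘ g) (a * a') (b * a' ^ 2 + a * b')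
      (c * a' ^ 3 + 3 * b * a' * b' + a * c') := by
  obtain ⟨hf0, f1, f2, hf1, hf2, hf3, rfl, rfl⟩ := hf
  obtain ⟨hg0, g1, g2, hg1, hg2, hg3, rfl, rfl⟩ := hg
  have hgc : Tendsto g (𝓝 0) (𝓝 0) := by
    simpa [hg0] using hg1.self_of_nhds.continuousAt.tendsto
  have hg1' := hg1.self_of_nhds
  have hg2' := hg2.self_of_nhds
  refine ⟨by simp [hf0, hg0], fun x => f1 (g x) * g1 x,
    fun x => f2 (g x) * g1 x ^ 2 + f1 (g x) * g2 x, ?_, ?_, ?_, by simp [hg0], by simp [hg0]⟩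
  · filter_upwards [hg1, hgc.eventually hf1] with x h1 h2
    exact h2.comp x h1
  · filter_upwards [hg1, hg2, hgc.eventually hf2] with x h1 h2 h3
    refine ((h3.comp x h1).mul h2).congr_deriv ?_
    simp only [Function.comp_apply]
    ring
  · have h3 : HasDerivAt f2 c (g 0) := by rwa [hg0]
    have h2 : HasDerivAt f1 (f2 0) (g 0) := by rw [hg0]; exact hf2.self_of_nhds
    refine (((h3.comp 0 hg1').mul (hg2'.pow 2)).add ((h2.comp 0 hg1').mul hg3)).congr_deriv ?_
    simp only [Function.comp_apply, Pi.pow_apply, hg0]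
    push_cast
    ring

namespace Slope

variable (G : Slope)

/-! ### The transition map to the axis `t = 0` -/

/-- The value at time `0` of the solution which vanishes at time `s`. -/
def ell (s : ℝ) : ℝ := G.flow s 0 0

@[simp] theorem ell_zero : G.ell 0 = 0 := G.flow_self 0 0

/-- The second derivative of `g` with respect to the unknown. -/
def guu (p : ℝ × ℝ) : ℝ := fderiv ℝ G.gu p (0, 1)

/-- The mixed second derivative of `g`. -/
def gus (p : ℝ × ℝ) : ℝ := fderiv ℝ G.gu p (1, 0)

/-- The second derivative of `g` with respect to time. -/
def gss (p : ℝ × ℝ) : ℝ := fderiv ℝ G.gs p (1, 0)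

theorem continuous_guu : Continuous G.guu :=
  (G.contDiff_gu.continuous_fderiv (by norm_num)).clm_apply continuous_const

theorem hasDerivAt_gu_snd (t x : ℝ) : HasDerivAt (fun x => G.gu (t, x)) (G.guu (t, x)) x := by
  have h1 : HasFDerivAt G.gu (fderiv ℝ G.gu (t, x)) (t, x) :=
    (G.contDiff_gu.differentiable (by norm_num) _).hasFDerivAt
  exact h1.comp_hasDerivAt x ((hasDerivAt_const x t).prodMk (hasDerivAt_id x))

theorem hasDerivAt_gu_fst (t x : ℝ) : HasDerivAt (fun t => G.gu (t, x)) (G.gus (t, x)) t := by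
  have h1 : HasFDerivAt G.gu (fderiv ℝ G.gu (t, x)) (t, x) :=
    (G.contDiff_gu.differentiable (by norm_num) _).hasFDerivAt
  exact h1.comp_hasDerivAt t ((hasDerivAt_id t).prodMk (hasDerivAt_const t x))

theorem hasDerivAt_gs_fst (t x : ℝ) : HasDerivAt (fun t => G.gs (t, x)) (G.gss (t, x)) t := by
  have h1 : HasFDerivAt G.gs (fderiv ℝ G.gs (t, x)) (t, x) :=
    (G.contDiff_gs.differentiable (by norm_num) _).hasFDerivAt
  exact h1.comp_hasDerivAt t ((hasDerivAt_id t).prodMk (hasDerivAt_const t x))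

theorem hasDerivAt_flow_left (s x t : ℝ) :
    HasDerivAt (fun s => G.flow s x t) (-(G.g (s, x) * G.jac s x t)) s := by
  have := (G.hasFDerivAt_flow s x t).comp_hasDerivAt s
    ((hasDerivAt_id s).prodMk (hasDerivAt_const s x))
  refine this.congr_deriv ?_
  simp [mul_comm]

/-- The exponent in the derivative of `ell`. -/
def expo (s : ℝ) : ℝ := ∫ τ in (0 : ℝ)..s, G.gu (τ, G.flow s 0 τ)

theorem hasDerivAt_ell (s : ℝ) :
    HasDerivAt G.ell (-(G.g (s, 0)) * Real.exp (-G.expo s)) s := by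
  refine (G.hasDerivAt_flow_left s 0 0).congr_deriv ?_
  rw [jac, expo, intervalIntegral.integral_symm]
  ring

/-- The derivative of the integrand of `expo` with respect to the parameter. -/
def expoIntegrand (s τ : ℝ) : ℝ :=
  G.guu (τ, G.flow s 0 τ) * -(G.g (s, 0) * G.jac s 0 τ)

theorem continuous_expoIntegrand : Continuous fun p : ℝ × ℝ => G.expoIntegrand p.1 p.2 := by
  have h1 : Continuous fun p : ℝ × ℝ => G.flow p.1 0 p.2 :=
    G.continuous_flow.comp (by fun_prop : Continuous fun p : ℝ × ℝ => (p.1, (0 : ℝ), p.2))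
  have h2 : Continuous fun p : ℝ × ℝ => G.jac p.1 0 p.2 :=
    G.continuous_jac.comp (by fun_prop : Continuous fun p : ℝ × ℝ => (p.1, (0 : ℝ), p.2))
  have h3 := G.continuous
  have h4 := G.continuous_guu
  unfold expoIntegrand
  fun_prop

theorem hasDerivAt_expo (s : ℝ) :
    HasDerivAt G.expo (G.gu (s, 0) + ∫ τ in (0 : ℝ)..s, G.expoIntegrand s τ) s := by
  have h1 : Continuous fun p : ℝ × ℝ => G.flow p.1 0 p.2 :=
    G.continuous_flow.comp (by fun_prop : Continuous fun p : ℝ × ℝ => (p.1, (0 : ℝ), p.2))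
  have h := hasDerivAt_integral_leibniz (q := fun s τ => G.gu (τ, G.flow s 0 τ))
    (q' := G.expoIntegrand) (G.contDiff_gu.continuous.comp (continuous_snd.prodMk h1))
    G.continuous_expoIntegrand (fun s τ =>
      (G.hasDerivAt_gu_snd τ _).comp s (G.hasDerivAt_flow_left s 0 τ)) 0 s
  simp only [flow_self] at h
  exact h

@[simp] theorem expo_zero : G.expo 0 = 0 := by simp [expo]

theorem continuous_expo : Continuous G.expo :=
  continuous_iff_continuousAt.mpr fun s => (G.hasDerivAt_expo s).continuousAt

/-- The third derivative exists although `g` is only of class `C²`. The derivative of `ell` is `-g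
(s, 0) * exp (-expo s)`, and `expo'` is the sum of `gu (s, 0)` and of an integral from `0` to `s`
with a continuous integrand. That integral is differentiable at `s = 0`, with derivative the value
of the integrand there (`hasDerivAt_integral_diag`). -/
theorem hasJet3_ell : HasJet3 G.ell (-G.g 0) (-G.gs 0 + G.g 0 * G.gu 0)
    (-G.gss 0 + 2 * G.gs 0 * G.gu 0 + G.g 0 * (G.gus 0 - G.g 0 * G.guu 0)
      - G.g 0 * G.gu 0 ^ 2) := by
  have hE : ∀ s, HasDerivAt (fun s => Real.exp (-G.expo s)) (Real.exp (-G.expo s) *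
      -(G.gu (s, 0) + ∫ τ in (0 : ℝ)..s, G.expoIntegrand s τ)) s :=
    fun s => (G.hasDerivAt_expo s).neg.exp
  have hI : HasDerivAt (fun s => G.gu (s, 0) + ∫ τ in (0 : ℝ)..s, G.expoIntegrand s τ)
      (G.gus (0, 0) + G.expoIntegrand 0 0) 0 :=
    (G.hasDerivAt_gu_fst 0 0).add (hasDerivAt_integral_diag G.continuous_expoIntegrand 0)
  refine ⟨G.ell_zero, fun s => -(G.g (s, 0)) * Real.exp (-G.expo s),
    fun s => -(G.gs (s, 0)) * Real.exp (-G.expo s) + -(G.g (s, 0)) * (Real.exp (-G.expo s) *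
      -(G.gu (s, 0) + ∫ τ in (0 : ℝ)..s, G.expoIntegrand s τ)),
    Eventually.of_forall G.hasDerivAt_ell, Eventually.of_forall fun s => ?_, ?_, ?_, ?_⟩
  · exact (G.hasDerivAt_fst s 0).neg.mul (hE s)
  · refine (((G.hasDerivAt_gs_fst 0 0).neg.mul (hE 0)).add
      ((G.hasDerivAt_fst 0 0).neg.mul ((hE 0).mul hI.neg))).congr_deriv ?_
    have h0 : ((0 : ℝ), (0 : ℝ)) = 0 := rfl
    simp [expoIntegrand, h0, jac]
    ring
  · have h0 : ((0 : ℝ), (0 : ℝ)) = 0 := rfl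
    simp [h0]
  · have h0 : ((0 : ℝ), (0 : ℝ)) = 0 := rfl
    simp [h0]

end Slope

end

section

/-! ### Slopes which are close to a constant -/

/-- The slope is close to the constant `c`, and so is the derivative of the transition map to the
slope `-c`. -/
structure Slope.Near (G : Slope) (c η : ℝ) : Prop where
  close : ∀ p, |G.g p - c| ≤ η * |c|
  expo_le : ∀ s, |G.expo s| ≤ η

/-- The integrand vanishes for `|τ| ≥ R`, so the interval of integration can be cut at `R` or `-R`.
-/
theorem Slope.abs_expo_le (G : Slope) {K R : ℝ} (hR : 0 ≤ R) (hK : ∀ p, |G.gu p| ≤ K)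
    (h0 : ∀ p : ℝ × ℝ, R ≤ |p.1| → G.gu p = 0) (s : ℝ) : |G.expo s| ≤ K * R := by
  have hK0 : 0 ≤ K := (abs_nonneg _).trans (hK 0)
  have hint : ∀ a b, IntervalIntegrable (fun τ => G.gu (τ, G.flow s 0 τ))
      MeasureTheory.volume a b := fun a b => Continuous.intervalIntegrable
    (G.contDiff_gu.continuous.comp (continuous_id.prodMk (G.continuous_flow_right s 0))) _ _
  have hz : ∀ b, |b| ≤ R → (∀ τ ∈ uIoc b s, R ≤ |τ|) → |G.expo s| ≤ K * R := by
    intro b hbR hb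
    have h1 : ∫ τ in b..s, G.gu (τ, G.flow s 0 τ) = 0 :=
      intervalIntegral.integral_zero_ae (Eventually.of_forall fun τ hτ => h0 _ (hb τ hτ))
    have h2 := intervalIntegral.integral_add_adjacent_intervals (hint 0 b) (hint b s)
    rw [h1, add_zero] at h2
    have h3 : |G.expo s| ≤ K * |b - 0| := by
      rw [expo, ← h2, ← Real.norm_eq_abs]
      exact intervalIntegral.norm_integral_le_of_norm_le_const fun τ _ => hK (τ, G.flow s 0 τ)
    rw [sub_zero] at h3
    exact h3.trans (by gcongr)
  rcases le_or_gt |s| R with h | h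
  · exact hz s h fun τ hτ => by simp at hτ
  · rcases le_or_gt 0 s with hs | hs
    · rw [abs_of_nonneg hs] at h
      refine hz R (abs_of_nonneg hR).le fun τ hτ => ?_
      rw [uIoc_of_le h.le] at hτ
      exact hτ.1.le.trans (le_abs_self τ)
    · rw [abs_of_neg hs] at h
      refine hz (-R) (by rw [abs_neg, abs_of_nonneg hR]) fun τ hτ => ?_
      rw [uIoc_of_ge (by linarith)] at hτ
      exact (le_neg.mpr hτ.2).trans (neg_le_abs τ)

/-- The slope `f` is replaced by `f 0 + χ (p / ε) * (f p - f 0)`. This agrees with `f` near the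
origin, is constant outside a ball of radius `2 * ε`, and its `u`-derivative is bounded uniformly in
`ε`. The exponent `expo`, an integral over a set of size `O(ε)`, is therefore small. -/
theorem exists_slope {f : ℝ × ℝ → ℝ} (hf : ContDiffAt ℝ 2 f 0) (h0 : f 0 ≠ 0) {η : ℝ}
    (hη : 0 < η) : ∃ G : Slope, G.g =ᶠ[𝓝 0] f ∧ G.Near (f 0) η := by
  obtain ⟨χ⟩ : Nonempty {χ : ContDiffBump (0 : ℝ × ℝ) // χ.rIn = 1 ∧ χ.rOut = 2} :=
    ⟨⟨⟨1, 2, one_pos, one_lt_two⟩, rfl, rfl⟩⟩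
  obtain ⟨χ, hin, hout⟩ := χ
  have hχd : ContDiff ℝ 2 χ := χ.contDiff
  obtain ⟨C, hC⟩ : ∃ C : ℝ, ∀ p, ‖fderiv ℝ χ p‖ ≤ C := by
    have h1 : HasCompactSupport (fderiv ℝ χ) := χ.hasCompactSupport.fderiv ℝ
    exact h1.exists_bound_of_continuous (hχd.continuous_fderiv (by norm_num))
  have hC0 : 0 ≤ C := (norm_nonneg _).trans (hC 0)
  set L : ℝ := ‖fderiv ℝ f 0‖ + 1 with hL
  have hL0 : 0 < L := by positivity
  obtain ⟨r, hr, hfr⟩ : ∃ r > 0, ∀ p : ℝ × ℝ, ‖p‖ < r →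
      ContDiffAt ℝ 2 f p ∧ ‖fderiv ℝ f p‖ ≤ L := by
    have h1 := hf.eventually (by simp)
    have h2 : ContinuousAt (fderiv ℝ f) 0 :=
      (hf.fderiv_right (m := 1) (by norm_num)).continuousAt
    have h3 : ∀ᶠ p in 𝓝 (0 : ℝ × ℝ), ‖fderiv ℝ f p‖ ≤ L :=
      (h2.norm.eventually (gt_mem_nhds (show ‖fderiv ℝ f 0‖ < L by linarith))).mono
        fun _ h => le_of_lt h
    obtain ⟨r, hr, h⟩ := Metric.eventually_nhds_iff.mp (h1.and h3)
    exact ⟨r, hr, fun p hp => h (by simpa using hp)⟩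
  have hlip : ∀ p : ℝ × ℝ, ‖p‖ < r → |f p - f 0| ≤ L * ‖p‖ := by
    intro p hp
    have := (convex_ball (0 : ℝ × ℝ) r).norm_image_sub_le_of_norm_fderiv_le (𝕜 := ℝ) (f := f)
      (C := L) (x := 0) (y := p)
      (fun q hq => (hfr q (by simpa using hq)).1.differentiableAt (by norm_num))
      (fun q hq => (hfr q (by simpa using hq)).2) (by simpa using hr) (by simpa using hp)
    simpa using this
  -- A bound of the derivative of the cut-off slope that does not depend on the scale `ε`: the
  -- factor `ε⁻¹` from the rescaled bump is compensated by `|f p - f 0| ≤ L * (2 * ε)` on its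
  -- support.
  set K : ℝ := 2 * C * L + L with hK
  have hK0 : 0 < K := by positivity
  obtain ⟨ε, hε, hε1, hε2, hε3⟩ : ∃ ε : ℝ, 0 < ε ∧ 2 * ε < r ∧ K * (3 * ε) ≤ η ∧
      L * (2 * ε) ≤ η * |f 0| := by
    have hf0 : 0 < |f 0| := abs_pos.mpr h0
    have e1 : ∀ᶠ ε in 𝓝[>] (0 : ℝ), 2 * ε < r :=
      ((by fun_prop : Continuous fun ε : ℝ => 2 * ε).tendsto' 0 0 (by simp)).eventually
        (gt_mem_nhds hr) |>.filter_mono nhdsWithin_le_nhds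
    have e2 : ∀ᶠ ε in 𝓝[>] (0 : ℝ), K * (3 * ε) < η :=
      ((by fun_prop : Continuous fun ε : ℝ => K * (3 * ε)).tendsto' 0 0 (by simp)).eventually
        (gt_mem_nhds hη) |>.filter_mono nhdsWithin_le_nhds
    have e3 : ∀ᶠ ε in 𝓝[>] (0 : ℝ), L * (2 * ε) < η * |f 0| :=
      ((by fun_prop : Continuous fun ε : ℝ => L * (2 * ε)).tendsto' 0 0 (by simp)).eventually
        (gt_mem_nhds (by positivity)) |>.filter_mono nhdsWithin_le_nhds
    obtain ⟨ε, h, h0⟩ := ((e1.and (e2.and e3)).and self_mem_nhdsWithin).exists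
    exact ⟨ε, h0, h.1, h.2.1.le, h.2.2.le⟩
  set g : ℝ × ℝ → ℝ := fun p => f 0 + χ (ε⁻¹ • p) * (f p - f 0) with hg
  have hzero : ∀ p : ℝ × ℝ, 2 * ε ≤ ‖p‖ → χ (ε⁻¹ • p) = 0 := by
    intro p hp
    refine χ.zero_of_le_dist ?_
    rw [hout, dist_zero_right, norm_smul, norm_inv, Real.norm_of_nonneg hε.le]
    rw [inv_mul_eq_div, le_div_iff₀ hε]
    exact hp
  have hfar : ∀ p : ℝ × ℝ, 2 * ε < ‖p‖ → g =ᶠ[𝓝 p] fun _ => f 0 := by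
    intro p hp
    filter_upwards [continuous_norm.tendsto p |>.eventually (lt_mem_nhds hp)] with q hq
    simp [hg, hzero q hq.le]
  have hχε : ∀ p, HasFDerivAt (fun p : ℝ × ℝ => χ (ε⁻¹ • p)) (ε⁻¹ • fderiv ℝ χ (ε⁻¹ • p)) p := by
    intro p
    have h1 : HasFDerivAt χ (fderiv ℝ χ (ε⁻¹ • p)) (ε⁻¹ • p) :=
      (hχd.differentiable (by norm_num) _).hasFDerivAt
    have h2 : HasFDerivAt (fun p : ℝ × ℝ => ε⁻¹ • p)
        (ε⁻¹ • ContinuousLinearMap.id ℝ (ℝ × ℝ)) p := (hasFDerivAt_id p).const_smul ε⁻¹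
    refine (h1.comp p h2).congr_fderiv ?_
    ext <;> simp
  have hgd : ContDiff ℝ 2 g := by
    rw [contDiff_iff_contDiffAt]
    intro p
    rcases lt_or_ge ‖p‖ r with hp | hp
    · exact contDiffAt_const.add
        ((hχd.contDiffAt.comp p (contDiffAt_id.const_smul ε⁻¹)).mul
          ((hfr p hp).1.sub contDiffAt_const))
    · exact contDiffAt_const.congr_of_eventuallyEq (hfar p (hε1.trans_le hp))
  have hclose : ∀ p, |g p - f 0| ≤ L * (2 * ε) := by
    intro p
    rcases lt_or_ge ‖p‖ (2 * ε) with hp | hp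
    · have h1 : |χ (ε⁻¹ • p)| ≤ 1 := by rw [abs_of_nonneg χ.nonneg]; exact χ.le_one
      calc |g p - f 0| = |χ (ε⁻¹ • p)| * |f p - f 0| := by simp [hg, abs_mul]
        _ ≤ 1 * (L * ‖p‖) := by gcongr; exact hlip p (hp.trans hε1)
        _ ≤ _ := by rw [one_mul]; gcongr
    · simp [hg, hzero p hp]; positivity
  have hfd0 : ∀ p : ℝ × ℝ, 2 * ε < ‖p‖ → fderiv ℝ g p = 0 := by
    intro p hp
    rw [(hfar p hp).fderiv_eq]
    simp
  have hfd : ∀ p, |fderiv ℝ g p (0, 1)| ≤ K := by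
    intro p
    rcases le_or_gt ‖p‖ (2 * ε) with hp | hp
    · have hpr := hp.trans_lt hε1
      have h1 : HasFDerivAt f (fderiv ℝ f p) p :=
        ((hfr p hpr).1.differentiableAt (by norm_num)).hasFDerivAt
      have h2 := ((hχε p).mul (h1.sub_const (f 0))).const_add (f 0)
      have h3 : fderiv ℝ g p = _ := h2.fderiv
      have hn : ‖((0 : ℝ), (1 : ℝ))‖ ≤ 1 := by simp [Prod.norm_def]
      have h4 : |fderiv ℝ χ (ε⁻¹ • p) (0, 1)| ≤ C := by
        have := (fderiv ℝ χ (ε⁻¹ • p)).le_of_opNorm_le_of_le (hC _) hn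
        simpa using this
      have h5 : |fderiv ℝ f p (0, 1)| ≤ L := by
        have := (fderiv ℝ f p).le_of_opNorm_le_of_le (hfr p hpr).2 hn
        simpa using this
      have h6 : |χ (ε⁻¹ • p)| ≤ 1 := by rw [abs_of_nonneg χ.nonneg]; exact χ.le_one
      have h7 := hlip p hpr
      rw [h3]
      simp only [_root_.add_apply, _root_.smul_apply, smul_eq_mul]
      calc _ ≤ |χ (ε⁻¹ • p) * fderiv ℝ f p (0, 1)| +
            |(f p - f 0) * (ε⁻¹ * fderiv ℝ χ (ε⁻¹ • p) (0, 1))| := abs_add_le _ _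
        _ = |χ (ε⁻¹ • p)| * |fderiv ℝ f p (0, 1)| +
            |f p - f 0| * (ε⁻¹ * |fderiv ℝ χ (ε⁻¹ • p) (0, 1)|) := by
          rw [abs_mul, abs_mul, abs_mul, abs_of_pos (inv_pos.mpr hε)]
        _ ≤ 1 * L + (L * (2 * ε)) * (ε⁻¹ * C) := by
          gcongr
          exact h7.trans (by gcongr)
        _ = K := by rw [hK]; field_simp; ring
    · rw [hfd0 p hp]; simpa using hK0.le
  let G : Slope := ⟨g, hgd, ⟨|f 0| + L * (2 * ε), fun p => by
    have h1 := hclose p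
    calc |g p| = |f 0 + (g p - f 0)| := by ring_nf
      _ ≤ |f 0| + |g p - f 0| := abs_add_le _ _
      _ ≤ _ := by gcongr⟩, ⟨K, hfd⟩⟩
  refine ⟨G, ?_, fun p => (hclose p).trans hε3, fun s => ?_⟩
  · have h1 : ∀ᶠ p in 𝓝 (0 : ℝ × ℝ), ‖p‖ < ε :=
      (continuous_norm.tendsto' 0 0 (by simp)).eventually (gt_mem_nhds hε)
    filter_upwards [h1] with p hp
    have : χ (ε⁻¹ • p) = 1 := by
      refine χ.one_of_mem_closedBall ?_
      rw [mem_closedBall_zero_iff, hin, norm_smul, norm_inv, Real.norm_of_nonneg hε.le,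
        inv_mul_eq_div, div_le_one hε]
      exact hp.le
    simp [G, hg, this]
  -- The derivative is known to vanish only where `2 * ε < ‖p‖`, a strict inequality; the radius `3
  -- * ε` leaves room for it.
  · refine (G.abs_expo_le (K := K) (R := 3 * ε) (by positivity) hfd (fun p hp => ?_) s).trans hε2
    have h3 : 3 * ε ≤ ‖p‖ := hp.trans (norm_fst_le p)
    have : 2 * ε < ‖p‖ := by linarith
    change fderiv ℝ g p (0, 1) = 0
    rw [hfd0 p this]; rfl

end

section

/-! ### Linearization of contractions of the line -/

theorem exists_orderIso_of_deriv {f f1 : ℝ → ℝ} {m : ℝ} (hm : 0 < m)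
    (hf : ∀ x, HasDerivAt f (f1 x) x) (h1 : ∀ x, m ≤ f1 x) : ∃ e : ℝ ≃o ℝ, ∀ x, e x = f x := by
  have hmono : StrictMono f := strictMono_of_deriv_pos fun x => by
    rw [(hf x).deriv]; exact hm.trans_le (h1 x)
  have hcont : Continuous f := continuous_iff_continuousAt.mpr fun x => (hf x).continuousAt
  have hlin : Monotone fun x => f x - m * x := by
    refine monotone_of_deriv_nonneg (fun x => ((hf x).sub ((hasDerivAt_id x).const_mul
      m)).differentiableAt) fun x => ?_
    have := ((hf x).sub ((hasDerivAt_id x).const_mul m)).deriv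
    change deriv (f - fun y => m * id y) x ≥ 0
    rw [this]
    linarith [h1 x]
  have htop : Tendsto f atTop atTop := by
    refine tendsto_atTop_mono' _ (f₁ := fun x => m * x + f 0) ?_ ?_
    · filter_upwards [eventually_ge_atTop 0] with x hx
      have := hlin hx
      simp only [mul_zero, sub_zero] at this
      linarith
    · exact tendsto_atTop_add_const_right _ _ (tendsto_id.const_mul_atTop hm)
  have hbot : Tendsto f atBot atBot := by
    refine tendsto_atBot_mono' _ (f₁ := fun x => m * x + f 0) ?_ ?_
    · filter_upwards [eventually_le_atBot 0] with x hx
      have := hlin hx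
      simp only [mul_zero, sub_zero] at this
      linarith
    · exact tendsto_atBot_add_const_right _ _ (tendsto_id.const_mul_atBot hm)
  exact ⟨hmono.orderIsoOfSurjective f (hcont.surjective htop hbot), fun x => rfl⟩

/-- The product `D x` of the ratios `F1 (F^[n] x) / F1 0` over all `n ≥ 0` satisfies `F1 0 * D x = D
(F x) * F1 x`, so its primitive `ψ` satisfies `ψ (F x) = F1 0 * ψ x`. The product converges because
the iterates decay geometrically and the logarithm of the ratio at `z` is `O(|z|)`. For the latter,
differentiability of `F1` at the origin alone suffices. -/
theorem exists_linearization {F F1 : ℝ → ℝ} {q m b : ℝ} (hF : ∀ x, HasDerivAt F (F1 x) x)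
    (hc : Continuous F1) (h0 : F 0 = 0) (hb : HasDerivAt F1 b 0) (hq : q < 1) (hm : 0 < m)
    (hFq : ∀ x, -q ≤ F1 x) (hFm : ∀ x, F1 x ≤ -m) :
    ∃ ψ : ℝ ≃o ℝ, ψ 0 = 0 ∧ ∀ x, ψ (F x) = F1 0 * ψ x := by
  set α := F1 0 with hα
  have hα0 : α < 0 := (hFm 0).trans_lt (by linarith)
  have hq0 : 0 ≤ q := by linarith [hFq 0, hFm 0]
  have hFc : Continuous F := continuous_iff_continuousAt.mpr fun x => (hF x).continuousAt
  have hFabs : ∀ x, |F x| ≤ q * |x| := by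
    intro x
    have := convex_univ.norm_image_sub_le_of_norm_hasDerivWithin_le (f := F) (C := q) (x := 0)
      (y := x) (fun y _ => (hF y).hasDerivWithinAt) (fun y _ => by
        rw [Real.norm_eq_abs, abs_le]; exact ⟨hFq y, by linarith [hFm y]⟩)
      (mem_univ _) (mem_univ _)
    simpa [h0] using this
  have hiter : ∀ n x, |F^[n] x| ≤ q ^ n * |x| := by
    intro n
    induction n with
    | zero => intro x; simp
    | succ n ih =>
      intro x
      rw [Function.iterate_succ_apply', pow_succ', mul_assoc]
      exact (hFabs _).trans (by gcongr; exact ih x)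
  set L : ℝ → ℝ := fun z => Real.log (F1 z / α) with hL
  have hpos : ∀ z, 0 < F1 z / α := fun z =>
    div_pos_of_neg_of_neg ((hFm z).trans_lt (by linarith)) hα0
  have hLc : Continuous L := (hc.div_const α).log fun z => (hpos z).ne'
  have hL0 : L 0 = 0 := by simp [hL, ← hα, div_self hα0.ne]
  -- Near `0` the bound is the differentiability of `L` at `0`; for `|z| ≥ r` it follows from the
  -- boundedness of `L`.
  obtain ⟨C, hC0, hC⟩ : ∃ C : ℝ, 0 ≤ C ∧ ∀ z, |L z| ≤ C * |z| := by
    have hd : HasDerivAt L (b / α / (F1 0 / α)) 0 := (hb.div_const α).log (hpos 0).ne'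
    have hO := hd.isBigO_sub
    rw [Asymptotics.isBigO_iff] at hO
    obtain ⟨C1, hO⟩ := hO
    obtain ⟨r, hr, hr'⟩ := Metric.eventually_nhds_iff.mp hO
    set B : ℝ := |Real.log (m / -α)| + |Real.log (q / -α)|
    have hB : ∀ z, |L z| ≤ B := by
      intro z
      have e : F1 z / α = (-F1 z) / -α := (neg_div_neg_eq _ _).symm
      have h1 : Real.log (m / -α) ≤ L z := by
        simp only [hL]; rw [e]
        exact Real.log_le_log (by apply div_pos hm; linarith)
          (by have := hFm z; gcongr <;> linarith)
      have h2 : L z ≤ Real.log (q / -α) := by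
        have := hpos z
        simp only [hL]; rw [e] at this ⊢
        exact Real.log_le_log this (by have := hFq z; gcongr <;> linarith)
      rw [abs_le]
      constructor
      · have := neg_abs_le (Real.log (m / -α))
        have := abs_nonneg (Real.log (q / -α))
        simp only [B]; linarith
      · have := le_abs_self (Real.log (q / -α))
        have := abs_nonneg (Real.log (m / -α))
        simp only [B]; linarith
    have hB0 : 0 ≤ B := by positivity
    refine ⟨|C1| + B / r, by positivity, fun z => ?_⟩
    rcases lt_or_ge |z| r with hz | hz
    · have h1 := hr' (y := z) (by simpa using hz)
      rw [hL0, sub_zero, sub_zero, Real.norm_eq_abs, Real.norm_eq_abs] at h1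
      calc |L z| ≤ C1 * |z| := h1
        _ ≤ |C1| * |z| := by gcongr; exact le_abs_self _
        _ ≤ _ := by gcongr; linarith [div_nonneg hB0 hr.le]
    · calc |L z| ≤ B := hB z
        _ = B / r * r := by field_simp
        _ ≤ B / r * |z| := by gcongr
        _ ≤ _ := by gcongr; linarith [abs_nonneg C1]
  have hterm : ∀ n x, |L (F^[n] x)| ≤ C * |x| * q ^ n := fun n x =>
    (hC _).trans (by
      calc C * |F^[n] x| ≤ C * (q ^ n * |x|) := by gcongr; exact hiter n x
        _ = _ := by ring)
  have hgeo : Summable fun n : ℕ => q ^ n := summable_geometric_of_lt_one hq0 hq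
  have hsum : ∀ x, Summable fun n => L (F^[n] x) := fun x =>
    Summable.of_norm_bounded (hgeo.mul_left (C * |x|)) fun n => hterm n x
  set S : ℝ → ℝ := fun x => ∑' n, L (F^[n] x) with hS
  have hSc : Continuous S := by
    rw [continuous_iff_continuousAt]
    intro x
    have hon : ContinuousOn S (Metric.ball 0 (|x| + 1)) := by
      refine continuousOn_tsum (u := fun n => C * (|x| + 1) * q ^ n)
        (fun n => (hLc.comp (hFc.iterate n)).continuousOn) (hgeo.mul_left _) fun n y hy => ?_
      refine (hterm n y).trans ?_
      have : |y| ≤ |x| + 1 := by simpa using (mem_ball_zero_iff.mp hy).le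
      gcongr
    exact hon.continuousAt (Metric.isOpen_ball.mem_nhds (by simp))
  have hSF : ∀ x, S x = L x + S (F x) := by
    intro x
    simp only [hS]
    rw [(hsum x).tsum_eq_zero_add]
    simp
  set D : ℝ → ℝ := fun x => Real.exp (S x)
  have hDc : Continuous D := Real.continuous_exp.comp hSc
  have hDF : ∀ x, α * D x = D (F x) * F1 x := by
    intro x
    simp only [D]
    rw [hSF x, Real.exp_add, Real.exp_log (hpos x), ← mul_assoc, mul_div_cancel₀ _ hα0.ne,
      mul_comm]
  set ψ : ℝ → ℝ := fun x => ∫ t in (0 : ℝ)..x, D t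
  have hψ : ∀ x, HasDerivAt ψ (D x) x := fun x =>
    intervalIntegral.integral_hasDerivAt_right (hDc.intervalIntegrable _ _)
      (hDc.stronglyMeasurableAtFilter _ _) hDc.continuousAt
  have hψ0 : ψ 0 = 0 := by simp [ψ]
  have hψF : ∀ x, ψ (F x) = α * ψ x := by
    intro x
    have hd : ∀ x, HasDerivAt (fun x => ψ (F x) - α * ψ x) 0 x := by
      intro x
      refine (((hψ (F x)).comp x (hF x)).sub ((hψ x).const_mul α)).congr_deriv ?_
      rw [hDF x, sub_self]
    have := is_const_of_deriv_eq_zero (fun x => (hd x).differentiableAt) (fun x => (hd x).deriv) x 0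
    simp only [h0, hψ0, mul_zero, sub_zero] at this
    linarith
  have hmono : StrictMono ψ := strictMono_of_deriv_pos fun x => by
    rw [(hψ x).deriv]; exact Real.exp_pos _
  have hψc : Continuous ψ := continuous_iff_continuousAt.mpr fun x => (hψ x).continuousAt
  have hFs : Function.Surjective F := by
    obtain ⟨e, he⟩ := exists_orderIso_of_deriv hm (f := fun x => -F x) (f1 := fun x => -F1 x)
      (fun x => (hF x).neg) (fun x => by linarith [hFm x])
    intro y
    refine ⟨e.symm (-y), ?_⟩
    have := he (e.symm (-y))
    rw [e.apply_symm_apply] at this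
    linarith
  have hψ1 : 0 < ψ 1 := by rw [← hψ0]; exact hmono one_pos
  -- As `F` is onto, the range of `ψ` is stable under division by `α`. These points alternate in
  -- sign and are unbounded, which makes `ψ` onto.
  have hrange : ∀ n : ℕ, ∃ z, ψ z = (α⁻¹) ^ n * ψ 1 := by
    intro n
    induction n with
    | zero => exact ⟨1, by simp⟩
    | succ n ih =>
      obtain ⟨z, hz⟩ := ih
      obtain ⟨z', rfl⟩ := hFs z
      refine ⟨z', ?_⟩
      rw [hψF] at hz
      rw [pow_succ', mul_assoc, ← hz, inv_mul_cancel_left₀ hα0.ne]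
  have hα1 : 1 < (α⁻¹) ^ 2 := by
    rw [inv_pow]
    refine (one_lt_inv₀ (sq_pos_of_neg hα0)).mpr ?_
    have := hFq 0
    nlinarith
  have hsurj : Function.Surjective ψ := by
    intro y
    refine mem_range_of_exists_le_of_exists_ge hψc ?_ ?_
    · obtain ⟨n, hn⟩ := pow_unbounded_of_one_lt (-y * (-α) / ψ 1) hα1
      obtain ⟨z, hz⟩ := hrange (2 * n + 1)
      refine ⟨z, ?_⟩
      rw [hz, pow_succ, pow_mul]
      rw [div_lt_iff₀ hψ1] at hn
      have h2 : ((α⁻¹) ^ 2) ^ n * α⁻¹ * ψ 1 = -((((α⁻¹) ^ 2) ^ n * ψ 1) / (-α)) := by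
        field_simp
      rw [h2]
      have h3 : -y < (((α⁻¹) ^ 2) ^ n * ψ 1) / (-α) := by
        rw [lt_div_iff₀ (by linarith)]; exact hn
      linarith
    · obtain ⟨n, hn⟩ := pow_unbounded_of_one_lt (y / ψ 1) hα1
      obtain ⟨z, hz⟩ := hrange (2 * n)
      refine ⟨z, ?_⟩
      rw [hz, pow_mul]
      rw [div_lt_iff₀ hψ1] at hn
      exact hn.le
  exact ⟨hmono.orderIsoOfSurjective ψ hsurj, hψ0, hψF⟩

/-- The odd extension of the power `x ↦ x ^ c`. -/
def oddPow (c x : ℝ) : ℝ := if 0 ≤ x then x ^ c else -(-x) ^ c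

theorem oddPow_of_nonneg {c x : ℝ} (hx : 0 ≤ x) : oddPow c x = x ^ c := if_pos hx

theorem oddPow_neg {c : ℝ} (hc : 0 < c) (x : ℝ) : oddPow c (-x) = -oddPow c x := by
  unfold oddPow
  rcases lt_trichotomy x 0 with h | rfl | h
  · rw [if_pos (by linarith), if_neg (by linarith), neg_neg]
  · simp [Real.zero_rpow hc.ne']
  · rw [if_neg (by linarith), if_pos h.le, neg_neg]

theorem oddPow_oddPow {c : ℝ} (hc : 0 < c) (x : ℝ) : oddPow c⁻¹ (oddPow c x) = x := by
  have key : ∀ x, 0 ≤ x → oddPow c⁻¹ (oddPow c x) = x := fun x hx => by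
    rw [oddPow_of_nonneg hx, oddPow_of_nonneg (Real.rpow_nonneg hx _),
      Real.rpow_rpow_inv hx hc.ne']
  rcases le_total 0 x with h | h
  · exact key x h
  · have := key (-x) (by linarith)
    rw [oddPow_neg hc, oddPow_neg (inv_pos.mpr hc)] at this
    linarith

theorem oddPow_mono {c : ℝ} (hc : 0 < c) : Monotone (oddPow c) := by
  have key : ∀ x, 0 ≤ x → 0 ≤ oddPow c x := fun x hx => by
    rw [oddPow_of_nonneg hx]; exact Real.rpow_nonneg hx _
  have key2 : ∀ x y, 0 ≤ x → x ≤ y → oddPow c x ≤ oddPow c y := fun x y hx hxy => by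
    rw [oddPow_of_nonneg hx, oddPow_of_nonneg (hx.trans hxy)]
    exact Real.rpow_le_rpow hx hxy hc.le
  intro x y hxy
  rcases le_total 0 x with hx | hx
  · exact key2 x y hx hxy
  · rcases le_total 0 y with hy | hy
    · have := key (-x) (by linarith)
      rw [oddPow_neg hc] at this
      linarith [key y hy]
    · have := key2 (-y) (-x) (by linarith) (by linarith)
      rw [oddPow_neg hc, oddPow_neg hc] at this
      linarith

/-- The conjugacy is the odd power with the exponent `c` for which `(-α) ^ c = -β`; it is positive
since both logarithms are negative. -/
theorem exists_orderIso_mul {α β : ℝ} (hα : α < 0) (hα1 : -1 < α) (hβ : β < 0) (hβ1 : -1 < β) :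
    ∃ P : ℝ ≃o ℝ, P 0 = 0 ∧ ∀ x, P (α * x) = β * P x := by
  set c : ℝ := Real.log (-β) / Real.log (-α) with hc
  have h1 : Real.log (-α) < 0 := Real.log_neg (by linarith) (by linarith)
  have h2 : Real.log (-β) < 0 := Real.log_neg (by linarith) (by linarith)
  have hc0 : 0 < c := div_pos_of_neg_of_neg h2 h1
  have hpow : (-α) ^ c = -β := by
    rw [Real.rpow_def_of_pos (by linarith), hc, mul_div_cancel₀ _ h1.ne, Real.exp_log (by linarith)]
  have hinv : ∀ x, oddPow c (oddPow c⁻¹ x) = x := fun x => by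
    simpa using oddPow_oddPow (inv_pos.mpr hc0) x
  have hinj : Function.Injective (oddPow c) :=
    Function.LeftInverse.injective (oddPow_oddPow hc0)
  have key : ∀ x, 0 ≤ x → oddPow c (α * x) = β * oddPow c x := fun x hx => by
    have e : α * x = -(-α * x) := by ring
    rw [e, oddPow_neg hc0, oddPow_of_nonneg (mul_nonneg (by linarith) hx), oddPow_of_nonneg hx,
      Real.mul_rpow (by linarith) hx, hpow]
    ring
  refine ⟨((oddPow_mono hc0).strictMono_of_injective hinj).orderIsoOfSurjective (oddPow c)
    fun y => ⟨_, hinv y⟩, ?_, fun x => ?_⟩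
  · change oddPow c 0 = 0
    simp [oddPow, Real.zero_rpow hc0.ne']
  · change oddPow c (α * x) = β * oddPow c x
    rcases le_total 0 x with hx | hx
    · exact key x hx
    · have := key (-x) (by linarith)
      rw [mul_neg, oddPow_neg hc0, oddPow_neg hc0] at this
      linarith

/-- An increasing diffeomorphism of the line which fixes the origin, with derivative between `lo`
and `hi`. -/
structure IsTransition (A : ℝ ≃o ℝ) (lo hi : ℝ) : Prop where
  zero : A 0 = 0
  pos : 0 < lo
  exists_deriv : ∃ A1 : ℝ → ℝ, (∀ x, HasDerivAt A (A1 x) x) ∧ Continuous A1 ∧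
    (∃ b, HasDerivAt A1 b 0) ∧ ∀ x, lo ≤ A1 x ∧ A1 x ≤ hi

/-- The return map `A⁻¹ ∘ (-B)` has derivative between `-b' / a` and `-b / a'`, so `b' < a` makes it
a decreasing contraction of the whole line. -/
theorem exists_linearization_pair {A B : ℝ ≃o ℝ} {a a' b b' : ℝ} (hA : IsTransition A a a')
    (hB : IsTransition B b b') (hlt : b' < a) :
    ∃ (ψ : ℝ ≃o ℝ) (α : ℝ), α < 0 ∧ -1 < α ∧ ψ 0 = 0 ∧
      ∀ x, ψ (A.symm (-B x)) = α * ψ x := by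
  obtain ⟨hA0, ha, A1, hA1, hAc, ⟨c, hc⟩, hAb⟩ := hA
  obtain ⟨hB0, hb, B1, hB1, hBc, ⟨d, hd⟩, hBb⟩ := hB
  set F : ℝ → ℝ := fun x => A.symm (-B x) with hF
  have hBpos : ∀ x, 0 < B1 x := fun x => hb.trans_le (hBb x).1
  have hApos : ∀ x, 0 < A1 x := fun x => ha.trans_le (hAb x).1
  have hF0 : F 0 = 0 := by
    simp only [hF, hB0, neg_zero]; rw [← hA0, A.symm_apply_apply, hA0]
  have hAs : ∀ y, HasDerivAt A.symm (A1 (A.symm y))⁻¹ y := fun y =>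
    HasDerivAt.of_local_left_inverse A.symm.continuous.continuousAt (hA1 _) (hApos _).ne'
      (Eventually.of_forall fun y => A.apply_symm_apply y)
  have hFd : ∀ x, HasDerivAt F (-(B1 x / A1 (F x))) x := fun x => by
    refine ((hAs (-B x)).comp x (hB1 x).neg).congr_deriv ?_
    rw [mul_neg, div_eq_inv_mul]
  have hFc : Continuous F := continuous_iff_continuousAt.mpr fun x => (hFd x).continuousAt
  have hA10 : HasDerivAt A1 c (F 0) := by rw [hF0]; exact hc
  have hFlo : ∀ x, -(b' / a) ≤ -(B1 x / A1 (F x)) := fun x => by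
    refine neg_le_neg ?_
    have := (hBb x).2
    have := (hAb (F x)).1
    have := (hBpos x).le
    have : 0 ≤ b' := by linarith
    gcongr
  have ha' : 0 < a' := (hApos 0).trans_le (hAb 0).2
  have hFhi : ∀ x, -(B1 x / A1 (F x)) ≤ -(b / a') := fun x => by
    refine neg_le_neg ?_
    have := (hBb x).1
    have := (hAb (F x)).2
    have := hApos (F x)
    have := (hBpos x).le
    gcongr
  obtain ⟨ψ, hψ0, hψ⟩ := exists_linearization hFd
    ((hBc.div (hAc.comp hFc) fun x => (hApos _).ne').neg) hF0
    ((hd.div (hA10.comp 0 (hFd 0)) (hApos _).ne').neg)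
    (q := b' / a) (m := b / a') ((div_lt_one ha).mpr hlt) (div_pos hb ha') hFlo hFhi
  refine ⟨ψ, _, ?_, ?_, hψ0, hψ⟩
  · exact neg_neg_of_pos (div_pos (hBpos _) (hApos _))
  · have h1 := hFlo 0
    have h2 := (div_lt_one ha).mpr hlt
    linarith

/-- The first equation forces `κ = A' ∘ h ∘ A⁻¹`, and the second then says that `h` conjugates the
return maps `A⁻¹ ∘ (-B)` and `A'⁻¹ ∘ (-B')`. If these expand, exchanging `A` and `B` replaces the
return maps by their inverses. -/
theorem exists_conj_pair {A B A' B' : ℝ ≃o ℝ} {a1 a2 b1 b2 a1' a2' b1' b2' : ℝ}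
    (hA : IsTransition A a1 a2) (hB : IsTransition B b1 b2) (hA' : IsTransition A' a1' a2')
    (hB' : IsTransition B' b1' b2')
    (hlt : (b2 < a1 ∧ b2' < a1') ∨ (a2 < b1 ∧ a2' < b1')) :
    ∃ h κ : ℝ ≃o ℝ, h 0 = 0 ∧ κ 0 = 0 ∧ (∀ s, A' (h s) = κ (A s)) ∧
      ∀ s, -B' (h s) = κ (-B s) := by
  have key : ∀ {A B A' B' : ℝ ≃o ℝ} {a1 a2 b1 b2 a1' a2' b1' b2' : ℝ},
      IsTransition A a1 a2 → IsTransition B b1 b2 → IsTransition A' a1' a2' →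
      IsTransition B' b1' b2' → b2 < a1 → b2' < a1' →
      ∃ h : ℝ ≃o ℝ, h 0 = 0 ∧ ∀ x, h (A.symm (-B x)) = A'.symm (-B' (h x)) := by
    intro A B A' B' a1 a2 b1 b2 a1' a2' b1' b2' hA hB hA' hB' h1 h2
    obtain ⟨ψ, α, hα, hα1, hψ0, hψ⟩ := exists_linearization_pair hA hB h1
    obtain ⟨φ, β, hβ, hβ1, hφ0, hφ⟩ := exists_linearization_pair hA' hB' h2
    obtain ⟨P, hP0, hP⟩ := exists_orderIso_mul hα hα1 hβ hβ1
    refine ⟨(ψ.trans P).trans φ.symm, ?_, fun x => ?_⟩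
    · simp only [OrderIso.trans_apply, hψ0, hP0]
      rw [← hφ0, φ.symm_apply_apply, hφ0]
    · simp only [OrderIso.trans_apply, hψ, hP]
      apply φ.injective
      rw [hφ, φ.apply_symm_apply, φ.apply_symm_apply]
  have hs0 : ∀ {A : ℝ ≃o ℝ} {a a' : ℝ}, IsTransition A a a' → A.symm 0 = 0 := by
    intro A a a' hA
    rw [A.symm_apply_eq, hA.zero]
  rcases hlt with ⟨h1, h2⟩ | ⟨h1, h2⟩
  · obtain ⟨h, h0, hh⟩ := key hA hB hA' hB' h1 h2
    refine ⟨h, (A.symm.trans h).trans A', h0, ?_, fun s => ?_, fun s => ?_⟩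
    · simp [hs0 hA, h0, hA'.zero]
    · simp
    · simp [hh]
  · obtain ⟨h, h0, hh⟩ := key hB hA hB' hA' h1 h2
    refine ⟨h, (A.symm.trans h).trans A', h0, ?_, fun s => ?_, fun s => ?_⟩
    · simp [hs0 hA, h0, hA'.zero]
    · simp
    · have := hh (A.symm (-B s))
      simp only [OrderIso.apply_symm_apply, neg_neg, OrderIso.symm_apply_apply] at this
      simp [this]

/-- The ratio between the bounds of the derivative of the transition map of a slope which is close
to a constant. -/
def spread (η : ℝ) : ℝ := (1 + η) * Real.exp η / ((1 - η) * Real.exp (-η))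

/-- The sign `σ` (`1` for negative slopes, `-1` for positive ones) makes `σ * ell` increasing. The
bounds are those of the two factors of `ell' = -g (s, 0) * exp (-expo s)`. -/
theorem Slope.Near.exists_transition {G : Slope} {c η σ : ℝ} (hG : G.Near c η) (hη : η < 1)
    (hσ : σ = 1 ∨ σ = -1) (hc : σ * c < 0) :
    ∃ A : ℝ ≃o ℝ, (∀ s, A s = σ * G.ell s) ∧
      IsTransition A (-(σ * c) * ((1 - η) * Real.exp (-η)))
        (-(σ * c) * ((1 + η) * Real.exp η)) := by
  have habs : |c| = -(σ * c) := by
    rcases hσ with rfl | rfl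
    · rw [abs_of_neg (by linarith)]; ring
    · rw [abs_of_pos (by linarith)]; ring
  have hη0 : 0 ≤ η := (abs_nonneg _).trans (hG.expo_le 0)
  have hσc : 0 < -(σ * c) := by linarith
  have hlo : 0 < -(σ * c) * ((1 - η) * Real.exp (-η)) :=
    mul_pos hσc (mul_pos (by linarith) (Real.exp_pos _))
  have hd : ∀ s, HasDerivAt (fun s => σ * G.ell s)
      (-(σ * G.g (s, 0)) * Real.exp (-G.expo s)) s := fun s =>
    ((G.hasDerivAt_ell s).const_mul σ).congr_deriv (by ring)
  have hb : ∀ s, -(σ * c) * ((1 - η) * Real.exp (-η)) ≤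
      -(σ * G.g (s, 0)) * Real.exp (-G.expo s) ∧ -(σ * G.g (s, 0)) * Real.exp (-G.expo s) ≤
      -(σ * c) * ((1 + η) * Real.exp η) := by
    intro s
    have h1 := abs_le.mp (hG.expo_le s)
    have h2 := abs_le.mp (hG.close (s, 0))
    rw [habs] at h2
    have h3 : -(σ * c) * (1 - η) ≤ -(σ * G.g (s, 0)) ∧
        -(σ * G.g (s, 0)) ≤ -(σ * c) * (1 + η) := by
      rcases hσ with rfl | rfl <;> constructor <;> linarith [h2.1, h2.2]
    have h4 : 0 ≤ -(σ * c) * (1 - η) := mul_nonneg hσc.le (by linarith)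
    constructor
    · rw [← mul_assoc]
      exact mul_le_mul h3.1 (Real.exp_le_exp.mpr (by linarith [h1.2])) (Real.exp_pos _).le
        (h4.trans h3.1)
    · rw [← mul_assoc]
      exact mul_le_mul h3.2 (Real.exp_le_exp.mpr (by linarith [h1.1])) (Real.exp_pos _).le
        (h4.trans (h3.1.trans h3.2))
  obtain ⟨A, hA⟩ := exists_orderIso_of_deriv hlo hd fun s => (hb s).1
  have hA' : (A : ℝ → ℝ) = fun s => σ * G.ell s := funext hA
  refine ⟨A, hA, ?_, hlo, fun s => -(σ * G.g (s, 0)) * Real.exp (-G.expo s), ?_, ?_, ?_, hb⟩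
  · simp [hA]
  · rw [hA']; exact hd
  · have h1 := G.continuous
    have h2 := G.continuous_expo
    fun_prop
  · exact ⟨_, ((G.hasDerivAt_fst 0 0).const_mul σ).neg.mul (G.hasDerivAt_expo 0).neg.exp⟩

theorem exists_conj {GX GY HX HY : Slope} {cX cY dX dY η : ℝ} (hGX : GX.Near cX η)
    (hGY : GY.Near cY η) (hHX : HX.Near dX η) (hHY : HY.Near dY η) (hη : η < 1)
    (hcX : cX < 0) (hcY : 0 < cY) (hdX : dX < 0) (hdY : 0 < dY)
    (hlt : (cY * spread η < -cX ∧ dY * spread η < -dX) ∨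
      (-cX * spread η < cY ∧ -dX * spread η < dY)) :
    ∃ h κ : ℝ ≃o ℝ, h 0 = 0 ∧ κ 0 = 0 ∧ (∀ s, HX.ell (h s) = κ (GX.ell s)) ∧
      ∀ s, HY.ell (h s) = κ (GY.ell s) := by
  obtain ⟨A, hA, hA'⟩ := hGX.exists_transition hη (σ := 1) (Or.inl rfl) (by linarith)
  obtain ⟨B, hB, hB'⟩ := hGY.exists_transition hη (σ := -1) (Or.inr rfl) (by linarith)
  obtain ⟨C, hC, hC'⟩ := hHX.exists_transition hη (σ := 1) (Or.inl rfl) (by linarith)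
  obtain ⟨D, hD, hD'⟩ := hHY.exists_transition hη (σ := -1) (Or.inr rfl) (by linarith)
  have hp : 0 < (1 - η) * Real.exp (-η) := mul_pos (by linarith) (Real.exp_pos _)
  have key : ∀ x y : ℝ, x * spread η < y →
      x * ((1 + η) * Real.exp η) < y * ((1 - η) * Real.exp (-η)) := by
    intro x y h
    rw [spread, mul_div_assoc', div_lt_iff₀ hp] at h
    exact h
  obtain ⟨h, κ, h0, hκ, h1, h2⟩ := exists_conj_pair hA' hB' hC' hD' (by
    rcases hlt with ⟨h1, h2⟩ | ⟨h1, h2⟩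
    · left
      constructor
      · have := key _ _ h1; linarith
      · have := key _ _ h2; linarith
    · right
      constructor
      · have := key _ _ h1; linarith
      · have := key _ _ h2; linarith)
  refine ⟨h, κ, h0, hκ, fun s => ?_, fun s => ?_⟩
  · have := h1 s
    rw [hA, hC] at this
    simpa using this
  · have := h2 s
    rw [hB, hD] at this
    simpa using this

end

section

/-! ### Coordinates -/

/-- The point with coordinate `s` of index `i` and with the other coordinate equal to `u`. -/
def pt (i : Fin 2) (s u : ℝ) : Plane := fun k => if k = i then s else u

theorem one_sub_ne (i : Fin 2) : 1 - i ≠ i := by fin_cases i <;> decide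

theorem one_sub_one_sub (i : Fin 2) : 1 - (1 - i) = i := by fin_cases i <;> decide

theorem eq_or_eq_one_sub (i k : Fin 2) : k = i ∨ k = 1 - i := by
  fin_cases i <;> fin_cases k <;> simp

@[simp] theorem pt_self (i : Fin 2) (s u : ℝ) : pt i s u i = s := if_pos rfl

@[simp] theorem pt_other (i : Fin 2) (s u : ℝ) : pt i s u (1 - i) = u := if_neg (one_sub_ne i)

theorem pt_eta (i : Fin 2) (p : Plane) : pt i (p i) (p (1 - i)) = p := by
  funext k
  rcases eq_or_eq_one_sub i k with rfl | rfl <;> simp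

@[simp] theorem pt_zero (i : Fin 2) : pt i 0 0 = 0 := by
  funext k
  rcases eq_or_eq_one_sub i k with rfl | rfl <;> simp

theorem plane_ext {i : Fin 2} {p q : Plane} (h1 : p i = q i) (h2 : p (1 - i) = q (1 - i)) :
    p = q := by
  rw [← pt_eta i p, ← pt_eta i q, h1, h2]

theorem mul_eq_mul (i : Fin 2) (p : Plane) : p 0 * p 1 = p i * p (1 - i) := by
  fin_cases i
  · simp
  · simp [mul_comm]

theorem continuous_pt (i : Fin 2) : Continuous fun p : ℝ × ℝ => pt i p.1 p.2 := by
  refine continuous_pi fun k => ?_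
  unfold pt
  split_ifs
  · exact continuous_fst
  · exact continuous_snd

theorem mem_ball_zero_iff_coord (i : Fin 2) {p : Plane} {δ : ℝ} (hδ : 0 < δ) :
    p ∈ Metric.ball (0 : Plane) δ ↔ |p i| < δ ∧ |p (1 - i)| < δ := by
  rw [mem_ball_zero_iff, pi_norm_lt_iff hδ]
  constructor
  · intro h
    exact ⟨h i, h (1 - i)⟩
  · rintro ⟨h1, h2⟩ k
    rcases eq_or_eq_one_sub i k with rfl | rfl
    exacts [h1, h2]

theorem pt_mem_ball (i : Fin 2) {s u δ : ℝ} (hs : |s| < δ) (hu : |u| < δ) :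
    pt i s u ∈ Metric.ball (0 : Plane) δ := by
  rw [mem_ball_zero_iff_coord i ((abs_nonneg s).trans_lt hs)]
  simpa using ⟨hs, hu⟩

theorem hasDerivAt_pt {i : Fin 2} {f g : ℝ → ℝ} {t : ℝ} {v : Plane} (hf : HasDerivAt f (v i) t)
    (hg : HasDerivAt g (v (1 - i)) t) : HasDerivAt (fun t => pt i (f t) (g t)) v t := by
  rw [hasDerivAt_pi]
  intro k
  rcases eq_or_eq_one_sub i k with rfl | rfl
  · simpa using hf
  · simpa using hg

/-! ### Changes of time -/

/-- The new time is the primitive of `1 / v`, bi-Lipschitz because `v` lies between positive bounds.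
The speed is only assumed measurable since along a leaf it jumps from that of `Y` to that of `X` (or
back) at `s = 0`; accordingly the derivative is claimed only at points of continuity. -/
theorem exists_time_change_pos {v : ℝ → ℝ} (hv : Measurable v) {m M : ℝ} (hm : 0 < m)
    (hb : ∀ s, m ≤ v s ∧ v s ≤ M) (a : ℝ) : ∃ e : ℝ ≃o ℝ, e a = 0 ∧
      ∀ t, ContinuousAt v (e.symm t) → HasDerivAt e.symm (v (e.symm t)) t := by
  have hM : 0 < M := hm.trans_le ((hb 0).1.trans (hb 0).2)
  have hpos : ∀ s, 0 < v s := fun s => hm.trans_le (hb s).1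
  have hint : ∀ x y, IntervalIntegrable (fun s => (v s)⁻¹) MeasureTheory.volume x y := by
    intro x y
    refine (intervalIntegrable_const (c := m⁻¹)).mono_fun
      (hv.inv.aestronglyMeasurable) (Eventually.of_forall fun s => ?_)
    simp only
    rw [Real.norm_of_nonneg (inv_pos.mpr (hpos s)).le, Real.norm_of_nonneg (inv_pos.mpr hm).le]
    exact inv_anti₀ hm (hb s).1
  set τ : ℝ → ℝ := fun x => ∫ s in a..x, (v s)⁻¹ with hτ
  have hsub : ∀ x y, τ y - τ x = ∫ s in x..y, (v s)⁻¹ := fun x y =>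
    intervalIntegral.integral_interval_sub_left (hint _ _) (hint _ _)
  have hlow : ∀ x y, x ≤ y → M⁻¹ * (y - x) ≤ τ y - τ x := by
    intro x y hxy
    rw [hsub]
    have := intervalIntegral.integral_mono_on hxy (intervalIntegrable_const (c := M⁻¹))
      (hint x y) fun s _ => inv_anti₀ (hpos s) (hb s).2
    simpa [mul_comm] using this
  have hmono : StrictMono τ := by
    intro x y hxy
    have := hlow x y hxy.le
    have h2 : 0 < M⁻¹ * (y - x) := mul_pos (inv_pos.mpr hM) (sub_pos.mpr hxy)
    linarith
  have hcont : Continuous τ := intervalIntegral.continuous_primitive hint a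
  have ha : τ a = 0 := by simp [hτ]
  have htop : Tendsto τ atTop atTop := by
    refine tendsto_atTop_mono' _ (f₁ := fun x => M⁻¹ * (x - a)) ?_ ?_
    · filter_upwards [eventually_ge_atTop a] with x hx
      have := hlow a x hx
      rwa [ha, sub_zero] at this
    · exact (tendsto_atTop_add_const_right _ (-a) tendsto_id).const_mul_atTop (inv_pos.mpr hM)
  have hbot : Tendsto τ atBot atBot := by
    refine tendsto_atBot_mono' _ (f₁ := fun x => M⁻¹ * (x - a)) ?_ ?_
    · filter_upwards [eventually_le_atBot a] with x hx
      have := hlow x a hx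
      rw [ha] at this
      linarith
    · exact (tendsto_atBot_add_const_right _ (-a) tendsto_id).const_mul_atBot (inv_pos.mpr hM)
  refine ⟨hmono.orderIsoOfSurjective τ (hcont.surjective htop hbot), ha, fun t ht => ?_⟩
  set e := hmono.orderIsoOfSurjective τ (hcont.surjective htop hbot) with he
  have h1 : HasDerivAt τ (v (e.symm t))⁻¹ (e.symm t) :=
    intervalIntegral.integral_hasDerivAt_right (hint _ _)
      (hv.inv.stronglyMeasurable.stronglyMeasurableAtFilter) (ht.inv₀ (hpos _).ne')
  have h2 := HasDerivAt.of_local_left_inverse e.symm.continuous.continuousAt h1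
    (inv_pos.mpr (hpos _)).ne' (Eventually.of_forall fun y => e.apply_symm_apply y)
  simpa using h2

theorem exists_time_change {σ : ℝ} (hσ : σ = 1 ∨ σ = -1) {v : ℝ → ℝ} (hv : Measurable v)
    {m M : ℝ} (hm : 0 < m) (hb : ∀ s, m ≤ σ * v s ∧ σ * v s ≤ M) {a b : ℝ}
    (hab : σ * a ≤ σ * b) : ∃ T : ℝ, 0 ≤ T ∧ ∃ θ : ℝ → ℝ, θ 0 = a ∧ θ T = b ∧ Continuous θ ∧
      θ '' Icc 0 T = uIcc a b ∧ Function.Injective θ ∧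
      ∀ t, ContinuousAt v (θ t) → HasDerivAt θ (v (θ t)) t := by
  have hσσ : σ * σ = 1 := by rcases hσ with rfl | rfl <;> norm_num
  obtain ⟨e, he, hd⟩ := exists_time_change_pos (v := fun x => σ * v (σ * x))
    ((hv.comp (measurable_const.mul measurable_id)).const_mul σ) hm (fun s => hb _) (σ * a)
  have hθ0 : σ * e.symm 0 = a := by
    rw [← he, e.symm_apply_apply, ← mul_assoc, hσσ, one_mul]
  have hθT : σ * e.symm (e (σ * b)) = b := by
    rw [e.symm_apply_apply, ← mul_assoc, hσσ, one_mul]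
  have hT : 0 ≤ e (σ * b) := by rw [← he]; exact e.monotone hab
  have hc : Continuous fun t => σ * e.symm t := e.symm.continuous.const_mul σ
  have hmem : ∀ x y z : ℝ, σ * x ≤ σ * y → σ * y ≤ σ * z → y ∈ uIcc x z := by
    intro x y z h1 h2
    rw [mem_uIcc]
    rcases hσ with rfl | rfl
    · left; constructor <;> linarith
    · right; constructor <;> linarith
  refine ⟨e (σ * b), hT, fun t => σ * e.symm t, hθ0, hθT, hc, ?_, ?_, fun t ht => ?_⟩
  · apply Subset.antisymm
    · rintro _ ⟨t, ht, rfl⟩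
      refine hmem _ _ _ ?_ ?_
      · rw [← mul_assoc, hσσ, one_mul, ← e.symm_apply_apply (σ * a), he]
        exact e.symm.monotone ht.1
      · rw [← mul_assoc, hσσ, one_mul, ← e.symm_apply_apply (σ * b)]
        exact e.symm.monotone ht.2
    · have := intermediate_value_uIcc (a := 0) (b := e (σ * b)) hc.continuousOn
      rw [uIcc_of_le hT] at this
      simp only [hθ0, hθT] at this
      exact this
  · intro x y hxy
    have h1 : σ * (σ * e.symm x) = σ * (σ * e.symm y) := by simp only at hxy; rw [hxy]
    rw [← mul_assoc, ← mul_assoc, hσσ, one_mul, one_mul] at h1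
    exact e.symm.injective h1
  · have h1 : ContinuousAt (fun x => σ * v (σ * x)) (e.symm t) :=
      (ht.comp (f := fun x => σ * x) (by fun_prop)).const_mul σ
    refine ((hd t h1).const_mul σ).congr_deriv ?_
    rw [← mul_assoc, hσσ, one_mul]

/-! ### Leaves and labels -/

/-- The leaf with label `y`, as a function of the first coordinate: it solves the equation of
slope `GX` where the product of the coordinates is positive and that of slope `GY` elsewhere. -/
def leaf (GX GY : Slope) (y s : ℝ) : ℝ := if 0 ≤ s * y then GX.flow 0 y s else GY.flow 0 y s

/-- The label of the leaf through a point. -/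
def label (GX GY : Slope) (s u : ℝ) : ℝ := if 0 ≤ s * u then GX.flow s u 0 else GY.flow s u 0

/-- The label of the leaf which ends at the point of coordinate `s` of the axis, on the side of
the sign of `y`. -/
def foot (GX GY : Slope) (y s : ℝ) : ℝ := if 0 ≤ s * y then GX.ell s else GY.ell s

section Leaf

variable {GX GY : Slope}

@[simp] theorem leaf_at_zero (y : ℝ) : leaf GX GY y 0 = y := by simp [leaf]

theorem continuous_leaf {y : ℝ} (hy : y ≠ 0) : Continuous (leaf GX GY y) := by
  refine Continuous.if_le (GX.continuous_flow_right 0 y) (GY.continuous_flow_right 0 y)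
    continuous_const (by fun_prop) fun s hs => ?_
  rcases mul_eq_zero.mp hs.symm with rfl | h
  · simp
  · exact absurd h hy

theorem leaf_of_pos {y s : ℝ} (h : 0 < s * y) : leaf GX GY y s = GX.flow 0 y s := if_pos h.le

theorem leaf_of_neg {y s : ℝ} (h : s * y < 0) : leaf GX GY y s = GY.flow 0 y s :=
  if_neg h.not_ge

theorem hasDerivAt_leaf_of_pos {y s : ℝ} (h : 0 < s * y) :
    HasDerivAt (leaf GX GY y) (GX.g (s, leaf GX GY y s)) s := by
  rw [leaf_of_pos h]
  refine (GX.hasDerivAt_flow 0 y s).congr_of_eventuallyEq ?_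
  have : ∀ᶠ s' in 𝓝 s, 0 < s' * y :=
    (by fun_prop : Continuous fun s' : ℝ => s' * y).tendsto s |>.eventually (lt_mem_nhds h)
  exact this.mono fun s' hs' => leaf_of_pos hs'

theorem hasDerivAt_leaf_of_neg {y s : ℝ} (h : s * y < 0) :
    HasDerivAt (leaf GX GY y) (GY.g (s, leaf GX GY y s)) s := by
  rw [leaf_of_neg h]
  refine (GY.hasDerivAt_flow 0 y s).congr_of_eventuallyEq ?_
  have : ∀ᶠ s' in 𝓝 s, s' * y < 0 :=
    (by fun_prop : Continuous fun s' : ℝ => s' * y).tendsto s |>.eventually (gt_mem_nhds h)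
  exact this.mono fun s' hs' => leaf_of_neg hs'

variable (hX : ∀ p, GX.g p < 0) (hY : ∀ p, 0 < GY.g p)
include hX hY

/-- A leaf above the axis increases up to `s = 0` and decreases afterwards, so its label is its
maximal height. -/
theorem le_label {s u : ℝ} (hu : 0 < u) : u ≤ label GX GY s u := by
  have h1 : StrictAnti (GX.flow s u) := strictAnti_of_deriv_neg fun t => by
    rw [(GX.hasDerivAt_flow s u t).deriv]; exact hX _
  have h2 : StrictMono (GY.flow s u) := strictMono_of_deriv_pos fun t => by
    rw [(GY.hasDerivAt_flow s u t).deriv]; exact hY _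
  unfold label
  split_ifs with h
  · have := h1.antitone (nonneg_of_mul_nonneg_left h hu)
    simpa using this
  · have : s ≤ 0 := by
      by_contra hs
      exact h (mul_nonneg (not_le.mp hs).le hu.le)
    simpa using h2.monotone this

theorem label_le {s u : ℝ} (hu : u < 0) : label GX GY s u ≤ u := by
  have h1 : StrictAnti (GX.flow s u) := strictAnti_of_deriv_neg fun t => by
    rw [(GX.hasDerivAt_flow s u t).deriv]; exact hX _
  have h2 : StrictMono (GY.flow s u) := strictMono_of_deriv_pos fun t => by
    rw [(GY.hasDerivAt_flow s u t).deriv]; exact hY _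
  unfold label
  split_ifs with h
  · have : s ≤ 0 := by
      by_contra hs
      exact (mul_neg_of_pos_of_neg (not_le.mp hs) hu).not_ge h
    simpa using h1.antitone this
  · have : 0 ≤ s := by
      by_contra hs
      exact h (mul_nonneg_of_nonpos_of_nonpos (not_le.mp hs).le hu.le)
    simpa using h2.monotone this

theorem label_mul_pos {s u : ℝ} (hu : u ≠ 0) : 0 < label GX GY s u * u := by
  rcases hu.lt_or_gt with h | h
  · exact mul_pos_of_neg_of_neg ((label_le hX hY h).trans_lt h) h
  · exact mul_pos (h.trans_le (le_label hX hY h)) h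

theorem abs_le_abs_label {s u : ℝ} : |u| ≤ |label GX GY s u| ∨ u = 0 := by
  rcases lt_trichotomy u 0 with h | h | h
  · left
    have := label_le hX hY (s := s) h
    rw [abs_of_neg h, abs_of_neg (this.trans_lt h)]
    linarith
  · exact Or.inr h
  · left
    have := le_label hX hY (s := s) h
    rw [abs_of_pos h, abs_of_pos (h.trans_le this)]
    exact this

theorem leaf_label {s u : ℝ} (hu : u ≠ 0) : leaf GX GY (label GX GY s u) s = u := by
  have h := label_mul_pos hX hY (s := s) hu
  have hiff : 0 ≤ s * label GX GY s u ↔ 0 ≤ s * u := by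
    constructor <;> intro h'
    · by_contra hc
      push Not at hc
      have h1 := mul_nonneg h' h.le
      have h3 : 0 < u ^ 2 := by positivity
      have hs : s * u < 0 := hc
      nlinarith [mul_neg_of_neg_of_pos hs (mul_pos h h), mul_pos h h]
    · by_contra hc
      push Not at hc
      nlinarith [mul_nonneg h' h.le, mul_neg_of_neg_of_pos hc (by positivity : 0 < u ^ 2),
        mul_nonneg h' (sq_nonneg (label GX GY s u))]
  unfold leaf
  by_cases h0 : 0 ≤ s * u
  · rw [if_pos (hiff.mpr h0), label, if_pos h0, Slope.flow_flow, Slope.flow_self]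
  · rw [if_neg (hiff.not.mpr h0), label, if_neg h0, Slope.flow_flow, Slope.flow_self]

end Leaf

end

/-! ### Continuity of labels and shape of leaves -/

section

section Leaf

variable {GX GY : Slope}

/-- The hypothesis keeps the point on the part of the leaf before it meets the axis. Beyond its ends
the solution changes half plane, and `label` would select the other slope. -/
theorem label_leaf {y s : ℝ} (h : 0 < leaf GX GY y s * y) : label GX GY s (leaf GX GY y s) = y := by
  have hiff : 0 ≤ s * leaf GX GY y s ↔ 0 ≤ s * y := by
    rcases pos_and_pos_or_neg_and_neg_of_mul_pos h with ⟨h1, h2⟩ | ⟨h1, h2⟩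
    · rw [mul_nonneg_iff_of_pos_right h1, mul_nonneg_iff_of_pos_right h2]
    · rw [← neg_mul_neg, ← neg_mul_neg s y, mul_nonneg_iff_of_pos_right (by linarith),
        mul_nonneg_iff_of_pos_right (by linarith)]
  unfold label
  by_cases h0 : 0 ≤ s * y
  · rw [if_pos (hiff.mpr h0), leaf, if_pos h0, Slope.flow_flow, Slope.flow_self]
  · rw [if_neg (hiff.not.mpr h0), leaf, if_neg h0, Slope.flow_flow, Slope.flow_self]

/-- One of the two flows is always trivial, so a single formula is valid on both sides of `s = 0`
and continuity across the crossing branch becomes visible. -/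
theorem label_eq_of_pos (s : ℝ) {u : ℝ} (hu : 0 < u) :
    label GX GY s u = GX.flow (max s 0) (GY.flow (min s 0) u 0) 0 := by
  unfold label
  rcases le_or_gt 0 s with h | h
  · rw [if_pos (mul_nonneg h hu.le), max_eq_left h, min_eq_right h, Slope.flow_self]
  · rw [if_neg (mul_neg_of_neg_of_pos h hu).not_ge, max_eq_right h.le, min_eq_left h.le,
      Slope.flow_self]

theorem label_eq_of_neg (s : ℝ) {u : ℝ} (hu : u < 0) :
    label GX GY s u = GY.flow (max s 0) (GX.flow (min s 0) u 0) 0 := by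
  unfold label
  rcases le_or_gt s 0 with h | h
  · rw [if_pos (mul_nonneg_of_nonpos_of_nonpos h hu.le), max_eq_right h, min_eq_left h,
      Slope.flow_self]
  · rw [if_neg (mul_neg_of_pos_of_neg h hu).not_ge, max_eq_left h.le, min_eq_right h.le,
      Slope.flow_self]

theorem continuousAt_label {s u : ℝ} (hu : u ≠ 0) :
    ContinuousAt (fun p : ℝ × ℝ => label GX GY p.1 p.2) (s, u) := by
  have hc : ∀ G H : Slope, Continuous fun p : ℝ × ℝ =>
      G.flow (max p.1 0) (H.flow (min p.1 0) p.2 0) 0 := fun G H =>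
    G.continuous_flow.comp ((by fun_prop : Continuous fun p : ℝ × ℝ => max p.1 0).prodMk
      ((H.continuous_flow.comp (by fun_prop : Continuous fun p : ℝ × ℝ =>
        (min p.1 0, p.2, (0 : ℝ)))).prodMk continuous_const))
  have h2 : Tendsto (fun p : ℝ × ℝ => p.2) (𝓝 (s, u)) (𝓝 u) := continuous_snd.tendsto _
  rcases hu.lt_or_gt with h | h
  · refine (hc GY GX).continuousAt.congr ?_
    exact (h2.eventually (gt_mem_nhds h)).mono fun p hp => (label_eq_of_neg p.1 hp).symm
  · refine (hc GX GY).continuousAt.congr ?_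
    exact (h2.eventually (lt_mem_nhds h)).mono fun p hp => (label_eq_of_pos p.1 hp).symm

/-- Along the axis the label jumps: the limit from a half plane is computed with the slope in force
on that side, selected by the sign of `y`. This is how the end of a leaf, which does not belong to
it, still determines its label. -/
theorem tendsto_label_foot {y s : ℝ} (hy : y ≠ 0) (hs : s ≠ 0) :
    Tendsto (fun p : ℝ × ℝ => label GX GY p.1 p.2) (𝓝[{p | 0 < p.2 * y}] (s, 0))
      (𝓝 (foot GX GY y s)) := by
  have hc : ∀ G : Slope, Tendsto (fun p : ℝ × ℝ => G.flow p.1 p.2 0) (𝓝 (s, 0)) (𝓝 (G.ell s)) :=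
    fun G => (G.continuous_flow.comp (by fun_prop : Continuous fun p : ℝ × ℝ =>
        (p.1, p.2, (0 : ℝ)))).tendsto (s, 0)
  have h1 : Tendsto (fun p : ℝ × ℝ => p.1 * y) (𝓝 (s, 0)) (𝓝 (s * y)) :=
    (by fun_prop : Continuous fun p : ℝ × ℝ => p.1 * y).tendsto _
  rcases (mul_ne_zero hs hy).lt_or_gt with h | h
  · rw [foot, if_neg h.not_ge]
    refine ((hc GY).mono_left nhdsWithin_le_nhds).congr' ?_
    filter_upwards [self_mem_nhdsWithin,
      nhdsWithin_le_nhds (h1.eventually (gt_mem_nhds h))] with p hp hp'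
    rw [label, if_neg]
    intro h0
    have hp : 0 < p.2 * y := hp
    nlinarith [mul_nonneg h0 (sq_nonneg y), mul_neg_of_neg_of_pos hp' hp]
  · rw [foot, if_pos h.le]
    refine ((hc GX).mono_left nhdsWithin_le_nhds).congr' ?_
    filter_upwards [self_mem_nhdsWithin,
      nhdsWithin_le_nhds (h1.eventually (lt_mem_nhds h))] with p hp hp'
    rw [label, if_pos]
    have hp : 0 < p.2 * y := hp
    have h2 : 0 < y ^ 2 := by positivity
    by_contra h0
    push Not at h0
    nlinarith [mul_neg_of_neg_of_pos h0 h2, mul_pos hp' hp]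

variable (hX : ∀ p, GX.g p < 0) (hY : ∀ p, 0 < GY.g p)
include hX hY

/-- The factor `y` treats hills and valleys at the same time: the height relative to the sign of `y`
decreases away from `s = 0`. -/
theorem leaf_antitoneOn {y : ℝ} (hy : y ≠ 0) :
    StrictAntiOn (fun s => leaf GX GY y s * y) (Ici 0) := by
  refine strictAntiOn_of_deriv_neg (convex_Ici 0)
    ((continuous_leaf hy).mul_const y).continuousOn fun s hs => ?_
  rw [interior_Ici, mem_Ioi] at hs
  rcases hy.lt_or_gt with h | h
  · have := (hasDerivAt_leaf_of_neg (GX := GX) (GY := GY)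
      (mul_neg_of_pos_of_neg hs h)).mul_const y
    rw [this.deriv]
    exact mul_neg_of_pos_of_neg (hY _) h
  · have := (hasDerivAt_leaf_of_pos (GX := GX) (GY := GY) (mul_pos hs h)).mul_const y
    rw [this.deriv]
    exact mul_neg_of_neg_of_pos (hX _) h

theorem leaf_monotoneOn {y : ℝ} (hy : y ≠ 0) :
    StrictMonoOn (fun s => leaf GX GY y s * y) (Iic 0) := by
  refine strictMonoOn_of_deriv_pos (convex_Iic 0)
    ((continuous_leaf hy).mul_const y).continuousOn fun s hs => ?_
  rw [interior_Iic, mem_Iio] at hs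
  rcases hy.lt_or_gt with h | h
  · have := (hasDerivAt_leaf_of_pos (GX := GX) (GY := GY)
      (mul_pos_of_neg_of_neg hs h)).mul_const y
    rw [this.deriv]
    exact mul_pos_of_neg_of_neg (hX _) h
  · have := (hasDerivAt_leaf_of_neg (GX := GX) (GY := GY)
      (mul_neg_of_neg_of_pos hs h)).mul_const y
    rw [this.deriv]
    exact mul_pos (hY _) h

theorem leaf_mul_pos {y a b s : ℝ} (hy : y ≠ 0) (ha : 0 < leaf GX GY y a * y)
    (hb : 0 < leaf GX GY y b * y) (hs : s ∈ uIcc a b) : 0 < leaf GX GY y s * y := by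
  have key : ∀ a b : ℝ, 0 < leaf GX GY y a * y → 0 < leaf GX GY y b * y → a ≤ s → s ≤ b →
      0 < leaf GX GY y s * y := by
    intro a b ha hb has hsb
    rcases le_total 0 s with h0 | h0
    · exact hb.trans_le ((leaf_antitoneOn hX hY hy).antitoneOn h0 (h0.trans hsb) hsb)
    · exact ha.trans_le ((leaf_monotoneOn hX hY hy).monotoneOn (has.trans h0) h0 has)
  rcases mem_uIcc.mp hs with h | h
  · exact key a b ha hb h.1 h.2
  · exact key b a hb ha h.1 h.2

theorem abs_leaf_le {y s : ℝ} (h : 0 < leaf GX GY y s * y) : |leaf GX GY y s| ≤ |y| := by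
  rcases abs_le_abs_label hX hY (s := s) (u := leaf GX GY y s) with h1 | h1
  · rwa [label_leaf h] at h1
  · rw [h1, zero_mul] at h
    exact absurd h (lt_irrefl _)

end Leaf

/-! ### Local models -/

/-- Near the origin, the components of the fields are given by slopes and speeds which are
defined and controlled in the whole plane. The fields have the sign `σ` in the direction `i`. -/
structure LocalModel {U : OriginNhd} {r : ℕ} (Z : Omega U r) (i : Fin 2) (σ δ : ℝ)
    (GX GY : Slope) (SX SY : Plane → ℝ) : Prop where
  hσ : σ = 1 ∨ σ = -1
  hδ : 0 < δ
  ball_subset : Metric.ball (0 : Plane) δ ⊆ U.carrier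
  hX : ∀ p, GX.g p < 0
  hY : ∀ p, 0 < GY.g p
  continuous_SX : Continuous SX
  continuous_SY : Continuous SY
  bounds : ∃ m M : ℝ, 0 < m ∧ ∀ p, (m ≤ σ * SX p ∧ σ * SX p ≤ M) ∧ m ≤ σ * SY p ∧ σ * SY p ≤ M
  eq_X : ∀ p ∈ Metric.ball (0 : Plane) δ, Z.1 p i = SX p ∧
    Z.1 p (1 - i) = SX p * GX.g (p i, p (1 - i))
  eq_Y : ∀ p ∈ Metric.ball (0 : Plane) δ, Z.2 p i = SY p ∧
    Z.2 p (1 - i) = SY p * GY.g (p i, p (1 - i))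

/-- `G` is the cut-off of the quotient of the two components. The speed `S` is the component `i`
evaluated after clamping the point to a closed box, which makes it continuous and bounded away from
`0` everywhere without changing it near the origin. -/
theorem exists_model_field {V : Plane → Plane} (hV : ContDiffAt ℝ 2 V 0) {i : Fin 2} {σ : ℝ}
    (hσ : 0 < σ * V 0 i) (hj : V 0 (1 - i) ≠ 0) {η : ℝ} (hη : 0 < η) :
    ∃ (G : Slope) (S : Plane → ℝ), G.Near (V 0 (1 - i) / V 0 i) η ∧ Continuous S ∧
      (∃ m M : ℝ, 0 < m ∧ ∀ p, m ≤ σ * S p ∧ σ * S p ≤ M) ∧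
      ∀ᶠ p in 𝓝 (0 : Plane), V p i = S p ∧ V p (1 - i) = S p * G.g (p i, p (1 - i)) := by
  have hi : V 0 i ≠ 0 := fun h => by simp [h] at hσ
  set f : ℝ × ℝ → ℝ := fun q => V (pt i q.1 q.2) (1 - i) / V (pt i q.1 q.2) i with hf
  have hpt : ContDiff ℝ 2 fun q : ℝ × ℝ => pt i q.1 q.2 := by
    rw [contDiff_pi]
    intro k
    unfold pt
    split_ifs
    · exact contDiff_fst
    · exact contDiff_snd
  have hVc : ∀ k, ContDiffAt ℝ 2 (fun p => V p k) 0 := fun k => contDiffAt_pi.mp hV k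
  have hVpt : ∀ k, ContDiffAt ℝ 2 (fun q : ℝ × ℝ => V (pt i q.1 q.2) k) 0 := fun k =>
    ContDiffAt.comp (0 : ℝ × ℝ) (f := fun q : ℝ × ℝ => pt i q.1 q.2) (g := fun p => V p k)
      (by simpa using hVc k) hpt.contDiffAt
  have hfd : ContDiffAt ℝ 2 f 0 := (hVpt _).div (hVpt _) (by simpa using hi)
  have hf0 : f 0 = V 0 (1 - i) / V 0 i := by simp [hf]
  obtain ⟨G, hG, hN⟩ := exists_slope hfd (by rw [hf0]; exact div_ne_zero hj hi) hη
  rw [hf0] at hN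
  set a : ℝ := σ * V 0 i with ha
  obtain ⟨δ, hδ, hδ'⟩ : ∃ δ > 0, ∀ p : Plane, ‖p‖ ≤ δ → ContinuousAt V p ∧
      a / 2 ≤ σ * V p i ∧ σ * V p i ≤ 2 * a := by
    have h1 : ∀ᶠ p in 𝓝 (0 : Plane), ContinuousAt V p :=
      (hV.eventually (by simp)).mono fun p hp => hp.continuousAt
    have h2 : Tendsto (fun p => σ * V p i) (𝓝 0) (𝓝 a) :=
      (hVc i).continuousAt.const_mul σ
    have h3 := h1.and ((h2.eventually (lt_mem_nhds (show a / 2 < a by linarith))).and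
      (h2.eventually (gt_mem_nhds (show a < 2 * a by linarith))))
    obtain ⟨δ, hδ, h⟩ := Metric.nhds_basis_closedBall.eventually_iff.mp h3
    exact ⟨δ, hδ, fun p hp => by
      have := h (mem_closedBall_zero_iff.mpr hp)
      exact ⟨this.1, this.2.1.le, this.2.2.le⟩⟩
  set cl : Plane → Plane := fun p k => max (-δ) (min δ (p k)) with hcl
  have hclc : Continuous cl := by
    refine continuous_pi fun k => ?_
    have := continuous_apply (A := fun _ : Fin 2 => ℝ) k
    fun_prop
  have hcln : ∀ p, ‖cl p‖ ≤ δ := fun p => by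
    rw [pi_norm_le_iff_of_nonneg hδ.le]
    intro k
    rw [Real.norm_eq_abs, abs_le]
    exact ⟨le_max_left _ _, max_le (by linarith) (min_le_left _ _)⟩
  refine ⟨G, fun p => V (cl p) i, hN, ?_, ⟨a / 2, 2 * a, by linarith, fun p =>
    (hδ' _ (hcln p)).2⟩, ?_⟩
  · rw [continuous_iff_continuousAt]
    intro p
    have h1 := (hδ' _ (hcln p)).1
    have h2 : ContinuousAt (fun p => V p i) (cl p) :=
      ((continuous_apply i).continuousAt).comp h1
    exact h2.comp hclc.continuousAt
  · have h1 : ∀ᶠ p in 𝓝 (0 : Plane), ‖p‖ < δ :=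
      (continuous_norm.tendsto' 0 0 (by simp)).eventually (gt_mem_nhds hδ)
    have h2 : Tendsto (fun p : Plane => (p i, p (1 - i))) (𝓝 0) (𝓝 0) :=
      (by fun_prop : Continuous fun p : Plane => (p i, p (1 - i))).tendsto' 0 0 (by simp)
    have h3 : ∀ᶠ p in 𝓝 (0 : Plane), V p i ≠ 0 :=
      (hVc i).continuousAt.eventually_ne hi
    filter_upwards [h1, h2.eventually hG, h3] with p hp hp' hp0
    have e : cl p = p := by
      funext k
      have := (norm_le_pi_norm p k).trans hp.le
      rw [Real.norm_eq_abs, abs_le] at this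
      rw [hcl]
      simp only
      rw [min_eq_right this.2, max_eq_right this.1]
    rw [e, hp', hf]
    simp only [pt_eta]
    exact ⟨trivial, by field_simp⟩

variable {U : OriginNhd} {r : ℕ}

theorem CrField.contDiffAt_zero (V : CrField U r) (hr : 2 ≤ r) : ContDiffAt ℝ 2 V 0 :=
  (V.2.1.contDiffAt (U.isOpen'.mem_nhds U.zero_mem')).of_le (by exact_mod_cast hr)

/-- The signs at the origin of the fields of a pseudo-Hopf configuration with crossing branch `i`
and with direction `σ`. -/
structure SignConfig (Z : Omega U r) (i : Fin 2) (σ : ℝ) : Prop where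
  hσ : σ = 1 ∨ σ = -1
  X_pos : 0 < σ * Z.1 0 i
  Y_pos : 0 < σ * Z.2 0 i
  X_neg : σ * Z.1 0 (1 - i) < 0
  Y_pos' : 0 < σ * Z.2 0 (1 - i)

theorem Slope.Near.neg {G : Slope} {c η : ℝ} (h : G.Near c η) (hη : η < 1) (hc : c < 0)
    (p : ℝ × ℝ) : G.g p < 0 := by
  have := (abs_le.mp (h.close p)).2
  rw [abs_of_neg hc] at this
  nlinarith

theorem Slope.Near.pos {G : Slope} {c η : ℝ} (h : G.Near c η) (hη : η < 1) (hc : 0 < c)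
    (p : ℝ × ℝ) : 0 < G.g p := by
  have := (abs_le.mp (h.close p)).1
  rw [abs_of_pos hc] at this
  nlinarith

theorem SignConfig.slope_X {Z : Omega U r} {i : Fin 2} {σ : ℝ} (h : SignConfig Z i σ) :
    Z.1 0 (1 - i) / Z.1 0 i < 0 := by
  have h1 := h.X_pos
  have h2 := h.X_neg
  rcases h.hσ with rfl | rfl
  · exact div_neg_of_neg_of_pos (by linarith) (by linarith)
  · exact div_neg_of_pos_of_neg (by linarith) (by linarith)

theorem SignConfig.slope_Y {Z : Omega U r} {i : Fin 2} {σ : ℝ} (h : SignConfig Z i σ) :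
    0 < Z.2 0 (1 - i) / Z.2 0 i := by
  have h1 := h.Y_pos
  have h2 := h.Y_pos'
  rcases h.hσ with rfl | rfl
  · exact div_pos (by linarith) (by linarith)
  · exact div_pos_of_neg_of_neg (by linarith) (by linarith)

theorem SignConfig.exists_model {Z : Omega U r} (hr : 2 ≤ r) {i : Fin 2} {σ : ℝ}
    (h : SignConfig Z i σ) {η : ℝ} (hη : 0 < η) (hη1 : η < 1) :
    ∃ (δ : ℝ) (GX GY : Slope) (SX SY : Plane → ℝ), LocalModel Z i σ δ GX GY SX SY ∧
      GX.Near (Z.1 0 (1 - i) / Z.1 0 i) η ∧ GY.Near (Z.2 0 (1 - i) / Z.2 0 i) η := by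
  obtain ⟨GX, SX, hNX, hSX, ⟨m, M, hm, hb⟩, hX⟩ := exists_model_field
    (Z.1.contDiffAt_zero hr) h.X_pos (fun h0 => by have := h.X_neg; simp [h0] at this) hη
  obtain ⟨GY, SY, hNY, hSY, ⟨m', M', hm', hb'⟩, hY⟩ := exists_model_field
    (Z.2.contDiffAt_zero hr) h.Y_pos (fun h0 => by have := h.Y_pos'; simp [h0] at this) hη
  obtain ⟨δ, hδ, hev⟩ := Metric.nhds_basis_ball.eventually_iff.mp
    ((hX.and hY).and (U.isOpen'.mem_nhds U.zero_mem'))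
  refine ⟨δ, GX, GY, SX, SY, ⟨h.hσ, hδ, fun p hp => (hev hp).2, hNX.neg hη1 h.slope_X,
    hNY.pos hη1 h.slope_Y, hSX, hSY, ⟨min m m', max M M', lt_min hm hm', fun p =>
    ⟨⟨(min_le_left _ _).trans (hb p).1, (hb p).2.trans (le_max_left _ _)⟩,
      (min_le_right _ _).trans (hb' p).1, (hb' p).2.trans (le_max_right _ _)⟩⟩,
    fun p hp => (hev hp).1.1, fun p hp => (hev hp).1.2⟩, hNX, hNY⟩

end

/-! ### Law of motion and realizable arcs in a local model -/

section

variable {U : OriginNhd} {r : ℕ}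

/-- The speed of the sliding motion at the point of coordinate `s` of the sliding branch. -/
def slideSpeed (i : Fin 2) (GX GY : Slope) (SX SY : Plane → ℝ) (s : ℝ) : ℝ :=
  SX (pt i s 0) * SY (pt i s 0) * (GY.g (s, 0) - GX.g (s, 0)) /
    (GY.g (s, 0) * SY (pt i s 0) - GX.g (s, 0) * SX (pt i s 0))

namespace LocalModel

variable {Z : Omega U r} {i : Fin 2} {σ δ : ℝ} {GX GY : Slope} {SX SY : Plane → ℝ}
  (hM : LocalModel Z i σ δ GX GY SX SY)
include hM

theorem sq : σ * σ = 1 := by rcases hM.hσ with h | h <;> simp [h]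

theorem SX_pos (p : Plane) : 0 < σ * SX p := by
  obtain ⟨m, M, hm, h⟩ := hM.bounds
  exact hm.trans_le (h p).1.1

theorem SY_pos (p : Plane) : 0 < σ * SY p := by
  obtain ⟨m, M, hm, h⟩ := hM.bounds
  exact hm.trans_le (h p).2.1

theorem X_pos {p : Plane} (hp : p ∈ Metric.ball (0 : Plane) δ) : 0 < σ * Z.1 p i := by
  rw [(hM.eq_X p hp).1]; exact hM.SX_pos p

theorem Y_pos {p : Plane} (hp : p ∈ Metric.ball (0 : Plane) δ) : 0 < σ * Z.2 p i := by
  rw [(hM.eq_Y p hp).1]; exact hM.SY_pos p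

theorem X_neg {p : Plane} (hp : p ∈ Metric.ball (0 : Plane) δ) : σ * Z.1 p (1 - i) < 0 := by
  rw [(hM.eq_X p hp).2, ← mul_assoc]; exact mul_neg_of_pos_of_neg (hM.SX_pos p) (hM.hX _)

theorem Y_pos' {p : Plane} (hp : p ∈ Metric.ball (0 : Plane) δ) : 0 < σ * Z.2 p (1 - i) := by
  rw [(hM.eq_Y p hp).2, ← mul_assoc]; exact mul_pos (hM.SY_pos p) (hM.hY _)

theorem mul_pos_i {p : Plane} (hp : p ∈ Metric.ball (0 : Plane) δ) :
    0 < Z.1 p i * Z.2 p i := by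
  have := mul_pos (hM.X_pos hp) (hM.Y_pos hp)
  rwa [mul_mul_mul_comm, hM.sq, one_mul] at this

theorem mul_neg_j {p : Plane} (hp : p ∈ Metric.ball (0 : Plane) δ) :
    Z.1 p (1 - i) * Z.2 p (1 - i) < 0 := by
  have := mul_neg_of_neg_of_pos (hM.X_neg hp) (hM.Y_pos' hp)
  rwa [mul_mul_mul_comm, hM.sq, one_mul] at this

theorem zero_mem_ball : (0 : Plane) ∈ Metric.ball (0 : Plane) δ := Metric.mem_ball_self hM.hδ

theorem mem_sliding_or_escaping {p : Plane} (hp : p ∈ Metric.ball (0 : Plane) δ)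
    (hj : p (1 - i) = 0) (h0 : p i ≠ 0) : p ∈ sliding Z (1 - i) ∪ escaping Z (1 - i) := by
  have hb : p ∈ branch U (1 - i) := ⟨hM.ball_subset hp, hj⟩
  have hX := hM.X_neg hp
  have hY := hM.Y_pos' hp
  simp only [sliding, escaping, mem_union, one_sub_one_sub]
  rcases hM.hσ with h | h <;> subst h <;> rcases h0.lt_or_gt with h1 | h1
  · exact Or.inr ⟨hb, Or.inr ⟨h1, by linarith, by linarith⟩⟩
  · exact Or.inl ⟨hb, Or.inl ⟨h1, by linarith, by linarith⟩⟩
  · exact Or.inl ⟨hb, Or.inr ⟨h1, by linarith, by linarith⟩⟩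
  · exact Or.inr ⟨hb, Or.inl ⟨h1, by linarith, by linarith⟩⟩

theorem not_mem_sliding_i {p : Plane} (hp : p ∈ Metric.ball (0 : Plane) δ) :
    p ∉ sliding Z i ∪ escaping Z i := by
  have h := hM.mul_pos_i hp
  rintro (⟨-, ⟨-, h1, h2⟩ | ⟨-, h1, h2⟩⟩ | ⟨-, ⟨-, h1, h2⟩ | ⟨-, h1, h2⟩⟩)
  · exact absurd (mul_neg_of_neg_of_pos h1 h2) h.not_gt
  · exact absurd (mul_neg_of_pos_of_neg h1 h2) h.not_gt
  · exact absurd (mul_neg_of_pos_of_neg h1 h2) h.not_gt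
  · exact absurd (mul_neg_of_neg_of_pos h1 h2) h.not_gt

theorem mem_crossing {p : Plane} (hp : p ∈ Metric.ball (0 : Plane) δ) (h0 : p i = 0) :
    p ∈ crossing Z i := ⟨⟨hM.ball_subset hp, h0⟩, hM.mul_pos_i hp⟩

theorem not_mem_crossing_j {p : Plane} (hp : p ∈ Metric.ball (0 : Plane) δ) :
    p ∉ crossing Z (1 - i) := fun h => (hM.mul_neg_j hp).not_gt h.2

theorem not_mem_closure_i : (0 : Plane) ∉ closure (sliding Z i ∪ escaping Z i) := by
  intro h
  obtain ⟨p, hp, hp'⟩ := mem_closure_iff.mp h _ Metric.isOpen_ball hM.zero_mem_ball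
  exact hM.not_mem_sliding_i hp hp'

/-- Points of the axis other than the origin slide or escape, arbitrarily near the origin, while the
other branch consists of crossing points. So the origin obeys the law of the sliding field. -/
theorem originSliding : OriginSliding Z (1 - i) := by
  refine ⟨?_, ?_, ?_⟩
  · rw [mem_closure_iff_nhds_basis Metric.nhds_basis_ball]
    intro ε hε
    set s := min ε δ / 2
    have hs : 0 < s := half_pos (lt_min hε hM.hδ)
    have h1 : s < ε := (half_lt_self (lt_min hε hM.hδ)).trans_le (min_le_left _ _)
    have h2 : s < δ := (half_lt_self (lt_min hε hM.hδ)).trans_le (min_le_right _ _)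
    refine ⟨pt i s 0, hM.mem_sliding_or_escaping (pt_mem_ball i ?_ ?_) (by simp)
      (by simpa using hs.ne'), pt_mem_ball i ?_ ?_⟩
    · rwa [abs_of_pos hs]
    · simpa using hM.hδ
    · rwa [abs_of_pos hs]
    · simpa using hε
  · rw [one_sub_one_sub]
    refine subset_closure (hM.mem_crossing hM.zero_mem_ball rfl)
  · rw [one_sub_one_sub]
    exact hM.not_mem_closure_i

theorem eq_of_originSliding {k : Fin 2} (h : OriginSliding Z k) : k = 1 - i := by
  rcases eq_or_eq_one_sub i k with rfl | h'
  · exact absurd h.1 hM.not_mem_closure_i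
  · exact h'

theorem not_originCrossing : ¬ OriginCrossing Z := by
  intro h
  obtain ⟨ε, hε, h⟩ := Metric.nhds_basis_ball.eventually_iff.mp h
  set s := min ε δ / 2
  have hs : 0 < s := half_pos (lt_min hε hM.hδ)
  have h1 : s < ε := (half_lt_self (lt_min hε hM.hδ)).trans_le (min_le_left _ _)
  have h2 : s < δ := (half_lt_self (lt_min hε hM.hδ)).trans_le (min_le_right _ _)
  have hmem : ∀ ρ, s < ρ → pt i s 0 ∈ Metric.ball (0 : Plane) ρ := fun ρ hρ =>
    pt_mem_ball i (by rwa [abs_of_pos hs]) (by simpa using hs.trans hρ)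
  have hcl := h (hmem ε h1) ⟨hM.ball_subset (hmem δ h2), by rw [mul_eq_mul i]; simp⟩
  have hopen : IsOpen (Metric.ball (0 : Plane) δ ∩ {p | 0 < p i}) :=
    Metric.isOpen_ball.inter (isOpen_lt continuous_const (continuous_apply i))
  obtain ⟨p, ⟨hp, hp0⟩, hp'⟩ := mem_closure_iff.mp hcl _ hopen ⟨hmem δ h2, by simpa using hs⟩
  have key : ∀ k, p ∉ crossing Z k := by
    intro k hk
    rcases eq_or_eq_one_sub i k with rfl | rfl
    · exact (show 0 < p k from hp0).ne' hk.1.2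
    · exact hM.not_mem_crossing_j hp hk
  rcases hp' with h | h
  · exact key _ h
  · exact key _ h

/-- The sliding field is the convex combination of `X` and `Y` tangent to the axis. Its speed is
therefore a convex combination of the two speeds and inherits their sign and bounds. The sign of the
denominator is recorded for continuity. -/
theorem slide_spec (s : ℝ) : ∃ c : ℝ, 0 ≤ c ∧ c ≤ 1 ∧ slideSpeed i GX GY SX SY s =
    c * SX (pt i s 0) + (1 - c) * SY (pt i s 0) ∧
    0 < σ * (GY.g (s, 0) * SY (pt i s 0) - GX.g (s, 0) * SX (pt i s 0)) := by
  have h1 := hM.SX_pos (pt i s 0)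
  have h2 := hM.SY_pos (pt i s 0)
  have h3 := hM.hX (s, 0)
  have h4 := hM.hY (s, 0)
  unfold slideSpeed
  set x := SX (pt i s 0)
  set y := SY (pt i s 0)
  set a := GX.g (s, 0)
  set b := GY.g (s, 0)
  have ha : 0 < -a * (σ * x) := mul_pos (by linarith) h1
  have hb : 0 < b * (σ * y) := mul_pos h4 h2
  have hsplit : σ * (b * y - a * x) = b * (σ * y) + -a * (σ * x) := by ring
  have hD : 0 < σ * (b * y - a * x) := by linarith
  have hD0 : b * y - a * x ≠ 0 := fun h => by simp [h] at hD
  have hσ0 : σ ≠ 0 := fun h => by simp [h] at h1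
  refine ⟨(b * (σ * y)) / (σ * (b * y - a * x)), div_nonneg hb.le hD.le,
    (div_le_one hD).mpr (by linarith), ?_, hD⟩
  have e1 : b * (σ * y) / (σ * (b * y - a * x)) = b * y / (b * y - a * x) := by
    rw [mul_left_comm, mul_div_mul_left _ _ hσ0]
  have e2 : b * y / (b * y - a * x) * (b * y - a * x) = b * y := div_mul_cancel₀ _ hD0
  rw [e1, div_eq_iff hD0]
  linear_combination (y - x) * e2

theorem slideSpeed_bounds : ∃ m M : ℝ, 0 < m ∧
    ∀ s, m ≤ σ * slideSpeed i GX GY SX SY s ∧ σ * slideSpeed i GX GY SX SY s ≤ M := by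
  obtain ⟨m, M, hm, h⟩ := hM.bounds
  refine ⟨m, M, hm, fun s => ?_⟩
  obtain ⟨c, h0, h1, hc, -⟩ := hM.slide_spec s
  obtain ⟨⟨h2, h3⟩, h4, h5⟩ := h (pt i s 0)
  rw [hc]
  have e : σ * (c * SX (pt i s 0) + (1 - c) * SY (pt i s 0)) =
    c * (σ * SX (pt i s 0)) + (1 - c) * (σ * SY (pt i s 0)) := by ring
  rw [e]
  constructor
  · nlinarith
  · nlinarith

theorem continuous_slideSpeed : Continuous (slideSpeed i GX GY SX SY) := by
  have h1 := GX.continuous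
  have h2 := GY.continuous
  have h3 : Continuous fun s : ℝ => SX (pt i s 0) :=
    hM.continuous_SX.comp ((continuous_pt i).comp (by fun_prop : Continuous fun s : ℝ =>
      (s, (0 : ℝ))))
  have h4 : Continuous fun s : ℝ => SY (pt i s 0) :=
    hM.continuous_SY.comp ((continuous_pt i).comp (by fun_prop : Continuous fun s : ℝ =>
      (s, (0 : ℝ))))
  have hc : Continuous fun s : ℝ => (s, (0 : ℝ)) := by fun_prop
  unfold slideSpeed
  refine Continuous.div ((h3.mul h4).mul ((h2.comp hc).sub (h1.comp hc)))
    (((h2.comp hc).mul h4).sub ((h1.comp hc).mul h3)) fun s h => ?_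
  obtain ⟨c, -, -, -, h'⟩ := hM.slide_spec s
  rw [h] at h'
  simp at h'

theorem slidingField_eq {p : Plane} (hp : p ∈ Metric.ball (0 : Plane) δ) (hj : p (1 - i) = 0) :
    slidingField Z (1 - i) p = pt i (slideSpeed i GX GY SX SY (p i)) 0 := by
  have e : pt i (p i) 0 = p := by rw [← hj]; exact pt_eta i p
  apply plane_ext (i := i)
  · rw [slidingField, one_sub_one_sub, pt_self, Pi.single_eq_same]
    rw [(hM.eq_X p hp).1, (hM.eq_X p hp).2, (hM.eq_Y p hp).1, (hM.eq_Y p hp).2, slideSpeed, e, hj]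
    congr 1 <;> ring
  · rw [slidingField, one_sub_one_sub, pt_other, Pi.single_eq_of_ne (one_sub_ne i)]

/-- In the ball there is no tangency, branch `i` only crosses, the other branch only slides or
escapes off the origin, and the origin follows the sliding field. The three laws reduce to these
four alternatives. -/
theorem law {W : Set Plane} {I : Set ℝ} {γ : ℝ → Plane} (h : IsTrajectory Z W I γ) {t : ℝ}
    (ht : t ∈ I) (hb : γ t ∈ Metric.ball (0 : Plane) δ) :
    (0 < γ t i * γ t (1 - i) ∧ HasDerivWithinAt γ (Z.1 (γ t)) I t) ∨
    (γ t i * γ t (1 - i) < 0 ∧ HasDerivWithinAt γ (Z.2 (γ t)) I t) ∨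
    (γ t i = 0 ∧ γ t (1 - i) ≠ 0 ∧ ∀ᶠ s in 𝓝[I \ {t}] t, γ s i * γ s (1 - i) ≠ 0) ∨
    (γ t (1 - i) = 0 ∧
      HasDerivWithinAt γ (pt i (slideSpeed i GX GY SX SY (γ t i)) 0) I t) := by
  obtain ⟨-, h⟩ := h.2 t ht
  rcases h with (⟨h1, h2⟩ | ⟨h1, h2⟩ | ⟨h0, ⟨k, hk⟩, hev⟩ | ⟨k, hk, hd⟩) |
    ⟨h0, k, hk, hk', -⟩ | ⟨h0, h⟩
  · exact Or.inl ⟨by rw [← mul_eq_mul]; exact h1.2, h2⟩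
  · exact Or.inr (Or.inl ⟨by rw [← mul_eq_mul]; exact h1.2, h2⟩)
  · refine Or.inr (Or.inr (Or.inl ?_))
    rcases eq_or_eq_one_sub i k with rfl | rfl
    · refine ⟨hk.1.2, fun hj => h0 ?_, hev.mono fun s hs => ?_⟩
      · exact plane_ext (i := k) hk.1.2 hj
      · rw [← mul_eq_mul]
        rcases hs with hs | hs
        exacts [hs.2.ne', hs.2.ne]
    · exact absurd hk (hM.not_mem_crossing_j hb)
  · refine Or.inr (Or.inr (Or.inr ?_))
    rcases eq_or_eq_one_sub i k with rfl | rfl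
    · exact absurd hk (hM.not_mem_sliding_i hb)
    · have hj : γ t (1 - i) = 0 := by
        rcases hk with hk | hk <;> exact hk.1.2
      refine ⟨hj, ?_⟩
      rwa [hM.slidingField_eq hb hj] at hd
  · exfalso
    rcases eq_or_eq_one_sub i k with rfl | rfl
    · exact (hM.mul_pos_i hb).ne' hk'
    · exact (hM.mul_neg_j hb).ne hk'
  · refine Or.inr (Or.inr (Or.inr ?_))
    have hj : γ t (1 - i) = 0 := by rw [h0]; rfl
    refine ⟨hj, ?_⟩
    rcases h with ⟨h, -⟩ | ⟨k, hk, hd, -⟩ | ⟨-, h, -⟩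
    · exact absurd h hM.not_originCrossing
    · obtain rfl := hM.eq_of_originSliding hk
      rwa [hM.slidingField_eq hM.zero_mem_ball rfl, ← h0] at hd
    · exact absurd ⟨_, hM.originSliding⟩ h

/-! ### Realization of arcs of leaves and of the sliding branch -/

/-- The graph of the leaf is run with the speed of `X` or `Y` according to the side of `s = 0`. At
`s = 0` the speed may jump, but the crossing law asks only that the curve leave `Σ` at once, which
holds because the new time is injective and the arc avoids the axis. -/
theorem exists_trajectory_leaf {W : Set Plane} {y a b : ℝ} (hy : y ≠ 0) (hyδ : |y| < δ)
    (ha : |a| < δ) (hb : |b| < δ) (hab : σ * a ≤ σ * b) (ha' : 0 < leaf GX GY y a * y)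
    (hb' : 0 < leaf GX GY y b * y) (hW : ∀ s ∈ uIcc a b, pt i s (leaf GX GY y s) ∈ W) :
    ∃ T : ℝ, 0 ≤ T ∧ ∃ γ : ℝ → Plane, IsTrajectory Z W (Icc 0 T) γ ∧
      γ 0 = pt i a (leaf GX GY y a) ∧ γ T = pt i b (leaf GX GY y b) ∧
      γ '' Icc 0 T = (fun s => pt i s (leaf GX GY y s)) '' uIcc a b := by
  obtain ⟨m, M, hm, hbd⟩ := hM.bounds
  set vX : ℝ → ℝ := fun s => SX (pt i s (GX.flow 0 y s)) with hvX
  set vY : ℝ → ℝ := fun s => SY (pt i s (GY.flow 0 y s)) with hvY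
  have hcX : Continuous vX := hM.continuous_SX.comp ((continuous_pt i).comp
    (continuous_id.prodMk (GX.continuous_flow_right 0 y)))
  have hcY : Continuous vY := hM.continuous_SY.comp ((continuous_pt i).comp
    (continuous_id.prodMk (GY.continuous_flow_right 0 y)))
  set v : ℝ → ℝ := fun s => if 0 ≤ s * y then vX s else vY s with hv
  have hvm : Measurable v := Measurable.ite
    (measurableSet_le measurable_const (measurable_id.mul_const y)) hcX.measurable hcY.measurable
  obtain ⟨T, hT, θ, hθ0, hθT, hθc, hθi, hθinj, hθd⟩ := exists_time_change hM.hσ hvm hm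
    (fun s => by simp only [hv]; split_ifs; exacts [(hbd _).1, (hbd _).2]) hab
  have hlc := continuous_leaf (GX := GX) (GY := GY) hy
  refine ⟨T, hT, fun t => pt i (θ t) (leaf GX GY y (θ t)), ⟨?_, fun t ht => ?_⟩, ?_, ?_, ?_⟩
  · exact ((continuous_pt i).comp (hθc.prodMk (hlc.comp hθc))).continuousOn
  · have hs : θ t ∈ uIcc a b := by rw [← hθi]; exact mem_image_of_mem θ ht
    have hlpos := leaf_mul_pos hM.hX hM.hY hy ha' hb' hs
    have hsδ : |θ t| < δ := by
      rcases mem_uIcc.mp hs with h | h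
      · exact abs_lt.mpr ⟨(abs_lt.mp ha).1.trans_le h.1, h.2.trans_lt (abs_lt.mp hb).2⟩
      · exact abs_lt.mpr ⟨(abs_lt.mp hb).1.trans_le h.1, h.2.trans_lt (abs_lt.mp ha).2⟩
    have hball : pt i (θ t) (leaf GX GY y (θ t)) ∈ Metric.ball (0 : Plane) δ :=
      pt_mem_ball i hsδ ((abs_leaf_le hM.hX hM.hY hlpos).trans_lt hyδ)
    have hU := hM.ball_subset hball
    refine ⟨hW _ hs, Or.inl ?_⟩
    have hl0 : leaf GX GY y (θ t) ≠ 0 := fun h => by simp [h] at hlpos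
    have hsign : ∀ s : ℝ, 0 < leaf GX GY y s * y → (0 < s * leaf GX GY y s ↔ 0 < s * y) := by
      intro s h
      rcases pos_and_pos_or_neg_and_neg_of_mul_pos h with ⟨h1, h2⟩ | ⟨h1, h2⟩
      · rw [mul_pos_iff_of_pos_right h1, mul_pos_iff_of_pos_right h2]
      · rw [← neg_mul_neg, ← neg_mul_neg s y, mul_pos_iff_of_pos_right (by linarith),
          mul_pos_iff_of_pos_right (by linarith)]
    rcases lt_trichotomy (θ t * y) 0 with h | h | h
    · refine Or.inr (Or.inl ⟨⟨hU, ?_⟩, ?_⟩)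
      · rw [mul_eq_mul i, pt_self, pt_other]
        refine lt_of_le_of_ne (not_lt.mp fun h' => ?_) ?_
        · exact absurd ((hsign _ hlpos).mp h') h.not_gt
        · exact mul_ne_zero (fun h' => by simp [h'] at h) hl0
      · have hev : ∀ᶠ s in 𝓝 (θ t), s * y < 0 :=
          (by fun_prop : Continuous fun s' : ℝ => s' * y).tendsto (θ t) |>.eventually
            (gt_mem_nhds h)
        have hvc : ContinuousAt v (θ t) := hcY.continuousAt.congr
          (hev.mono fun s hs => by simp [hv, hs.not_ge])
        have hd := hθd t hvc
        have hve : v (θ t) = Z.2 (pt i (θ t) (leaf GX GY y (θ t))) i := by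
          rw [(hM.eq_Y _ hball).1, leaf_of_neg h]
          simp [hv, hvY, h.not_ge]
        refine (hasDerivAt_pt (v := Z.2 (pt i (θ t) (leaf GX GY y (θ t)))) ?_ ?_).hasDerivWithinAt
        · rwa [← hve]
        · refine ((hasDerivAt_leaf_of_neg h).comp t hd).congr_deriv ?_
          rw [(hM.eq_Y _ hball).2, hve, (hM.eq_Y _ hball).1]
          simp [mul_comm]
    · have hθ : θ t = 0 := (mul_eq_zero.mp h).resolve_right hy
      refine Or.inr (Or.inr (Or.inl ⟨fun h0 => hl0 ?_, ⟨i, hM.mem_crossing hball ?_⟩, ?_⟩))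
      · have := congrFun h0 (1 - i)
        simpa using this
      · simpa using hθ
      · filter_upwards [self_mem_nhdsWithin] with t' ht'
        have hs' : θ t' ∈ uIcc a b := by rw [← hθi]; exact mem_image_of_mem θ ht'.1
        have hlpos' := leaf_mul_pos hM.hX hM.hY hy ha' hb' hs'
        have hne : θ t' ≠ 0 := fun h' => ht'.2 (hθinj (h'.trans hθ.symm))
        have hl0' : leaf GX GY y (θ t') ≠ 0 := fun h => by simp [h] at hlpos'
        have hsδ' : |θ t'| < δ := by
          rcases mem_uIcc.mp hs' with h | h
          · exact abs_lt.mpr ⟨(abs_lt.mp ha).1.trans_le h.1, h.2.trans_lt (abs_lt.mp hb).2⟩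
          · exact abs_lt.mpr ⟨(abs_lt.mp hb).1.trans_le h.1, h.2.trans_lt (abs_lt.mp ha).2⟩
        have hU' := hM.ball_subset (pt_mem_ball i hsδ'
          ((abs_leaf_le hM.hX hM.hY hlpos').trans_lt hyδ))
        rcases (mul_ne_zero hne hl0').lt_or_gt with h1 | h1
        · exact Or.inr ⟨hU', by rw [mul_eq_mul i, pt_self, pt_other]; exact h1⟩
        · exact Or.inl ⟨hU', by rw [mul_eq_mul i, pt_self, pt_other]; exact h1⟩
    · refine Or.inl ⟨⟨hU, ?_⟩, ?_⟩
      · rw [mul_eq_mul i, pt_self, pt_other]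
        exact (hsign _ hlpos).mpr h
      · have hev : ∀ᶠ s in 𝓝 (θ t), 0 < s * y :=
          (by fun_prop : Continuous fun s' : ℝ => s' * y).tendsto (θ t) |>.eventually
            (lt_mem_nhds h)
        have hvc : ContinuousAt v (θ t) := hcX.continuousAt.congr
          (hev.mono fun s hs => by simp [hv, hs.le])
        have hd := hθd t hvc
        have hve : v (θ t) = Z.1 (pt i (θ t) (leaf GX GY y (θ t))) i := by
          rw [(hM.eq_X _ hball).1, leaf_of_pos h]
          simp [hv, hvX, h.le]
        refine (hasDerivAt_pt (v := Z.1 (pt i (θ t) (leaf GX GY y (θ t)))) ?_ ?_).hasDerivWithinAt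
        · rwa [← hve]
        · refine ((hasDerivAt_leaf_of_pos h).comp t hd).congr_deriv ?_
          rw [(hM.eq_X _ hball).2, hve, (hM.eq_X _ hball).1]
          simp [mul_comm]
  · simp [hθ0]
  · simp [hθT]
  · rw [← hθi, image_image]

theorem exists_trajectory_slide {W : Set Plane} {a b : ℝ} (ha : |a| < δ) (hb : |b| < δ)
    (hab : σ * a ≤ σ * b) (hW : ∀ s ∈ uIcc a b, pt i s 0 ∈ W) :
    ∃ T : ℝ, 0 ≤ T ∧ ∃ γ : ℝ → Plane, IsTrajectory Z W (Icc 0 T) γ ∧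
      γ 0 = pt i a 0 ∧ γ T = pt i b 0 ∧ γ '' Icc 0 T = (fun s => pt i s 0) '' uIcc a b := by
  obtain ⟨m, M, hm, hbd⟩ := hM.slideSpeed_bounds
  obtain ⟨T, hT, θ, hθ0, hθT, hθc, hθi, hθinj, hθd⟩ := exists_time_change hM.hσ
    hM.continuous_slideSpeed.measurable hm hbd hab
  refine ⟨T, hT, fun t => pt i (θ t) 0, ⟨?_, fun t ht => ?_⟩, ?_, ?_, ?_⟩
  · exact ((continuous_pt i).comp (hθc.prodMk continuous_const)).continuousOn
  · have hs : ∀ t ∈ Icc 0 T, θ t ∈ uIcc a b := fun t ht => by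
      rw [← hθi]; exact mem_image_of_mem θ ht
    have hball : ∀ t ∈ Icc 0 T, pt i (θ t) 0 ∈ Metric.ball (0 : Plane) δ := fun t ht => by
      refine pt_mem_ball i ?_ (by simpa using hM.hδ)
      rcases mem_uIcc.mp (hs t ht) with h | h
      · exact abs_lt.mpr ⟨(abs_lt.mp ha).1.trans_le h.1, h.2.trans_lt (abs_lt.mp hb).2⟩
      · exact abs_lt.mpr ⟨(abs_lt.mp hb).1.trans_le h.1, h.2.trans_lt (abs_lt.mp ha).2⟩
    have hd : HasDerivWithinAt (fun t => pt i (θ t) 0)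
        (slidingField Z (1 - i) (pt i (θ t) 0)) (Icc 0 T) t := by
      rw [hM.slidingField_eq (hball t ht) (by simp)]
      refine (hasDerivAt_pt ?_ ?_).hasDerivWithinAt
      · simpa using hθd t hM.continuous_slideSpeed.continuousAt
      · simpa using hasDerivAt_const t (0 : ℝ)
    refine ⟨hW _ (hs t ht), ?_⟩
    -- The origin is neither a sliding nor an escaping point; the passage through it is governed by
    -- the origin law.
    by_cases h0 : θ t = 0
    · refine Or.inr (Or.inr ⟨by simp [h0], Or.inr (Or.inl ⟨1 - i, hM.originSliding, ?_, ?_⟩)⟩)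
      · simpa [h0] using hd
      · filter_upwards [self_mem_nhdsWithin] with t' ht'
        exact ⟨hM.ball_subset (hball t' ht'), by simp⟩
    · exact Or.inl (Or.inr (Or.inr (Or.inr ⟨1 - i,
        hM.mem_sliding_or_escaping (hball t ht) (by simp) (by simpa using h0), hd⟩)))
  · simp [hθ0]
  · simp [hθT]
  · rw [← hθi, image_image]

end LocalModel

end

/-! ### Every trajectory in a local model is an arc of the axis or of a leaf -/

section

/-- Continuous induction. The hypothesis concerns only the right germ at each time, so it also
applies at crossing instants, where no derivative is prescribed. -/
theorem strictMonoOn_of_eventually_lt {f : ℝ → ℝ} {a b : ℝ} (hc : ContinuousOn f (Icc a b))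
    (h : ∀ t ∈ Ico a b, ∀ᶠ s in 𝓝[>] t, f t < f s) : StrictMonoOn f (Icc a b) := by
  have hle : ∀ x ∈ Icc a b, ∀ y ∈ Icc a b, x ≤ y → f x ≤ f y := by
    intro x hx y hy hxy
    have hsub : Icc x y ⊆ Icc a b := Icc_subset_Icc hx.1 hy.2
    have hcl : IsClosed ({z | f x ≤ f z} ∩ Icc x y) := by
      rw [inter_comm]
      exact (hc.mono hsub).preimage_isClosed_of_isClosed isClosed_Icc isClosed_Ici
    refine hcl.Icc_subset_of_forall_exists_gt (le_refl (f x)) ?_ ⟨hxy, le_rfl⟩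
    rintro z ⟨hz, hz'⟩ w hw
    obtain ⟨s, hs, hs'⟩ := ((h z ⟨hx.1.trans hz'.1, hz'.2.trans_le hy.2⟩).and
      (Ioc_mem_nhdsGT hw)).exists
    have hz : f x ≤ f z := hz
    exact ⟨s, hz.trans hs.le, hs'⟩
  intro x hx y hy hxy
  obtain ⟨s, hs, hs'⟩ := ((h x ⟨hx.1, hxy.trans_le hy.2⟩).and (Ioc_mem_nhdsGT hxy)).exists
  exact hs.trans_le (hle s ⟨hx.1.trans hs'.1.le, hs'.2.trans hy.2⟩ y hy hs'.2)

theorem eventually_lt_of_hasDerivWithinAt {f : ℝ → ℝ} {I : Set ℝ} {f' t : ℝ}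
    (h : HasDerivWithinAt f f' I t) (hI : I ∈ 𝓝[>] t) (hf' : 0 < f') :
    ∀ᶠ s in 𝓝[>] t, f t < f s := by
  have h1 := h.mono_of_mem_nhdsWithin hI
  rw [hasDerivWithinAt_iff_tendsto_slope' (by simp)] at h1
  filter_upwards [h1.eventually (lt_mem_nhds hf'), self_mem_nhdsWithin] with s hs hs'
  rw [slope_def_field] at hs
  have hs' : 0 < s - t := sub_pos.mpr hs'
  have := (div_pos_iff_of_pos_right hs').mp hs
  linarith

variable {U : OriginNhd} {r : ℕ}

theorem HasDerivWithinAt.coord {γ : ℝ → Plane} {v : Plane} {I : Set ℝ} {t : ℝ}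
    (h : HasDerivWithinAt γ v I t) (k : Fin 2) :
    HasDerivWithinAt (fun s => γ s k) (v k) I t := (hasDerivWithinAt_pi.mp h) k

namespace LocalModel

variable {Z : Omega U r} {i : Fin 2} {σ δ : ℝ} {GX GY : Slope} {SX SY : Plane → ℝ}
  (hM : LocalModel Z i σ δ GX GY SX SY)
include hM

section Trajectory

variable {W : Set Plane} {T : ℝ} {γ : ℝ → Plane} (h : IsTrajectory Z W (Icc 0 T) γ)
  (hb : ∀ t ∈ Icc 0 T, γ t ∈ Metric.ball (0 : Plane) δ)
include h hb

/-- `X`, `Y` and the sliding field all have an `i`-component of sign `σ`. At a crossing instant the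
curve is off `Σ` just afterwards, and the sign of the derivative there gives the increase. -/
theorem strictMonoOn : StrictMonoOn (fun t => σ * γ t i) (Icc 0 T) := by
  have hc : ContinuousOn (fun t => σ * γ t i) (Icc 0 T) :=
    (((continuous_apply i).comp_continuousOn h.1).const_smul σ)
  have hsl : ∀ s, 0 < σ * slideSpeed i GX GY SX SY s := fun s => by
    obtain ⟨m, M, hm, hs⟩ := hM.slideSpeed_bounds
    exact hm.trans_le (hs s).1
  refine strictMonoOn_of_eventually_lt hc fun t ht => ?_
  have ht' : t ∈ Icc 0 T := Ico_subset_Icc_self ht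
  have hI : Icc 0 T ∈ 𝓝[>] t := Icc_mem_nhdsGT_of_mem ht
  have key : ∀ v : Plane, HasDerivWithinAt γ v (Icc 0 T) t → 0 < σ * v i →
      ∀ᶠ s in 𝓝[>] t, σ * γ t i < σ * γ s i := fun v hv hv' =>
    eventually_lt_of_hasDerivWithinAt (f := fun t => σ * γ t i)
      ((HasDerivWithinAt.coord hv i).const_mul σ) hI hv'
  rcases hM.law h ht' (hb t ht') with ⟨-, hd⟩ | ⟨-, hd⟩ | ⟨h0, hj, hev⟩ | ⟨-, hd⟩
  · exact key _ hd (hM.X_pos (hb t ht'))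
  · exact key _ hd (hM.Y_pos (hb t ht'))
  · have hev' : ∀ᶠ s in 𝓝[>] t, γ s i * γ s (1 - i) ≠ 0 := by
      refine hev.filter_mono (nhdsWithin_le_of_mem ?_)
      filter_upwards [hI, self_mem_nhdsWithin] with s hs hs'
      exact ⟨hs, ne_of_gt hs'⟩
    obtain ⟨b, hb', hsub⟩ := mem_nhdsGT_iff_exists_Ioc_subset.mp (inter_mem hev' hI)
    have hb' : t < b := hb'
    have hIcc : Icc t b ⊆ Icc 0 T := by
      intro s hs
      rcases hs.1.eq_or_lt with rfl | hlt
      · exact ht'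
      · exact (hsub ⟨hlt, hs.2⟩).2
    have hmono : StrictMonoOn (fun t => σ * γ t i) (Icc t b) := by
      refine strictMonoOn_of_deriv_pos (convex_Icc t b) (hc.mono hIcc) fun s hs => ?_
      rw [interior_Icc] at hs
      have hs1 := hsub (Ioo_subset_Ioc_self hs)
      have hs0 : γ s i * γ s (1 - i) ≠ 0 := hs1.1
      have hn : Icc 0 T ∈ 𝓝 s := mem_of_superset (Icc_mem_nhds hs.1 hs.2) hIcc
      have key' : ∀ v : Plane, HasDerivWithinAt γ v (Icc 0 T) s → 0 < σ * v i →
          0 < deriv (fun t => σ * γ t i) s := fun v hv hv' => by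
        rwa [(((HasDerivWithinAt.coord hv i).hasDerivAt hn).const_mul σ).deriv]
      rcases hM.law h hs1.2 (hb s hs1.2) with ⟨-, hd⟩ | ⟨-, hd⟩ | ⟨h0, -, -⟩ | ⟨h0, -⟩
      · exact key' _ hd (hM.X_pos (hb s hs1.2))
      · exact key' _ hd (hM.Y_pos (hb s hs1.2))
      · exact absurd (by rw [h0, zero_mul]) hs0
      · exact absurd (by rw [h0, mul_zero]) hs0
    filter_upwards [Ioc_mem_nhdsGT hb'] with s hs
    exact hmono ⟨le_rfl, hb'.le⟩ ⟨hs.1.le, hs.2⟩ hs.1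
  · refine key _ hd ?_
    rw [pt_self]
    exact hsl _

/-- On a time interval that avoids `Σ` the product of the coordinates keeps its sign, so one and the
same field governs the motion. -/
theorem exists_field {a b : ℝ} (hab : a < b) (ha : 0 ≤ a) (hbT : b ≤ T)
    (h0 : ∀ s ∈ Ioo a b, γ s i * γ s (1 - i) ≠ 0) :
    ∃ V : Plane → Plane, (∀ p ∈ Metric.ball (0 : Plane) δ, ContinuousAt V p) ∧
      (∀ p ∈ Metric.ball (0 : Plane) δ, V p (1 - i) ≠ 0) ∧
      ∀ s ∈ Ioo a b, HasDerivAt γ (V (γ s)) s := by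
  have hsub : Ioo a b ⊆ Icc 0 T := fun s hs => ⟨ha.trans hs.1.le, hs.2.le.trans hbT⟩
  have hf : ContinuousOn (fun s => γ s i * γ s (1 - i)) (Ioo a b) :=
    (ContinuousOn.mul ((continuous_apply i).comp_continuousOn h.1)
      ((continuous_apply (1 - i)).comp_continuousOn h.1)).mono hsub
  have hn : ∀ s ∈ Ioo a b, Icc 0 T ∈ 𝓝 s := fun s hs =>
    mem_of_superset (Icc_mem_nhds hs.1 hs.2) (Icc_subset_Icc ha hbT)
  have hVc : ∀ V : CrField U r, ∀ p ∈ Metric.ball (0 : Plane) δ, ContinuousAt V p :=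
    fun V p hp => V.2.1.continuousOn.continuousAt (U.isOpen'.mem_nhds (hM.ball_subset hp))
  have hpc : IsPreconnected ((fun s => γ s i * γ s (1 - i)) '' Ioo a b) :=
    isPreconnected_Ioo.image _ hf
  have hmid : (a + b) / 2 ∈ Ioo a b := ⟨by linarith, by linarith⟩
  have hconst : ∀ s ∈ Ioo a b, ∀ t ∈ Ioo a b, 0 < γ s i * γ s (1 - i) →
      0 < γ t i * γ t (1 - i) := by
    intro s hs t ht hpos
    by_contra hneg
    obtain ⟨u, hu, hu0⟩ := hpc.Icc_subset (mem_image_of_mem _ ht) (mem_image_of_mem _ hs)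
      ⟨not_lt.mp hneg, hpos.le⟩
    exact h0 u hu hu0
  rcases (h0 _ hmid).lt_or_gt with hm | hm
  · refine ⟨Z.2, hVc _, fun p hp h' => by simpa [h'] using hM.Y_pos' hp, fun s hs => ?_⟩
    rcases hM.law h (hsub hs) (hb s (hsub hs)) with ⟨h1, -⟩ | ⟨-, hd⟩ | ⟨h1, -, -⟩ | ⟨h1, -⟩
    · exact absurd (hconst s hs _ hmid h1) hm.not_gt
    · exact hd.hasDerivAt (hn s hs)
    · exact absurd (by rw [h1, zero_mul]) (h0 s hs)
    · exact absurd (by rw [h1, mul_zero]) (h0 s hs)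
  · refine ⟨Z.1, hVc _, fun p hp h' => by simpa [h'] using hM.X_neg hp, fun s hs => ?_⟩
    rcases hM.law h (hsub hs) (hb s (hsub hs)) with ⟨-, hd⟩ | ⟨h1, -⟩ | ⟨h1, -, -⟩ | ⟨h1, -⟩
    · exact hd.hasDerivAt (hn s hs)
    · exact absurd (hconst _ hmid s hs hm) h1.not_gt
    · exact absurd (by rw [h1, zero_mul]) (h0 s hs)
    · exact absurd (by rw [h1, mul_zero]) (h0 s hs)

/-- This is the reason why orbits of `X` and `Y` do not reach the axis in finite time. At an end of
the interval the one-sided derivative of `u` is the limit of its derivatives, a nonzero component of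
`X` or `Y`. If the end were on the axis, the law there would make this derivative zero. -/
theorem ne_zero_of_gap {a b : ℝ} (hab : a < b) (ha : 0 ≤ a) (hbT : b ≤ T)
    (h0 : ∀ s ∈ Ioo a b, γ s i * γ s (1 - i) ≠ 0) : γ a (1 - i) ≠ 0 ∧ γ b (1 - i) ≠ 0 := by
  obtain ⟨V, hVc, hV0, hVd⟩ := hM.exists_field h hb hab ha hbT h0
  have haI : a ∈ Icc 0 T := ⟨ha, hab.le.trans hbT⟩
  have hbI : b ∈ Icc 0 T := ⟨ha.trans hab.le, hbT⟩
  have hsub : Icc a b ⊆ Icc 0 T := Icc_subset_Icc ha hbT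
  set f : ℝ → ℝ := fun s => γ s (1 - i) with hf
  have hfc : ContinuousOn f (Icc a b) :=
    ((continuous_apply (1 - i)).comp_continuousOn h.1).mono hsub
  have hd : ∀ s ∈ Ioo a b, HasDerivAt f (V (γ s) (1 - i)) s := fun s hs =>
    (hasDerivAt_pi.mp (hVd s hs)) (1 - i)
  have hdiff : DifferentiableOn ℝ f (Ioo a b) := fun s hs =>
    (hd s hs).differentiableAt.differentiableWithinAt
  have hlim : ∀ c ∈ Icc a b, Tendsto (deriv f) (𝓝[Ioo a b] c) (𝓝 (V (γ c) (1 - i))) := by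
    intro c hc
    have h1 : Tendsto γ (𝓝[Ioo a b] c) (𝓝 (γ c)) :=
      (h.1 c (hsub hc)).mono_left (nhdsWithin_mono _ (Ioo_subset_Icc_self.trans hsub))
    have h2 : Tendsto (fun s => V (γ s) (1 - i)) (𝓝[Ioo a b] c) (𝓝 (V (γ c) (1 - i))) :=
      ((continuous_apply (1 - i)).tendsto _).comp ((hVc _ (hb c (hsub hc))).tendsto.comp h1)
    exact h2.congr' (by filter_upwards [self_mem_nhdsWithin] with s hs using (hd s hs).deriv.symm)
  have hdrop : ∀ c ∈ Icc 0 T, f c = 0 → HasDerivWithinAt f 0 (Icc 0 T) c := by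
    intro c hc hc0
    rcases hM.law h hc (hb c hc) with ⟨h1, -⟩ | ⟨h1, -⟩ | ⟨-, h1, -⟩ | ⟨-, hd⟩
    · have hc0 : γ c (1 - i) = 0 := hc0
      simp [hc0] at h1
    · have hc0 : γ c (1 - i) = 0 := hc0
      simp [hc0] at h1
    · exact absurd hc0 h1
    · simpa using HasDerivWithinAt.coord hd (1 - i)
  constructor
  · intro hz
    have h1 : HasDerivWithinAt f (V (γ a) (1 - i)) (Ici a) a :=
      hasDerivWithinAt_Ici_of_tendsto_deriv hdiff
        ((hfc a ⟨le_rfl, hab.le⟩).mono Ioo_subset_Icc_self) (Ioo_mem_nhdsGT hab)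
        (by rw [← nhdsWithin_Ioo_eq_nhdsGT hab]; exact hlim a ⟨le_rfl, hab.le⟩)
    have h2 := (hdrop a haI hz).mono hsub
    have h3 := (uniqueDiffOn_Icc hab a ⟨le_rfl, hab.le⟩).eq_deriv _
      (h1.mono Icc_subset_Ici_self) h2
    exact hV0 _ (hb a haI) h3
  · intro hz
    have h1 : HasDerivWithinAt f (V (γ b) (1 - i)) (Iic b) b :=
      hasDerivWithinAt_Iic_of_tendsto_deriv hdiff
        ((hfc b ⟨hab.le, le_rfl⟩).mono Ioo_subset_Icc_self) (Ioo_mem_nhdsLT hab)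
        (by rw [← nhdsWithin_Ioo_eq_nhdsLT hab]; exact hlim b ⟨hab.le, le_rfl⟩)
    have h2 := (hdrop b hbI hz).mono hsub
    have h3 := (uniqueDiffOn_Icc hab b ⟨hab.le, le_rfl⟩).eq_deriv _
      (h1.mono Icc_subset_Iic_self) h2
    exact hV0 _ (hb b hbI) h3

theorem eq_of_zero {s t : ℝ} (hs : s ∈ Icc 0 T) (ht : t ∈ Icc 0 T) (hs0 : γ s i = 0)
    (ht0 : γ t i = 0) : s = t :=
  (hM.strictMonoOn h hb).injOn hs ht (by simp [hs0, ht0])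

/-- If a trajectory were on the axis at one time and off it at another, take the last (or first)
instant on the axis between them. As the crossing branch is met at most once, an interval free of
`Σ` is adjacent to that instant, contrary to `ne_zero_of_gap`. -/
theorem slides_or_avoids : (∀ t ∈ Icc 0 T, γ t (1 - i) = 0) ∨ ∀ t ∈ Icc 0 T, γ t (1 - i) ≠ 0 := by
  by_contra! hcon
  obtain ⟨⟨t1, ht1, hne⟩, t0, ht0, hz⟩ := hcon
  have hcj : ContinuousOn (fun t => γ t (1 - i)) (Icc 0 T) :=
    (continuous_apply (1 - i)).comp_continuousOn h.1
  have hcompact : ∀ a b : ℝ, Icc a b ⊆ Icc 0 T →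
      IsCompact (Icc a b ∩ (fun t => γ t (1 - i)) ⁻¹' {0}) := fun a b hab =>
    isCompact_Icc.of_isClosed_subset
      ((hcj.mono hab).preimage_isClosed_of_isClosed isClosed_Icc isClosed_singleton)
      inter_subset_left
  rcases lt_trichotomy t0 t1 with hlt | rfl | hlt
  · have hsub : Icc t0 t1 ⊆ Icc 0 T := Icc_subset_Icc ht0.1 ht1.2
    obtain ⟨a, ⟨ha, ha0⟩, hmax⟩ := (hcompact t0 t1 hsub).exists_isGreatest
      ⟨t0, ⟨le_rfl, hlt.le⟩, hz⟩
    have hat : a < t1 := lt_of_le_of_ne ha.2 fun he => hne (by rw [← he]; exact ha0)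
    have hj : ∀ s ∈ Ioc a t1, γ s (1 - i) ≠ 0 := fun s hs hs0 =>
      hs.1.not_ge (hmax ⟨⟨ha.1.trans hs.1.le, hs.2⟩, hs0⟩)
    -- The interval is stopped at the unique meeting with the crossing branch, if there is one.
    obtain ⟨b, hab, hbt, hi⟩ : ∃ b, a < b ∧ b ≤ t1 ∧ ∀ s ∈ Ioo a b, γ s i ≠ 0 := by
      by_cases hz : ∃ z ∈ Ioo a t1, γ z i = 0
      · obtain ⟨z, hz, hz0⟩ := hz
        refine ⟨z, hz.1, hz.2.le, fun s hs hs0 => hs.2.ne ?_⟩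
        exact hM.eq_of_zero h hb (hsub ⟨ha.1.trans hs.1.le, (hs.2.trans hz.2).le⟩)
          (hsub ⟨ha.1.trans hz.1.le, hz.2.le⟩) hs0 hz0
      · push Not at hz
        exact ⟨t1, hat, le_rfl, hz⟩
    exact (hM.ne_zero_of_gap h hb hab (ht0.1.trans ha.1) (hbt.trans ht1.2) fun s hs =>
      mul_ne_zero (hi s hs) (hj s ⟨hs.1, hs.2.le.trans hbt⟩)).1 ha0
  · exact hne hz
  · have hsub : Icc t1 t0 ⊆ Icc 0 T := Icc_subset_Icc ht1.1 ht0.2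
    obtain ⟨b, ⟨hb1, hb0⟩, hmin⟩ := (hcompact t1 t0 hsub).exists_isLeast
      ⟨t0, ⟨hlt.le, le_rfl⟩, hz⟩
    have hbt : t1 < b := lt_of_le_of_ne hb1.1 fun he => hne (by rw [he]; exact hb0)
    have hj : ∀ s ∈ Ico t1 b, γ s (1 - i) ≠ 0 := fun s hs hs0 =>
      hs.2.not_ge (hmin ⟨⟨hs.1, hs.2.le.trans hb1.2⟩, hs0⟩)
    obtain ⟨a, hab, hat, hi⟩ : ∃ a, a < b ∧ t1 ≤ a ∧ ∀ s ∈ Ioo a b, γ s i ≠ 0 := by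
      by_cases hz : ∃ z ∈ Ioo t1 b, γ z i = 0
      · obtain ⟨z, hz, hz0⟩ := hz
        refine ⟨z, hz.2, hz.1.le, fun s hs hs0 => hs.1.ne' ?_⟩
        exact hM.eq_of_zero h hb (hsub ⟨(hz.1.trans hs.1).le, hs.2.le.trans hb1.2⟩)
          (hsub ⟨hz.1.le, hz.2.le.trans hb1.2⟩) hs0 hz0
      · push Not at hz
        exact ⟨t1, hbt, le_rfl, hz⟩
    exact (hM.ne_zero_of_gap h hb hab (ht1.1.trans hat) (hb1.2.trans ht0.2) fun s hs =>
      mul_ne_zero (hi s hs) (hj s ⟨hat.trans hs.1.le, hs.2⟩)).2 hb0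

/-- Off the crossing branch the label is a first integral of the field in force. That branch is met
at most once and the label is continuous there, so the zero derivative elsewhere suffices. -/
theorem label_const (h0 : ∀ t ∈ Icc 0 T, γ t (1 - i) ≠ 0) {t : ℝ} (ht : t ∈ Icc 0 T) :
    label GX GY (γ t i) (γ t (1 - i)) = label GX GY (γ 0 i) (γ 0 (1 - i)) := by
  set L : ℝ → ℝ := fun t => label GX GY (γ t i) (γ t (1 - i)) with hL
  have hpair : ContinuousOn (fun t => (γ t i, γ t (1 - i))) (Icc 0 T) :=
    ((continuous_apply i).prodMk (continuous_apply (1 - i))).comp_continuousOn h.1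
  have hc : ContinuousOn L (Icc 0 T) := fun s hs =>
    (continuousAt_label (h0 s hs)).tendsto.comp (hpair s hs)
  have hsub : Icc 0 t ⊆ Icc 0 T := Icc_subset_Icc le_rfl ht.2
  have hcount : ({s | s ∈ Icc 0 T ∧ γ s i = 0} : Set ℝ).Countable :=
    Set.Subsingleton.countable fun s hs s' hs' => hM.eq_of_zero h hb hs.1 hs'.1 hs.2 hs'.2
  have hflow : ∀ (G : Slope) (s : ℝ) (v : Plane), HasDerivAt γ v s →
      v (1 - i) = v i * G.g (γ s i, γ s (1 - i)) →
      HasDerivAt (fun t => G.flow (γ t i) (γ t (1 - i)) 0) 0 s := by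
    intro G s v hv hve
    have h1 : HasDerivAt (fun t => (γ t i, γ t (1 - i))) (v i, v (1 - i)) s :=
      ((hasDerivAt_pi.mp hv) i).prodMk ((hasDerivAt_pi.mp hv) (1 - i))
    have h2 := (G.hasFDerivAt_flow (γ s i) (γ s (1 - i)) 0).comp_hasDerivAt s h1
    refine h2.congr_deriv ?_
    simp [hve, mul_comm]
  have := MeasureTheory.integral_eq_of_hasDerivAt_off_countable_of_le L (fun _ => 0) ht.1 hcount
    (hc.mono hsub) (fun s hs => ?_) intervalIntegrable_const
  · simp only [intervalIntegral.integral_zero] at this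
    exact (sub_eq_zero.mp this.symm)
  · have hsI : s ∈ Icc 0 T := hsub (Ioo_subset_Icc_self hs.1)
    have hn : Icc 0 T ∈ 𝓝 s := mem_of_superset (Icc_mem_nhds hs.1.1 hs.1.2) hsub
    have hprod : ContinuousAt (fun t => γ t i * γ t (1 - i)) s :=
      (ContinuousOn.mul ((continuous_apply i).comp_continuousOn h.1)
        ((continuous_apply (1 - i)).comp_continuousOn h.1)).continuousAt hn
    rcases hM.law h hsI (hb s hsI) with ⟨h1, hd⟩ | ⟨h1, hd⟩ | ⟨h1, -, -⟩ | ⟨h1, -⟩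
    · refine (hflow GX s _ (hd.hasDerivAt hn) ?_).congr_of_eventuallyEq ?_
      · rw [(hM.eq_X _ (hb s hsI)).1, (hM.eq_X _ (hb s hsI)).2]
      · filter_upwards [hprod.eventually (lt_mem_nhds h1)] with u hu
        exact if_pos hu.le
    · refine (hflow GY s _ (hd.hasDerivAt hn) ?_).congr_of_eventuallyEq ?_
      · rw [(hM.eq_Y _ (hb s hsI)).1, (hM.eq_Y _ (hb s hsI)).2]
      · filter_upwards [hprod.eventually (gt_mem_nhds h1)] with u hu
        exact if_neg hu.not_ge
    · exact absurd ⟨hsI, h1⟩ hs.2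
    · exact absurd h1 (h0 s hsI)

theorem image_coord (hT : 0 ≤ T) : (fun t => γ t i) '' Icc 0 T = uIcc (γ 0 i) (γ T i) := by
  have hm := hM.strictMonoOn h hb
  have hc : ContinuousOn (fun t => γ t i) (Icc 0 T) := (continuous_apply i).comp_continuousOn h.1
  apply Subset.antisymm
  · rintro _ ⟨t, ht, rfl⟩
    have h1 := hm.monotoneOn ⟨le_rfl, hT⟩ ht ht.1
    have h2 := hm.monotoneOn ht ⟨hT, le_rfl⟩ ht.2
    simp only at h1 h2 ⊢
    rw [mem_uIcc]
    rcases hM.hσ with e | e <;> rw [e] at h1 h2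
    · left; constructor <;> linarith
    · right; constructor <;> linarith
  · have := intermediate_value_uIcc (a := 0) (b := T) (f := fun t => γ t i)
      (by rwa [uIcc_of_le hT])
    rwa [uIcc_of_le hT] at this

theorem arc_mono (hT : 0 ≤ T) : σ * γ 0 i ≤ σ * γ T i :=
  (hM.strictMonoOn h hb).monotoneOn ⟨le_rfl, hT⟩ ⟨hT, le_rfl⟩ hT

end Trajectory

end LocalModel

end

section

/-! ### Orientation -/

/-- A map that preserves the sign of each coordinate moves a vector by an angle less than `π / 2`:
the inner product with the original direction is positive. The angle of the image is thus `s +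
arctan (cross / dot)`, and the correction is periodic. -/
theorem orientationPreservingAtZero_of_sign {φ : Plane → Plane} (hc : Continuous φ) (h0 : φ 0 = 0)
    (hpos : ∀ p k, 0 < p k → 0 < φ p k) (hneg : ∀ p k, p k < 0 → φ p k < 0) :
    OrientationPreservingAtZero φ := by
  filter_upwards [self_mem_nhdsWithin] with ρ hρ
  have hρ : 0 < ρ := hρ
  set v : ℝ → Plane := fun s => φ ![ρ * Real.cos s, ρ * Real.sin s] with hv
  set dot : ℝ → ℝ := fun s => Real.cos s * v s 0 + Real.sin s * v s 1 with hdot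
  set cross : ℝ → ℝ := fun s => Real.cos s * v s 1 - Real.sin s * v s 0 with hcross
  have hsgn : ∀ (c w : ℝ) (p : Plane) (k : Fin 2), p k = ρ * c → w = φ p k →
      0 ≤ c * w ∧ (c ≠ 0 → 0 < c * w) := by
    intro c w p k hp hw
    rcases lt_trichotomy c 0 with h | h | h
    · have := mul_pos_of_neg_of_neg h
        (hw ▸ hneg p k (by rw [hp]; exact mul_neg_of_pos_of_neg hρ h))
      exact ⟨this.le, fun _ => this⟩
    · simp [h]
    · have := mul_pos h (hw ▸ hpos p k (by rw [hp]; exact mul_pos hρ h))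
      exact ⟨this.le, fun _ => this⟩
  have hd : ∀ s, 0 < dot s := by
    intro s
    have h1 := hsgn (Real.cos s) (v s 0) ![ρ * Real.cos s, ρ * Real.sin s] 0 rfl rfl
    have h2 := hsgn (Real.sin s) (v s 1) ![ρ * Real.cos s, ρ * Real.sin s] 1 rfl rfl
    by_cases hcs : Real.cos s = 0
    · have hs : Real.sin s ≠ 0 := fun hs => by
        have := Real.sin_sq_add_cos_sq s
        simp [hs, hcs] at this
      exact add_pos_of_nonneg_of_pos h1.1 (h2.2 hs)
    · exact add_pos_of_pos_of_nonneg (h1.2 hcs) h2.1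
  have hvc : Continuous v := hc.comp (continuous_pi fun k => by
    fin_cases k
    · exact Real.continuous_cos.const_mul ρ
    · exact Real.continuous_sin.const_mul ρ)
  have hv0 : Continuous fun s => v s 0 := (continuous_apply 0).comp hvc
  have hv1 : Continuous fun s => v s 1 := (continuous_apply 1).comp hvc
  have hdc : Continuous dot := by fun_prop
  have hcc : Continuous cross := by fun_prop
  refine ⟨fun s => dot s * √(1 + (cross s / dot s) ^ 2),
    fun s => s + Real.arctan (cross s / dot s), ?_, fun s => ?_, fun s => ?_, fun s => ?_⟩
  · exact continuous_id.add (Real.continuous_arctan.comp (hcc.div hdc fun s => (hd s).ne'))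
  · exact mul_pos (hd s) (Real.sqrt_pos.mpr (by positivity))
  · have hd' := (hd s).ne'
    have hsq : √(1 + (cross s / dot s) ^ 2) ≠ 0 := (Real.sqrt_pos.mpr (by positivity)).ne'
    have hcs := Real.sin_sq_add_cos_sq s
    have e0 : Real.cos s * dot s - Real.sin s * cross s = v s 0 := by
      simp only [hdot, hcross]
      linear_combination v s 0 * hcs
    have e1 : Real.sin s * dot s + Real.cos s * cross s = v s 1 := by
      simp only [hdot, hcross]
      linear_combination v s 1 * hcs
    rw [h0, sub_zero, Real.cos_add, Real.sin_add, Real.cos_arctan, Real.sin_arctan]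
    change v s = _
    funext k
    fin_cases k
    · change v s 0 = dot s * √(1 + (cross s / dot s) ^ 2) * (Real.cos s *
        (1 / √(1 + (cross s / dot s) ^ 2)) - Real.sin s *
        (cross s / dot s / √(1 + (cross s / dot s) ^ 2)))
      rw [← e0]
      field_simp
    · change v s 1 = dot s * √(1 + (cross s / dot s) ^ 2) * (Real.sin s *
        (1 / √(1 + (cross s / dot s) ^ 2)) + Real.cos s *
        (cross s / dot s / √(1 + (cross s / dot s) ^ 2)))
      rw [← e1]
      field_simp
  · have hvp : v (s + 2 * Real.pi) = v s := by simp [hv]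
    simp only [hdot, hcross, hvp, Real.cos_add_two_pi, Real.sin_add_two_pi]
    ring

/-! ### Conjugacies of pairs of slopes -/

/-- `h` and `κ` conjugate the pair of maps `ell` of `GX`, `GY` to that of `HX`, `HY`. -/
structure Conj (GX GY HX HY : Slope) (h κ : ℝ ≃o ℝ) : Prop where
  h_zero : h 0 = 0
  κ_zero : κ 0 = 0
  eq_X : ∀ s, HX.ell (h s) = κ (GX.ell s)
  eq_Y : ∀ s, HY.ell (h s) = κ (GY.ell s)

/-- The second coordinate of the map which carries the point of label `y` over `s` to the point
of label `κ y` over `h s`. -/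
def transfer (G H : Slope) (h κ : ℝ ≃o ℝ) (s u : ℝ) : ℝ := H.flow 0 (κ (G.flow s u 0)) (h s)

/-- The map `transfer` of the first pair of slopes where `s * u` is nonnegative and that of the
second pair elsewhere. -/
def glue (GX GY HX HY : Slope) (h κ : ℝ ≃o ℝ) (s u : ℝ) : ℝ :=
  if 0 ≤ s * u then transfer GX HX h κ s u else transfer GY HY h κ s u

/-- The map of the plane defined by `glue`. -/
def conjMap (i : Fin 2) (GX GY HX HY : Slope) (h κ : ℝ ≃o ℝ) (p : Plane) : Plane :=
  pt i (h (p i)) (glue GX GY HX HY h κ (p i) (p (1 - i)))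

theorem transfer_strictMono (G H : Slope) (h κ : ℝ ≃o ℝ) (s : ℝ) :
    StrictMono (transfer G H h κ s) :=
  (H.flow_strictMono 0 (h s)).comp (κ.strictMono.comp (G.flow_strictMono s 0))

theorem continuous_transfer (G H : Slope) (h κ : ℝ ≃o ℝ) :
    Continuous fun p : ℝ × ℝ => transfer G H h κ p.1 p.2 := by
  have h1 : Continuous fun p : ℝ × ℝ => G.flow p.1 p.2 0 :=
    G.continuous_flow.comp (by fun_prop : Continuous fun p : ℝ × ℝ => (p.1, p.2, (0 : ℝ)))
  exact H.continuous_flow.comp (continuous_const.prodMk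
    ((κ.continuous.comp h1).prodMk (h.continuous.comp continuous_fst)))

theorem flow_transfer (G H : Slope) (h κ : ℝ ≃o ℝ) (s u : ℝ) :
    H.flow (h s) (transfer G H h κ s u) 0 = κ (G.flow s u 0) := by
  rw [transfer, Slope.flow_flow, Slope.flow_self]

theorem transfer_symm_transfer (G H : Slope) (h κ : ℝ ≃o ℝ) (s u : ℝ) :
    transfer H G h.symm κ.symm (h s) (transfer G H h κ s u) = u := by
  rw [transfer, flow_transfer, h.symm_apply_apply, κ.symm_apply_apply, Slope.flow_flow,
    Slope.flow_self]

/-- The conjugacy equation enters here: it says that the ends of leaves go to the ends of leaves, so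
that the axis is mapped to itself. -/
theorem transfer_zero_of_ell {G H : Slope} {h κ : ℝ ≃o ℝ} {s : ℝ}
    (he : H.ell (h s) = κ (G.ell s)) : transfer G H h κ s 0 = 0 := by
  rw [transfer, ← Slope.ell, ← he, Slope.ell, Slope.flow_flow, Slope.flow_self]

namespace Conj

variable {GX GY HX HY : Slope} {h κ : ℝ ≃o ℝ} (hc : Conj GX GY HX HY h κ)
include hc

theorem symm : Conj HX HY GX GY h.symm κ.symm where
  h_zero := by rw [h.symm_apply_eq, hc.h_zero]
  κ_zero := by rw [κ.symm_apply_eq, hc.κ_zero]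
  eq_X s := by rw [← κ.symm_apply_apply (GX.ell _), ← hc.eq_X, h.apply_symm_apply]
  eq_Y s := by rw [← κ.symm_apply_apply (GY.ell _), ← hc.eq_Y, h.apply_symm_apply]

theorem h_pos {s : ℝ} : 0 < h s ↔ 0 < s := by
  rw [← hc.h_zero, h.lt_iff_lt, hc.h_zero]

theorem h_neg {s : ℝ} : h s < 0 ↔ s < 0 := by
  rw [← hc.h_zero, h.lt_iff_lt, hc.h_zero]

theorem glue_zero (s : ℝ) : glue GX GY HX HY h κ s 0 = 0 := by
  rw [glue, if_pos (by simp), transfer_zero_of_ell (hc.eq_X s)]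

theorem glue_pos {s u : ℝ} : 0 < glue GX GY HX HY h κ s u ↔ 0 < u := by
  unfold glue
  split_ifs
  · have := (transfer_strictMono GX HX h κ s).lt_iff_lt (a := 0) (b := u)
    rwa [transfer_zero_of_ell (hc.eq_X s)] at this
  · have := (transfer_strictMono GY HY h κ s).lt_iff_lt (a := 0) (b := u)
    rwa [transfer_zero_of_ell (hc.eq_Y s)] at this

theorem glue_neg {s u : ℝ} : glue GX GY HX HY h κ s u < 0 ↔ u < 0 := by
  unfold glue
  split_ifs
  · have := (transfer_strictMono GX HX h κ s).lt_iff_lt (a := u) (b := 0)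
    rwa [transfer_zero_of_ell (hc.eq_X s)] at this
  · have := (transfer_strictMono GY HY h κ s).lt_iff_lt (a := u) (b := 0)
    rwa [transfer_zero_of_ell (hc.eq_Y s)] at this

theorem glue_eq_zero {s u : ℝ} : glue GX GY HX HY h κ s u = 0 ↔ u = 0 := by
  constructor
  · intro he
    rcases lt_trichotomy u 0 with h' | h' | h'
    · exact absurd he (hc.glue_neg.mpr h').ne
    · exact h'
    · exact absurd he (hc.glue_pos.mpr h').ne'
  · rintro rfl
    exact hc.glue_zero s

theorem mul_glue_nonneg {s u : ℝ} : 0 ≤ h s * glue GX GY HX HY h κ s u ↔ 0 ≤ s * u := by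
  rw [← not_lt, ← not_lt, mul_neg_iff, mul_neg_iff, hc.h_pos, hc.h_neg, hc.glue_pos, hc.glue_neg]

/-- The two formulas agree on `Σ`: over `s = 0` both are `κ u`, and for `u = 0` both vanish. -/
theorem continuous_glue : Continuous fun p : ℝ × ℝ => glue GX GY HX HY h κ p.1 p.2 := by
  refine Continuous.if_le (continuous_transfer GX HX h κ) (continuous_transfer GY HY h κ)
    continuous_const (by fun_prop) fun p hp => ?_
  rcases mul_eq_zero.mp hp.symm with h' | h'
  · simp [transfer, h', hc.h_zero]
  · rw [h', transfer_zero_of_ell (hc.eq_X _), transfer_zero_of_ell (hc.eq_Y _)]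

theorem label_glue (s u : ℝ) :
    label HX HY (h s) (glue GX GY HX HY h κ s u) = κ (label GX GY s u) := by
  by_cases h0 : 0 ≤ s * u
  · rw [label, if_pos (hc.mul_glue_nonneg.mpr h0), glue, if_pos h0, flow_transfer, label,
      if_pos h0]
  · rw [label, if_neg (fun h' => h0 (hc.mul_glue_nonneg.mp h')), glue, if_neg h0, flow_transfer,
      label, if_neg h0]

theorem glue_symm_glue (s u : ℝ) :
    glue HX HY GX GY h.symm κ.symm (h s) (glue GX GY HX HY h κ s u) = u := by
  by_cases h0 : 0 ≤ s * u
  · rw [glue, if_pos (hc.mul_glue_nonneg.mpr h0), glue, if_pos h0, transfer_symm_transfer]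
  · rw [glue, if_neg (fun h' => h0 (hc.mul_glue_nonneg.mp h')), glue, if_neg h0,
      transfer_symm_transfer]

theorem conjMap_symm_conjMap (i : Fin 2) (p : Plane) :
    conjMap i HX HY GX GY h.symm κ.symm (conjMap i GX GY HX HY h κ p) = p := by
  rw [conjMap, conjMap, pt_self, pt_other, hc.glue_symm_glue, h.symm_apply_apply, pt_eta]

theorem continuous_conjMap (i : Fin 2) : Continuous (conjMap i GX GY HX HY h κ) := by
  have h1 : Continuous fun p : Plane => (p i, p (1 - i)) := by fun_prop
  have h2 : Continuous fun p : Plane => h (p i) := h.continuous.comp (continuous_apply i)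
  exact (continuous_pt i).comp (h2.prodMk (hc.continuous_glue.comp h1))

theorem conjMap_zero (i : Fin 2) : conjMap i GX GY HX HY h κ 0 = 0 := by
  simp [conjMap, hc.h_zero, hc.glue_zero]

theorem conjMap_pos (i : Fin 2) (p : Plane) (k : Fin 2) :
    0 < conjMap i GX GY HX HY h κ p k ↔ 0 < p k := by
  rcases eq_or_eq_one_sub i k with rfl | rfl
  · simp [conjMap, hc.h_pos]
  · simp [conjMap, hc.glue_pos]

theorem conjMap_neg (i : Fin 2) (p : Plane) (k : Fin 2) :
    conjMap i GX GY HX HY h κ p k < 0 ↔ p k < 0 := by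
  rcases eq_or_eq_one_sub i k with rfl | rfl
  · simp [conjMap, hc.h_neg]
  · simp [conjMap, hc.glue_neg]

theorem conjMap_eq_zero (i : Fin 2) (p : Plane) (k : Fin 2) :
    conjMap i GX GY HX HY h κ p k = 0 ↔ p k = 0 := by
  have h1 := hc.conjMap_pos i p k
  have h2 := hc.conjMap_neg i p k
  rw [le_antisymm_iff, le_antisymm_iff, ← not_lt, ← not_lt, h1, h2, not_lt, not_lt]

/-- The homeomorphism of the plane defined by a conjugacy. -/
def homeomorph (i : Fin 2) : Plane ≃ₜ Plane where
  toFun := conjMap i GX GY HX HY h κ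
  invFun := conjMap i HX HY GX GY h.symm κ.symm
  left_inv := hc.conjMap_symm_conjMap i
  right_inv := hc.symm.conjMap_symm_conjMap i
  continuous_toFun := hc.continuous_conjMap i
  continuous_invFun := hc.symm.continuous_conjMap i

end Conj

/-! ### Conjugacies map trajectories to trajectories -/

variable {U : OriginNhd} {r : ℕ}

theorem image_uIcc_orderIso (h : ℝ ≃o ℝ) (a b : ℝ) : h '' uIcc a b = uIcc (h a) (h b) := by
  rw [uIcc, uIcc, h.image_Icc, h.map_inf, h.map_sup]

/-- Although labels jump along the axis, both branches of the definition tend to `0` at the origin;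
so small neighbourhoods have small labels. -/
theorem tendsto_label_zero (GX GY : Slope) :
    Tendsto (fun p : ℝ × ℝ => label GX GY p.1 p.2) (𝓝 (0, 0)) (𝓝 0) := by
  have hG : ∀ G : Slope, Tendsto (fun p : ℝ × ℝ => G.flow p.1 p.2 0) (𝓝 (0, 0)) (𝓝 0) := fun G => by
    have : Continuous fun p : ℝ × ℝ => G.flow p.1 p.2 0 :=
      G.continuous_flow.comp (by fun_prop : Continuous fun p : ℝ × ℝ => (p.1, p.2, (0 : ℝ)))
    simpa using this.tendsto (0, 0)
  exact (hG GX).if' (hG GY)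

/-- A trajectory is an arc of the axis or of a leaf. Its image is an arc of the axis or of the leaf
with label `κ y`, which is run again with the speeds of `Z'`. The bound on `κ` of the labels keeps
the target leaf inside the ball where the model of `Z'` is valid. -/
theorem LocalModel.mapsTrajectories {Z Z' : Omega U r} {i : Fin 2} {σ δ δ' : ℝ}
    {GX GY HX HY : Slope} {SX SY SX' SY' : Plane → ℝ} (hM : LocalModel Z i σ δ GX GY SX SY)
    (hM' : LocalModel Z' i σ δ' HX HY SX' SY') {h κ : ℝ ≃o ℝ} (hc : Conj GX GY HX HY h κ)
    {W : Set Plane} (hW : W ⊆ Metric.ball 0 δ)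
    (hW' : ∀ p ∈ W, conjMap i GX GY HX HY h κ p ∈ Metric.ball (0 : Plane) δ')
    (hl : ∀ p ∈ W, |κ (label GX GY (p i) (p (1 - i)))| < δ') :
    MapsTrajectories (conjMap i GX GY HX HY h κ) Z W Z' (conjMap i GX GY HX HY h κ '' W) := by
  intro T γ hT hγ
  set φ := conjMap i GX GY HX HY h κ with hφ
  have hb : ∀ t ∈ Icc 0 T, γ t ∈ Metric.ball (0 : Plane) δ := fun t ht => hW (hγ.2 t ht).1
  have h0 : (0 : ℝ) ∈ Icc 0 T := ⟨le_rfl, hT⟩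
  have h1 : T ∈ Icc 0 T := ⟨hT, le_rfl⟩
  have hab : σ * h (γ 0 i) ≤ σ * h (γ T i) := by
    have := hM.arc_mono hγ hb hT
    rcases hM.hσ with e | e <;> rw [e] at this ⊢
    · simpa using this
    · simpa using this
  have hbd : ∀ t ∈ Icc 0 T, |h (γ t i)| < δ' := fun t ht => by
    have := ((mem_ball_zero_iff_coord i hM'.hδ).mp (hW' _ (hγ.2 t ht).1)).1
    simpa [hφ, conjMap] using this
  have hcoord := hM.image_coord hγ hb hT
  have hu : ∀ s ∈ uIcc (h (γ 0 i)) (h (γ T i)), ∃ t ∈ Icc 0 T, h (γ t i) = s := fun s hs => by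
    rw [← image_uIcc_orderIso, ← hcoord] at hs
    obtain ⟨_, ⟨t, ht, rfl⟩, rfl⟩ := hs
    exact ⟨t, ht, rfl⟩
  rcases hM.slides_or_avoids hγ hb with hs | hs
  · have hφγ : ∀ t ∈ Icc 0 T, pt i (h (γ t i)) 0 = φ (γ t) := fun t ht => by
      rw [hφ, conjMap, hs t ht, hc.glue_zero]
    obtain ⟨T', hT', γ', hγ', e0, e1, him⟩ := hM'.exists_trajectory_slide (W := φ '' W)
      (hbd 0 h0) (hbd T h1) hab fun s hs => by
        obtain ⟨t, ht, rfl⟩ := hu s hs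
        exact ⟨γ t, (hγ.2 t ht).1, (hφγ t ht).symm⟩
    refine ⟨T', γ', hT', hγ', by rw [e0, hφγ 0 h0], by rw [e1, hφγ T h1], ?_⟩
    rw [him, ← image_uIcc_orderIso, ← hcoord, image_image, image_image, image_image]
    exact image_congr hφγ
  · set y := label GX GY (γ 0 i) (γ 0 (1 - i)) with hy
    have hleaf : ∀ t ∈ Icc 0 T, leaf HX HY (κ y) (h (γ t i)) = φ (γ t) (1 - i) := fun t ht => by
      rw [hφ, conjMap, pt_other, hy, ← hM.label_const hγ hb hs ht, ← hc.label_glue,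
        leaf_label hM'.hX hM'.hY (fun h' => hs t ht (hc.glue_eq_zero.mp h'))]
    have hφγ : ∀ t ∈ Icc 0 T, pt i (h (γ t i)) (leaf HX HY (κ y) (h (γ t i))) = φ (γ t) :=
      fun t ht => by rw [hleaf t ht, hφ, conjMap, pt_other]
    have hpos : ∀ t ∈ Icc 0 T, 0 < leaf HX HY (κ y) (h (γ t i)) * κ y := fun t ht => by
      have h2 : label HX HY (h (γ t i)) (φ (γ t) (1 - i)) = κ y := by
        rw [hφ, conjMap, pt_other, hc.label_glue, hM.label_const hγ hb hs ht]
      rw [hleaf t ht, mul_comm]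
      nth_rewrite 1 [← h2]
      refine label_mul_pos hM'.hX hM'.hY fun h' => hs t ht ?_
      exact (hc.conjMap_eq_zero i (γ t) (1 - i)).mp h'
    have hy0 : κ y ≠ 0 := fun h' => by simpa [h'] using hpos 0 h0
    obtain ⟨T', hT', γ', hγ', e0, e1, him⟩ := hM'.exists_trajectory_leaf (W := φ '' W) hy0
      (hl _ (hγ.2 0 h0).1) (hbd 0 h0) (hbd T h1) hab (hpos 0 h0) (hpos T h1) fun s hs => by
        obtain ⟨t, ht, rfl⟩ := hu s hs
        exact ⟨γ t, (hγ.2 t ht).1, (hφγ t ht).symm⟩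
    refine ⟨T', γ', hT', hγ', by rw [e0, hφγ 0 h0], by rw [e1, hφγ T h1], ?_⟩
    rw [him, ← image_uIcc_orderIso, ← hcoord, image_image, image_image, image_image]
    exact image_congr hφγ

theorem LocalModel.locallyEquivalent {Z Z' : Omega U r} {i : Fin 2} {σ δ δ' : ℝ}
    {GX GY HX HY : Slope} {SX SY SX' SY' : Plane → ℝ} (hM : LocalModel Z i σ δ GX GY SX SY)
    (hM' : LocalModel Z' i σ δ' HX HY SX' SY') {h κ : ℝ ≃o ℝ} (hc : Conj GX GY HX HY h κ) :
    LocallyEquivalent Z Z' := by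
  have hlab : Tendsto (fun p : Plane => label GX GY (p i) (p (1 - i))) (𝓝 0) (𝓝 0) :=
    (tendsto_label_zero GX GY).comp
      (((continuous_apply i).prodMk (continuous_apply (1 - i))).tendsto (0 : Plane))
  have e1 : ∀ᶠ p in 𝓝 (0 : Plane), |label GX GY (p i) (p (1 - i))| < δ := by
    exact hlab.abs.eventually_lt_const (by simpa using hM.hδ)
  have e2 : ∀ᶠ p in 𝓝 (0 : Plane), |κ (label GX GY (p i) (p (1 - i)))| < δ' := by
    have h1 : Tendsto (fun x => |κ x|) (𝓝 0) (𝓝 |κ 0|) := (κ.continuous.abs).tendsto 0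
    exact (h1.comp hlab).eventually_lt_const (by simpa [hc.κ_zero] using hM'.hδ)
  have e3 : ∀ᶠ p in 𝓝 (0 : Plane), conjMap i GX GY HX HY h κ p ∈ Metric.ball (0 : Plane) δ' := by
    refine ((hc.continuous_conjMap i).tendsto 0).eventually (Metric.isOpen_ball.mem_nhds ?_)
    rw [hc.conjMap_zero]
    exact hM'.zero_mem_ball
  have e4 : ∀ᶠ p in 𝓝 (0 : Plane), p ∈ Metric.ball (0 : Plane) δ :=
    Metric.isOpen_ball.mem_nhds hM.zero_mem_ball
  obtain ⟨ρ, hρ, hball⟩ := Metric.nhds_basis_ball.eventually_iff.mp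
    (e1.and (e2.and (e3.and e4)))
  set W := Metric.ball (0 : Plane) ρ with hW
  set φ := hc.homeomorph i with hφ
  have hφW : φ.symm '' (φ '' W) = W := by
    rw [image_image]; simp
  refine ⟨φ.toOpenPartialHomeomorphOfImageEq W Metric.isOpen_ball (φ '' W) rfl,
    fun p hp => hM.ball_subset (hball hp).2.2.2, ?_, ?_, Metric.mem_ball_self hρ,
    hc.conjMap_zero i, ?_, fun p hp => ?_, ?_, ?_⟩
  · rintro _ ⟨p, hp, rfl⟩
    exact hM'.ball_subset (hball hp).2.2.1
  · exact (convex_ball _ _).isConnected ⟨0, Metric.mem_ball_self hρ⟩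
  · exact orientationPreservingAtZero_of_sign (hc.continuous_conjMap i) (hc.conjMap_zero i)
      (fun p k => (hc.conjMap_pos i p k).mpr) (fun p k => (hc.conjMap_neg i p k).mpr)
  · have h1 : p ∈ U.carrier := hM.ball_subset (hball hp).2.2.2
    have h2 : conjMap i GX GY HX HY h κ p ∈ U.carrier := hM'.ball_subset (hball hp).2.2.1
    constructor
    · rintro ⟨-, h⟩
      refine ⟨h2, ?_⟩
      rcases mul_eq_zero.mp h with h | h
      · exact mul_eq_zero_of_left ((hc.conjMap_eq_zero i p 0).mpr h) _
      · exact mul_eq_zero_of_right _ ((hc.conjMap_eq_zero i p 1).mpr h)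
    · rintro ⟨-, h⟩
      refine ⟨h1, ?_⟩
      rcases mul_eq_zero.mp h with h | h
      · exact mul_eq_zero_of_left ((hc.conjMap_eq_zero i p 0).mp h) _
      · exact mul_eq_zero_of_right _ ((hc.conjMap_eq_zero i p 1).mp h)
  · exact hM.mapsTrajectories hM' hc (fun p hp => (hball hp).2.2.2)
      (fun p hp => (hball hp).2.2.1) fun p hp => (hball hp).2.1
  · have := hM'.mapsTrajectories hM hc.symm (W := φ '' W) (fun q hq => ?_) (fun q hq => ?_)
      fun q hq => ?_
    · change MapsTrajectories φ.symm Z' (φ '' W) Z W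
      have e : conjMap i HX HY GX GY h.symm κ.symm '' (φ '' W) = W := hφW
      rw [e] at this
      exact this
    · obtain ⟨p, hp, rfl⟩ := hq
      exact (hball hp).2.2.1
    · obtain ⟨p, hp, rfl⟩ := hq
      have e : conjMap i HX HY GX GY h.symm κ.symm (φ p) = p := hc.conjMap_symm_conjMap i p
      rw [e]
      exact (hball hp).2.2.2
    · obtain ⟨p, hp, rfl⟩ := hq
      have e : label HX HY (φ p i) (φ p (1 - i)) = κ (label GX GY (p i) (p (1 - i))) := by
        change label HX HY (conjMap i GX GY HX HY h κ p i)
          (conjMap i GX GY HX HY h κ p (1 - i)) = _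
        rw [conjMap, pt_self, pt_other, hc.label_glue]
      rw [e, κ.symm_apply_apply]
      exact (hball hp).1

end

section

variable {U : OriginNhd} {r : ℕ}

/-! ### Jets at the origin and constant fields -/

theorem CrField.continuous_jet_zero {k : ℕ} (hk : k ≤ r) :
    Continuous fun V : CrField U r => iteratedFDeriv ℝ k V 0 := by
  have h1 : Continuous (CrField.jetMap U r) := continuous_induced_dom
  have h2 : Continuous fun V : CrField U r => V.jet ⟨k, Nat.lt_succ_of_le hk⟩ :=
    (continuous_apply _).comp h1
  exact (continuous_eval_const (F := BoundedContinuousFunction U.carrier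
    (ContinuousMultilinearMap ℝ (fun _ : Fin k => Plane) Plane))
    (⟨0, U.zero_mem'⟩ : U.carrier)).comp h2

/-- The value at the origin of a component, as a continuous linear form. -/
def evalZero (U : OriginNhd) (r : ℕ) (k : Fin 2) : CrField U r →L[ℝ] ℝ where
  toFun V := V 0 k
  map_add' _ _ := rfl
  map_smul' _ _ := rfl
  cont := by
    have h1 := CrField.continuous_jet_zero (U := U) (r := r) (Nat.zero_le r)
    have h2 : Continuous fun V : CrField U r =>
        (iteratedFDeriv ℝ 0 V 0) (fun _ => (0 : Plane)) :=
      (ContinuousMultilinearMap.apply ℝ (fun _ : Fin 0 => Plane) Plane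
        (fun _ => 0)).continuous.comp h1
    simp only [iteratedFDeriv_zero_apply] at h2
    exact (continuous_apply k).comp h2

theorem continuous_eval_zero (k : Fin 2) : Continuous fun V : CrField U r => V 0 k :=
  (evalZero U r k).continuous

open Classical in
/-- The constant vector field `v`. -/
def constField (U : OriginNhd) (r : ℕ) (v : Plane) : CrField U r :=
  ⟨U.carrier.indicator fun _ => v, by
    have heq : ∀ p ∈ U.carrier, (U.carrier.indicator fun _ => v) =ᶠ[𝓝 p] fun _ => v :=
      fun p hp => by
        filter_upwards [U.isOpen'.mem_nhds hp] with q hq using indicator_of_mem hq _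
    refine ⟨contDiffOn_const.congr fun p hp => indicator_of_mem hp _, fun k _ => ?_,
      fun p hp => indicator_of_notMem hp _⟩
    refine ⟨iteratedFDeriv ℝ k fun _ => v,
      ((contDiff_const (n := k)).continuous_iteratedFDeriv le_rfl).continuousOn,
      fun p hp => ?_⟩
    exact ((heq p hp).iteratedFDeriv ℝ k).eq_of_nhds.symm⟩

theorem constField_zero (v : Plane) : constField U r v 0 = v :=
  indicator_of_mem (f := fun _ => v) U.zero_mem'

theorem eval_add (V W : CrField U r) (p : Plane) : (V + W) p = V p + W p := rfl

theorem eval_smul (c : ℝ) (V : CrField U r) (p : Plane) : (c • V) p = c • V p := rfl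

/-! ### Stability away from the resonance -/

theorem tendsto_spread : Tendsto spread (𝓝[>] 0) (𝓝 1) := by
  have : ContinuousAt spread 0 := by
    unfold spread
    refine ContinuousAt.div (by fun_prop) (by fun_prop) (by simp)
  have h := this.tendsto
  rw [show spread 0 = 1 by simp [spread]] at h
  exact h.mono_left nhdsWithin_le_nhds

theorem eventually_mul_spread_lt {a b : ℝ} (h : a < b) : ∀ᶠ η in 𝓝[>] 0, a * spread η < b :=
  (tendsto_spread.const_mul a).eventually_lt_const (by simpa using h)

/-- The alternatives say that both return maps contract, or both expand, at the origin. Since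
`spread η` tends to `1`, a cut-off with small `η` turns these strict inequalities into global ones,
and the return maps of the cut-off slopes are conjugate. -/
theorem SignConfig.locallyEquivalent {Z Z' : Omega U r} (hr : 2 ≤ r) {i : Fin 2} {σ : ℝ}
    (hZ : SignConfig Z i σ) (hZ' : SignConfig Z' i σ)
    (hside : (Z.2 0 (1 - i) / Z.2 0 i < -(Z.1 0 (1 - i) / Z.1 0 i) ∧
        Z'.2 0 (1 - i) / Z'.2 0 i < -(Z'.1 0 (1 - i) / Z'.1 0 i)) ∨
      (-(Z.1 0 (1 - i) / Z.1 0 i) < Z.2 0 (1 - i) / Z.2 0 i ∧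
        -(Z'.1 0 (1 - i) / Z'.1 0 i) < Z'.2 0 (1 - i) / Z'.2 0 i)) :
    LocallyEquivalent Z Z' := by
  obtain ⟨η, hη, hη1, hs⟩ : ∃ η : ℝ, 0 < η ∧ η < 1 ∧
      ((Z.2 0 (1 - i) / Z.2 0 i * spread η < -(Z.1 0 (1 - i) / Z.1 0 i) ∧
        Z'.2 0 (1 - i) / Z'.2 0 i * spread η < -(Z'.1 0 (1 - i) / Z'.1 0 i)) ∨
      (-(Z.1 0 (1 - i) / Z.1 0 i) * spread η < Z.2 0 (1 - i) / Z.2 0 i ∧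
        -(Z'.1 0 (1 - i) / Z'.1 0 i) * spread η < Z'.2 0 (1 - i) / Z'.2 0 i)) := by
    have h1 : ∀ᶠ η in 𝓝[>] (0 : ℝ), η ∈ Ioo (0 : ℝ) 1 := Ioo_mem_nhdsGT one_pos
    rcases hside with ⟨ha, hb⟩ | ⟨ha, hb⟩
    · obtain ⟨η, h, h2, h3⟩ := (h1.and ((eventually_mul_spread_lt ha).and
        (eventually_mul_spread_lt hb))).exists
      exact ⟨η, h.1, h.2, Or.inl ⟨h2, h3⟩⟩
    · obtain ⟨η, h, h2, h3⟩ := (h1.and ((eventually_mul_spread_lt ha).and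
        (eventually_mul_spread_lt hb))).exists
      exact ⟨η, h.1, h.2, Or.inr ⟨h2, h3⟩⟩
  obtain ⟨δ, GX, GY, SX, SY, hM, hGX, hGY⟩ := hZ.exists_model hr hη hη1
  obtain ⟨δ', HX, HY, SX', SY', hM', hHX, hHY⟩ := hZ'.exists_model hr hη hη1
  obtain ⟨h, κ, h0, k0, hX, hY⟩ := exists_conj hGX hGY hHX hHY hη1 hZ.slope_X hZ.slope_Y
    hZ'.slope_X hZ'.slope_Y hs
  exact hM.locallyEquivalent hM' ⟨h0, k0, hX, hY⟩

theorem isOpen_signConfig (i : Fin 2) (σ : ℝ) : IsOpen {Z : Omega U r | SignConfig Z i σ} := by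
  by_cases hσ : σ = 1 ∨ σ = -1
  · have e1 : ∀ k, Continuous fun Z : Omega U r => σ * Z.1 0 k := fun k =>
      ((continuous_eval_zero k).comp continuous_fst).const_smul σ
    have e2 : ∀ k, Continuous fun Z : Omega U r => σ * Z.2 0 k := fun k =>
      ((continuous_eval_zero k).comp continuous_snd).const_smul σ
    have : {Z : Omega U r | SignConfig Z i σ} = ({Z | 0 < σ * Z.1 0 i} ∩ {Z | 0 < σ * Z.2 0 i}) ∩
        ({Z | σ * Z.1 0 (1 - i) < 0} ∩ {Z | 0 < σ * Z.2 0 (1 - i)}) := by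
      ext Z
      exact ⟨fun h => ⟨⟨h.X_pos, h.Y_pos⟩, h.X_neg, h.Y_pos'⟩,
        fun h => ⟨hσ, h.1.1, h.1.2, h.2.1, h.2.2⟩⟩
    rw [this]
    exact ((isOpen_lt continuous_const (e1 i)).inter (isOpen_lt continuous_const (e2 i))).inter
      ((isOpen_lt (e1 _) continuous_const).inter (isOpen_lt continuous_const (e2 _)))
  · convert isOpen_empty
    exact eq_empty_of_forall_notMem fun Z hZ => hσ hZ.hσ

theorem SignConfig.ne_zero {Z : Omega U r} {i : Fin 2} {σ : ℝ} (h : SignConfig Z i σ) (k : Fin 2) :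
    Z.1 0 k ≠ 0 ∧ Z.2 0 k ≠ 0 := by
  have h1 := h.X_pos
  have h2 := h.Y_pos
  have h3 := h.X_neg
  have h4 := h.Y_pos'
  rcases eq_or_eq_one_sub i k with rfl | rfl
  · exact ⟨fun h => by simp [h] at h1, fun h => by simp [h] at h2⟩
  · exact ⟨fun h => by simp [h] at h3, fun h => by simp [h] at h4⟩

/-- The sum of the slopes of `X` and `Y`, relative to the crossing branch `i`, at the origin. -/
def slopeSum (i : Fin 2) (Z : Omega U r) : ℝ := Z.2 0 (1 - i) / Z.2 0 i + Z.1 0 (1 - i) / Z.1 0 i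

theorem continuousAt_slopeSum {Z : Omega U r} {i : Fin 2} {σ : ℝ} (h : SignConfig Z i σ) :
    ContinuousAt (slopeSum i) Z := by
  have e1 : ∀ k, ContinuousAt (fun Z : Omega U r => Z.1 0 k) Z := fun k =>
    ((continuous_eval_zero k).comp continuous_fst).continuousAt
  have e2 : ∀ k, ContinuousAt (fun Z : Omega U r => Z.2 0 k) Z := fun k =>
    ((continuous_eval_zero k).comp continuous_snd).continuousAt
  exact ((e2 _).div (e2 _) (h.ne_zero i).2).add ((e1 _).div (e1 _) (h.ne_zero i).1)

theorem SignConfig.mem_Omega0 {Z : Omega U r} (hr : 2 ≤ r) {i : Fin 2} {σ : ℝ}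
    (hZ : SignConfig Z i σ) (h0 : slopeSum i Z ≠ 0) : Z ∈ Omega0 U r := by
  have hcont := continuousAt_slopeSum hZ
  have hev : ∀ᶠ Z' in 𝓝 Z, SignConfig Z' i σ := (isOpen_signConfig i σ).mem_nhds hZ
  have hloc : ∀ᶠ Z' in 𝓝 Z, LocallyEquivalent Z' Z := by
    rcases h0.lt_or_gt with h | h
    · filter_upwards [hev, hcont.eventually_lt_const h] with Z' hZ' hs
      refine hZ'.locallyEquivalent hr hZ (Or.inl ?_)
      unfold slopeSum at h hs
      constructor <;> linarith
    · filter_upwards [hev, hcont.eventually_const_lt h] with Z' hZ' hs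
      refine hZ'.locallyEquivalent hr hZ (Or.inr ?_)
      unfold slopeSum at h hs
      constructor <;> linarith
  obtain ⟨V, hV, hVo, hZV⟩ := eventually_nhds_iff.mp hloc
  exact ⟨V, hVo, hZV, hV⟩

end

section

variable {U : OriginNhd} {r : ℕ}

/-! ### Images of the sliding branch and of leaves under an equivalence -/

theorem abs_lt_of_mem_uIcc {a b s ρ : ℝ} (ha : |a| < ρ) (hb : |b| < ρ) (hs : s ∈ uIcc a b) :
    |s| < ρ := by
  rcases mem_uIcc.mp hs with h | h
  · exact abs_lt.mpr ⟨(abs_lt.mp ha).1.trans_le h.1, h.2.trans_lt (abs_lt.mp hb).2⟩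
  · exact abs_lt.mpr ⟨(abs_lt.mp hb).1.trans_le h.1, h.2.trans_lt (abs_lt.mp ha).2⟩

section Images

variable {Z Z' : Omega U r} {i : Fin 2} {σ δ δ' : ℝ}
    {GX GY HX HY : Slope} {SX SY SX' SY' : Plane → ℝ}
    {h : Plane → Plane} {S T : Set Plane} {ρ : ℝ}

/-- The image of an arc of the axis is a trajectory, hence lies in the axis or avoids it. The
condition `hz` supplies a point of the image on the axis, and the direction of time gives the
inequality. -/
theorem LocalModel.image_slide (hM : LocalModel Z i σ δ GX GY SX SY)
    (hM' : LocalModel Z' i σ δ' HX HY SX' SY') (hmap : MapsTrajectories h Z S Z' T)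
    (hρδ : ρ ≤ δ) (hS : Metric.ball 0 ρ ⊆ S)
    (himg : ∀ p ∈ Metric.ball (0 : Plane) ρ, h p ∈ Metric.ball (0 : Plane) δ') (h0 : h 0 = 0)
    {a b : ℝ} (ha : |a| < ρ) (hb : |b| < ρ) (hab : σ * a ≤ σ * b) (hz : (0 : ℝ) ∈ uIcc a b ∨
      h (pt i a 0) (1 - i) = 0) :
    (∀ s ∈ uIcc a b, h (pt i s 0) (1 - i) = 0) ∧ σ * h (pt i a 0) i ≤ σ * h (pt i b 0) i := by
  have hρ : 0 < ρ := (abs_nonneg a).trans_lt ha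
  have hin : ∀ s ∈ uIcc a b, pt i s 0 ∈ Metric.ball (0 : Plane) ρ := fun s hs =>
    pt_mem_ball i (abs_lt_of_mem_uIcc ha hb hs) (by simpa using hρ)
  obtain ⟨t, ht, γ, hγ, e0, e1, him⟩ := hM.exists_trajectory_slide (W := S) (ha.trans_le hρδ)
    (hb.trans_le hρδ) hab fun s hs => hS (hin s hs)
  obtain ⟨t', γ', ht', hγ', e0', e1', him'⟩ := hmap t γ ht hγ
  rw [him, image_image] at him'
  have hball : ∀ u ∈ Icc 0 t', γ' u ∈ Metric.ball (0 : Plane) δ' := fun u hu => by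
    have : γ' u ∈ (fun s => h (pt i s 0)) '' uIcc a b := him' ▸ mem_image_of_mem γ' hu
    obtain ⟨s, hs, hs'⟩ := this
    rw [← hs']
    exact himg _ (hin s hs)
  have hall : ∀ u ∈ Icc 0 t', γ' u (1 - i) = 0 := by
    refine (hM'.slides_or_avoids hγ' hball).resolve_right fun hne => ?_
    rcases hz with hz | hz
    · have : h (pt i 0 0) ∈ γ' '' Icc 0 t' := him' ▸ mem_image_of_mem (fun s => h (pt i s 0)) hz
      obtain ⟨u, hu, hu'⟩ := this
      refine hne u hu ?_
      rw [hu', pt_zero, h0]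
      rfl
    · exact hne 0 ⟨le_rfl, ht'⟩ (by rw [e0', e0, hz])
  constructor
  · intro s hs
    have : h (pt i s 0) ∈ γ' '' Icc 0 t' := him' ▸ mem_image_of_mem (fun s => h (pt i s 0)) hs
    obtain ⟨u, hu, hu'⟩ := this
    rw [← hu']
    exact hall u hu
  · have := hM'.arc_mono hγ' hball ht'
    rwa [e0', e1', e0, e1] at this

theorem LocalModel.image_axis (hM : LocalModel Z i σ δ GX GY SX SY)
    (hM' : LocalModel Z' i σ δ' HX HY SX' SY') (hmap : MapsTrajectories h Z S Z' T)
    (hρδ : ρ ≤ δ) (hS : Metric.ball 0 ρ ⊆ S)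
    (himg : ∀ p ∈ Metric.ball (0 : Plane) ρ, h p ∈ Metric.ball (0 : Plane) δ') (h0 : h 0 = 0)
    {s : ℝ} (hs : |s| < ρ) : h (pt i s 0) (1 - i) = 0 := by
  have hρ : |(0 : ℝ)| < ρ := by simpa using (abs_nonneg s).trans_lt hs
  rcases le_total (σ * s) (σ * 0) with hle | hle
  · exact (hM.image_slide hM' hmap hρδ hS himg h0 hs hρ hle (Or.inl right_mem_uIcc)).1 s
      left_mem_uIcc
  · exact (hM.image_slide hM' hmap hρδ hS himg h0 hρ hs hle (Or.inl left_mem_uIcc)).1 s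
      right_mem_uIcc

theorem LocalModel.strictMonoOn_axis (hM : LocalModel Z i σ δ GX GY SX SY)
    (hM' : LocalModel Z' i σ δ' HX HY SX' SY') (hmap : MapsTrajectories h Z S Z' T)
    (hρδ : ρ ≤ δ) (hS : Metric.ball 0 ρ ⊆ S)
    (himg : ∀ p ∈ Metric.ball (0 : Plane) ρ, h p ∈ Metric.ball (0 : Plane) δ') (h0 : h 0 = 0)
    (hinj : InjOn h S) : StrictMonoOn (fun s => h (pt i s 0) i) (Ioo (-ρ) ρ) := by
  have hz : ∀ s, |s| < ρ → h (pt i s 0) (1 - i) = 0 := fun s hs =>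
    hM.image_axis hM' hmap hρδ hS himg h0 hs
  intro a ha b hb hab
  have ha : |a| < ρ := abs_lt.mpr ha
  have hb : |b| < ρ := abs_lt.mpr hb
  have hρ : |(0 : ℝ)| < ρ := by simpa using (abs_nonneg a).trans_lt ha
  have hle : h (pt i a 0) i ≤ h (pt i b 0) i := by
    rcases hM.hσ with e | e
    · have := (hM.image_slide hM' hmap hρδ hS himg h0 ha hb (by rw [e]; linarith)
        (Or.inr (hz a ha))).2
      rw [e] at this
      linarith
    · have := (hM.image_slide hM' hmap hρδ hS himg h0 hb ha (by rw [e]; linarith)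
        (Or.inr (hz b hb))).2
      rw [e] at this
      linarith
  refine lt_of_le_of_ne hle fun he => hab.ne ?_
  have := hinj (hS (pt_mem_ball i ha hρ)) (hS (pt_mem_ball i hb hρ))
    (plane_ext (i := i) he ((hz a ha).trans (hz b hb).symm))
  simpa using congrFun this i

/-- The assumption on `foot` says that the leaf of label `y` ends at `(s, 0)`. Its arcs go to arcs
of a single leaf, on the same side of the axis, and the label of that leaf is read off by letting
the point tend to the end. A limit `c → 1` along the abscissas `c * s` is needed since the end is
not on the leaf. -/
theorem LocalModel.image_foot (hM : LocalModel Z i σ δ GX GY SX SY)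
    (hM' : LocalModel Z' i σ δ' HX HY SX' SY') (hmap : MapsTrajectories h Z S Z' T)
    (hρδ : ρ ≤ δ) (hS : Metric.ball 0 ρ ⊆ S)
    (himg : ∀ p ∈ Metric.ball (0 : Plane) ρ, h p ∈ Metric.ball (0 : Plane) δ')
    (hc : ContinuousOn h (Metric.ball 0 ρ))
    (hpos : ∀ p ∈ Metric.ball (0 : Plane) ρ, 0 < p (1 - i) → 0 < h p (1 - i))
    (hneg : ∀ p ∈ Metric.ball (0 : Plane) ρ, p (1 - i) < 0 → h p (1 - i) < 0)
    {y s : ℝ} (hy : y ≠ 0) (hyρ : |y| < ρ) (hs : |s| < ρ)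
    (hks : h (pt i s 0) i ≠ 0) (hks' : h (pt i s 0) (1 - i) = 0)
    (hfoot : foot GX GY y s = y) :
    foot HX HY y (h (pt i s 0) i) =
      label HX HY (h (pt i 0 y) i) (h (pt i 0 y) (1 - i)) := by
  have hρ : 0 < ρ := (abs_nonneg y).trans_lt hyρ
  have hls : leaf GX GY y s = 0 := by
    unfold foot at hfoot
    unfold leaf
    split_ifs at hfoot ⊢ with h1 <;>
    · nth_rewrite 1 [← hfoot]
      rw [Slope.ell, Slope.flow_flow, Slope.flow_self]
  have hs0 : s ≠ 0 := by
    rintro rfl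
    rw [leaf_at_zero] at hls
    exact hy hls
  have hyy : 0 < y * y := mul_self_pos.mpr hy
  have hleafpos : ∀ c : ℝ, 0 ≤ c → c < 1 → 0 < leaf GX GY y (c * s) * y := by
    intro c hc0 hc1
    rcases hs0.lt_or_gt with hsn | hsp
    · have := leaf_monotoneOn hM.hX hM.hY hy (a := s) (b := c * s) hsn.le
        (mul_nonpos_of_nonneg_of_nonpos hc0 hsn.le) (by nlinarith)
      simpa [hls] using this
    · have := leaf_antitoneOn hM.hX hM.hY hy (a := c * s) (b := s)
        (mul_nonneg hc0 hsp.le) hsp.le (by nlinarith)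
      simpa [hls] using this
  have hcs : ∀ c : ℝ, 0 ≤ c → c < 1 → |c * s| < ρ := fun c hc0 hc1 => by
    rw [abs_mul, abs_of_nonneg hc0]
    nlinarith [abs_nonneg s]
  have hsame : ∀ p ∈ Metric.ball (0 : Plane) ρ, 0 < p (1 - i) * y → 0 < h p (1 - i) * y := by
    intro p hp hpy
    rcases pos_and_pos_or_neg_and_neg_of_mul_pos hpy with ⟨h1, h2⟩ | ⟨h1, h2⟩
    · exact mul_pos (hpos p hp h1) h2
    · exact mul_pos_of_neg_of_neg (hneg p hp h1) h2
  set P : ℝ → Plane := fun u => pt i u (leaf GX GY y u) with hP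
  have hPj : ∀ u, P u (1 - i) = leaf GX GY y u := fun u => pt_other i _ _
  have hPball : ∀ u, |u| < ρ → 0 < leaf GX GY y u * y → P u ∈ Metric.ball (0 : Plane) ρ :=
    fun u hu hl => pt_mem_ball i hu ((abs_leaf_le hM.hX hM.hY hl).trans_lt hyρ)
  have hlab : ∀ c : ℝ, 0 ≤ c → c < 1 → label HX HY (h (P (c * s)) i) (h (P (c * s)) (1 - i)) =
      label HX HY (h (pt i 0 y) i) (h (pt i 0 y) (1 - i)) := by
    intro c hc0 hc1
    have hP0 : P 0 = pt i 0 y := by simp [hP]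
    have hl0 : 0 < leaf GX GY y 0 * y := by rwa [leaf_at_zero]
    have key : ∀ a b : ℝ, |a| < ρ → |b| < ρ → 0 < leaf GX GY y a * y → 0 < leaf GX GY y b * y →
        σ * a ≤ σ * b → label HX HY (h (P b) i) (h (P b) (1 - i)) =
          label HX HY (h (P a) i) (h (P a) (1 - i)) := by
      intro a b ha hb hla hlb hab
      have hin : ∀ u ∈ uIcc a b, 0 < leaf GX GY y u * y ∧ P u ∈ Metric.ball (0 : Plane) ρ :=
        fun u hu => by
          have := leaf_mul_pos hM.hX hM.hY hy hla hlb hu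
          exact ⟨this, hPball u (abs_lt_of_mem_uIcc ha hb hu) this⟩
      obtain ⟨t, ht, γ, hγ, e0, e1, him⟩ := hM.exists_trajectory_leaf (W := S) hy
        (hyρ.trans_le hρδ) (ha.trans_le hρδ) (hb.trans_le hρδ) hab hla hlb
        fun u hu => hS (hin u hu).2
      obtain ⟨t', γ', ht', hγ', e0', e1', him'⟩ := hmap t γ ht hγ
      rw [him, image_image] at him'
      have hmem : ∀ v ∈ Icc 0 t', ∃ u ∈ uIcc a b, h (P u) = γ' v := fun v hv => by
        have : γ' v ∈ (fun s => h (P s)) '' uIcc a b := him' ▸ mem_image_of_mem γ' hv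
        exact this
      have hball : ∀ v ∈ Icc 0 t', γ' v ∈ Metric.ball (0 : Plane) δ' := fun v hv => by
        obtain ⟨u, hu, hu'⟩ := hmem v hv
        rw [← hu']
        exact himg _ (hin u hu).2
      have hne : ∀ v ∈ Icc 0 t', γ' v (1 - i) ≠ 0 := fun v hv h' => by
        obtain ⟨u, hu, hu'⟩ := hmem v hv
        have := hsame (P u) (hin u hu).2 (by rw [hPj]; exact (hin u hu).1)
        rw [hu', h', zero_mul] at this
        exact lt_irrefl _ this
      have := hM'.label_const hγ' hball hne (t := t') ⟨ht', le_rfl⟩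
      rwa [e0', e1', e0, e1] at this
    rw [← hP0]
    rcases le_total (σ * 0) (σ * (c * s)) with hle | hle
    · exact key 0 (c * s) (by simpa using hρ) (hcs c hc0 hc1) hl0 (hleafpos c hc0 hc1) hle
    · exact (key (c * s) 0 (hcs c hc0 hc1) (by simpa using hρ) (hleafpos c hc0 hc1) hl0 hle).symm
  have hcl : Continuous fun c : ℝ => P (c * s) := by
    have h1 : Continuous fun c : ℝ => c * s := by fun_prop
    exact (continuous_pt i).comp (h1.prodMk ((continuous_leaf hy).comp h1))
  have hP1 : P (1 * s) = pt i s 0 := by rw [one_mul, hP]; simp only [hls]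
  have hsball : pt i s 0 ∈ Metric.ball (0 : Plane) ρ := pt_mem_ball i hs (by simpa using hρ)
  have hlim : Tendsto (fun c : ℝ => h (P (c * s))) (𝓝[Ico 0 1] 1) (𝓝 (h (pt i s 0))) := by
    have h1 : Tendsto (fun c : ℝ => P (c * s)) (𝓝[Ico 0 1] 1) (𝓝 (pt i s 0)) := by
      rw [← hP1]
      exact (hcl.tendsto 1).mono_left nhdsWithin_le_nhds
    exact (hc.continuousAt (Metric.isOpen_ball.mem_nhds hsball)).tendsto.comp h1
  have hlim2 : Tendsto (fun c : ℝ => (h (P (c * s)) i, h (P (c * s)) (1 - i))) (𝓝[Ico 0 1] 1)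
      (𝓝[{p | 0 < p.2 * y}] (h (pt i s 0) i, 0)) := by
    refine tendsto_nhdsWithin_iff.mpr ⟨?_, ?_⟩
    · have := (((continuous_apply i).tendsto _).comp hlim).prodMk_nhds
        (((continuous_apply (1 - i)).tendsto _).comp hlim)
      rwa [hks'] at this
    · filter_upwards [self_mem_nhdsWithin] with c hc'
      refine hsame _ (hPball _ (hcs c hc'.1 hc'.2) (hleafpos c hc'.1 hc'.2)) ?_
      rw [hPj]
      exact hleafpos c hc'.1 hc'.2
  have hlim3 := (tendsto_label_foot (GX := HX) (GY := HY) hy hks).comp hlim2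
  have : (𝓝[Ico (0 : ℝ) 1] 1).NeBot := by
    rw [nhdsWithin_Ico_eq_nhdsLT zero_lt_one]
    infer_instance
  refine tendsto_nhds_unique hlim3 (tendsto_const_nhds.congr' ?_)
  filter_upwards [self_mem_nhdsWithin] with c hc'
  exact (hlab c hc'.1 hc'.2).symm

end Images

end

section

variable {U : OriginNhd} {r : ℕ}

/-! ### The two half planes bounded by the sliding branch -/

/-- Coordinates in which the axis is horizontal. For `i = 1` the order of the coordinates is
reversed; shifting the angle by `π / 2` and taking `τ = -1` restores the orientation. -/
theorem OrientationPreservingAtZero.frame {h : Plane → Plane} (ho : OrientationPreservingAtZero h)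
    (h0 : h 0 = 0) (i : Fin 2) : ∃ τ : ℝ, (τ = 1 ∨ τ = -1) ∧ ∀ᶠ ρ in 𝓝[>] (0 : ℝ),
      ∃ m ψ : ℝ → ℝ, Continuous ψ ∧ (∀ s, 0 < m s) ∧
        (∀ s, h (pt i (ρ * Real.cos s) (τ * (ρ * Real.sin s))) i = m s * Real.cos (ψ s) ∧
          h (pt i (ρ * Real.cos s) (τ * (ρ * Real.sin s))) (1 - i) =
            τ * (m s * Real.sin (ψ s))) ∧
        ∀ s, ψ (s + 2 * Real.pi) = ψ s + 2 * Real.pi := by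
  fin_cases i
  · refine ⟨1, Or.inl rfl, ho.mono fun ρ hρ => ?_⟩
    obtain ⟨m, θ, hθ, hm, he, hp⟩ := hρ
    refine ⟨m, θ, hθ, hm, fun s => ?_, hp⟩
    have e : pt 0 (ρ * Real.cos s) (1 * (ρ * Real.sin s)) = ![ρ * Real.cos s, ρ * Real.sin s] := by
      funext k
      fin_cases k <;> simp [pt]
    have hs := he s
    rw [h0, sub_zero] at hs
    simp only [Fin.zero_eta, e, hs]
    simp
  · refine ⟨-1, Or.inr rfl, ho.mono fun ρ hρ => ?_⟩
    obtain ⟨m, θ, hθ, hm, he, hp⟩ := hρ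
    refine ⟨fun s => m (s + Real.pi / 2), fun s => θ (s + Real.pi / 2) - Real.pi / 2,
      by fun_prop, fun s => hm _, fun s => ?_, fun s => ?_⟩
    · have e : pt 1 (ρ * Real.cos s) (-1 * (ρ * Real.sin s)) =
          ![ρ * Real.cos (s + Real.pi / 2), ρ * Real.sin (s + Real.pi / 2)] := by
        rw [Real.cos_add_pi_div_two, Real.sin_add_pi_div_two]
        funext k
        fin_cases k <;> simp [pt]
      have hs := he (s + Real.pi / 2)
      rw [h0, sub_zero] at hs
      simp only [Fin.mk_one, e, hs, Real.cos_sub_pi_div_two, Real.sin_sub_pi_div_two]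
      simp
    · simp only
      rw [show s + 2 * Real.pi + Real.pi / 2 = s + Real.pi / 2 + 2 * Real.pi by ring, hp]
      ring

/-- The angle `ψ` of the image of a circle starts at a multiple of `2 * π`, increases by `2 * π`
over a turn, and is a multiple of `π` only at points of the axis. So `ψ` gains `π` on the upper half
circle and again on the lower one, and each half contains a point whose image is on its own side. -/
theorem OrientationPreservingAtZero.exists_same_side {h : Plane → Plane}
    (ho : OrientationPreservingAtZero h) (h0 : h 0 = 0) (i : Fin 2) {ρ : ℝ} (hρ : 0 < ρ)
    (haxis : ∀ s, |s| < ρ → h (pt i s 0) (1 - i) = 0)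
    (haxis' : ∀ s, 0 < s → s < ρ → 0 < h (pt i s 0) i)
    (hoff : ∀ p ∈ Metric.ball (0 : Plane) ρ, p (1 - i) ≠ 0 → h p (1 - i) ≠ 0) :
    (∃ p ∈ Metric.ball (0 : Plane) ρ, 0 < p (1 - i) ∧ 0 < h p (1 - i)) ∧
      ∃ p ∈ Metric.ball (0 : Plane) ρ, p (1 - i) < 0 ∧ h p (1 - i) < 0 := by
  obtain ⟨τ, hτ, hev⟩ := ho.frame h0 i
  obtain ⟨ε, ⟨m, ψ, hψ, hm, he, hp⟩, hε⟩ := (hev.and (Ioo_mem_nhdsGT hρ)).exists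
  have hπ := Real.pi_pos
  have hτ0 : τ ≠ 0 := by rcases hτ with rfl | rfl <;> norm_num
  have hττ : |τ| = 1 := by rcases hτ with rfl | rfl <;> simp
  set P : ℝ → Plane := fun s => pt i (ε * Real.cos s) (τ * (ε * Real.sin s)) with hP
  have hPj : ∀ s, P s (1 - i) = τ * (ε * Real.sin s) := fun s => pt_other i _ _
  have habs : ∀ x : ℝ, |x| ≤ 1 → |ε * x| < ρ := fun x hx => by
    rw [abs_mul, abs_of_pos hε.1]
    nlinarith [hε.1, hε.2]
  have hPball : ∀ s, P s ∈ Metric.ball (0 : Plane) ρ := fun s => by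
    refine pt_mem_ball i (habs _ (Real.abs_cos_le_one s)) ?_
    rw [abs_mul, hττ, one_mul]
    exact habs _ (Real.abs_sin_le_one s)
  have hsin : ∀ s, Real.sin (ψ s) = 0 → Real.sin s = 0 := by
    intro s hs
    by_contra hne
    refine hoff (P s) (hPball s) ?_ ?_
    · rw [hPj]
      exact mul_ne_zero hτ0 (mul_ne_zero hε.1.ne' hne)
    · rw [(he s).2, hs, mul_zero, mul_zero]
  have hψ0 : Real.sin (ψ 0) = 0 ∧ 0 < Real.cos (ψ 0) := by
    have e : P 0 = pt i ε 0 := by simp [hP]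
    constructor
    · have h1 := (he 0).2
      change h (P 0) (1 - i) = _ at h1
      rw [e, haxis ε (by rw [abs_of_pos hε.1]; exact hε.2)] at h1
      have := (mul_eq_zero.mp h1.symm).resolve_left hτ0
      exact (mul_eq_zero.mp this).resolve_left (hm 0).ne'
    · have h1 := (he 0).1
      change h (P 0) i = _ at h1
      have h2 := haxis' ε hε.1 hε.2
      rw [← e, h1] at h2
      exact (pos_iff_pos_of_mul_pos h2).mp (hm 0)
  have h2π : ψ (2 * Real.pi) = ψ 0 + 2 * Real.pi := by simpa using hp 0
  -- The value `ψ 0 + π` is taken somewhere inside the turn, at a point of the axis, which can only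
  -- be the opposite point.
  have hψπ : ψ Real.pi = ψ 0 + Real.pi := by
    obtain ⟨s, hs, hs'⟩ := intermediate_value_Icc (a := 0) (b := 2 * Real.pi) (by linarith)
      hψ.continuousOn (show ψ 0 + Real.pi ∈ Icc (ψ 0) (ψ (2 * Real.pi)) by
        rw [h2π]; constructor <;> linarith)
    have h1 : Real.sin s = 0 := hsin s (by rw [hs', Real.sin_add_pi, hψ0.1, neg_zero])
    have h2 : s ≠ 0 := by rintro rfl; linarith
    have h3 : s ≠ 2 * Real.pi := by rintro rfl; linarith
    have h4 : s = Real.pi := by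
      rcases lt_trichotomy s Real.pi with h | h | h
      · exact absurd h1 (Real.sin_pos_of_pos_of_lt_pi (lt_of_le_of_ne hs.1 h2.symm) h).ne'
      · exact h
      · have := Real.sin_pos_of_pos_of_lt_pi (sub_pos.mpr h)
          (by linarith [lt_of_le_of_ne hs.2 h3])
        rw [Real.sin_sub_pi] at this
        linarith
    rw [← hs', h4]
  obtain ⟨s1, hs1, hs1'⟩ := intermediate_value_Icc (a := 0) (b := Real.pi) hπ.le
    hψ.continuousOn (show ψ 0 + Real.pi / 2 ∈ Icc (ψ 0) (ψ Real.pi) by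
      rw [hψπ]; constructor <;> linarith)
  obtain ⟨s2, hs2, hs2'⟩ := intermediate_value_Icc (a := Real.pi) (b := 2 * Real.pi) (by linarith)
    hψ.continuousOn (show ψ Real.pi + Real.pi / 2 ∈ Icc (ψ Real.pi) (ψ (2 * Real.pi)) by
      rw [h2π, hψπ]; constructor <;> linarith)
  have hv1 : 0 < Real.sin (ψ s1) := by rw [hs1', Real.sin_add_pi_div_two]; exact hψ0.2
  have hv2 : Real.sin (ψ s2) < 0 := by
    rw [hs2', hψπ, Real.sin_add_pi_div_two, Real.cos_add_pi]; linarith [hψ0.2]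
  have hw1 : 0 < Real.sin s1 := by
    have h1 : s1 ≠ 0 := by rintro rfl; linarith
    have h2 : s1 ≠ Real.pi := by rintro rfl; linarith
    exact Real.sin_pos_of_pos_of_lt_pi (lt_of_le_of_ne hs1.1 h1.symm) (lt_of_le_of_ne hs1.2 h2)
  have hw2 : Real.sin s2 < 0 := by
    have h1 : s2 ≠ Real.pi := by rintro rfl; linarith
    have h2 : s2 ≠ 2 * Real.pi := by rintro rfl; linarith
    have := Real.sin_pos_of_pos_of_lt_pi (sub_pos.mpr (lt_of_le_of_ne hs2.1 h1.symm))
      (by linarith [lt_of_le_of_ne hs2.2 h2])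
    rw [Real.sin_sub_pi] at this
    linarith
  have q1 := mul_pos hε.1 hw1
  have q2 := mul_neg_of_pos_of_neg hε.1 hw2
  have q3 := mul_pos (hm s1) hv1
  have q4 := mul_neg_of_pos_of_neg (hm s2) hv2
  have e1 := (he s1).2
  have e2 := (he s2).2
  change h (P s1) (1 - i) = _ at e1
  change h (P s2) (1 - i) = _ at e2
  rcases hτ with rfl | rfl
  · exact ⟨⟨P s1, hPball _, by rw [hPj]; linarith, by rw [e1]; linarith⟩,
      P s2, hPball _, by rw [hPj]; linarith, by rw [e2]; linarith⟩
  · exact ⟨⟨P s2, hPball _, by rw [hPj]; linarith, by rw [e2]; linarith⟩,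
      P s1, hPball _, by rw [hPj]; linarith, by rw [e1]; linarith⟩

/-- Half discs are connected and the image coordinate does not vanish on them, so its sign at one
point decides. -/
theorem preserves_half_planes {h : Plane → Plane} {i : Fin 2} {ρ : ℝ}
    (hc : ContinuousOn h (Metric.ball 0 ρ))
    (hoff : ∀ p ∈ Metric.ball (0 : Plane) ρ, p (1 - i) ≠ 0 → h p (1 - i) ≠ 0)
    (hside : (∃ p ∈ Metric.ball (0 : Plane) ρ, 0 < p (1 - i) ∧ 0 < h p (1 - i)) ∧
      ∃ p ∈ Metric.ball (0 : Plane) ρ, p (1 - i) < 0 ∧ h p (1 - i) < 0) :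
    (∀ p ∈ Metric.ball (0 : Plane) ρ, 0 < p (1 - i) → 0 < h p (1 - i)) ∧
      ∀ p ∈ Metric.ball (0 : Plane) ρ, p (1 - i) < 0 → h p (1 - i) < 0 := by
  have hlin : IsLinearMap ℝ fun p : Plane => p (1 - i) := ⟨fun _ _ => rfl, fun _ _ => rfl⟩
  have hcj : ContinuousOn (fun p => h p (1 - i)) (Metric.ball 0 ρ) :=
    (continuous_apply (1 - i)).comp_continuousOn hc
  constructor
  · intro p hp hp0
    obtain ⟨q, hq, hq0, hq1⟩ := hside.1
    by_contra hneg
    have hpc : IsPreconnected (Metric.ball (0 : Plane) ρ ∩ {p | 0 < p (1 - i)}) :=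
      ((convex_ball _ _).inter (convex_halfSpace_gt hlin 0)).isPreconnected
    obtain ⟨w, hw, hw0⟩ := hpc.intermediate_value ⟨hp, hp0⟩ ⟨hq, hq0⟩ (hcj.mono inter_subset_left)
      ⟨not_lt.mp hneg, hq1.le⟩
    have hw1 : 0 < w (1 - i) := hw.2
    exact hoff w hw.1 hw1.ne' hw0
  · intro p hp hp0
    obtain ⟨q, hq, hq0, hq1⟩ := hside.2
    by_contra hneg
    have hpc : IsPreconnected (Metric.ball (0 : Plane) ρ ∩ {p | p (1 - i) < 0}) :=
      ((convex_ball _ _).inter (convex_halfSpace_lt hlin 0)).isPreconnected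
    obtain ⟨w, hw, hw0⟩ := hpc.intermediate_value ⟨hq, hq0⟩ ⟨hp, hp0⟩ (hcj.mono inter_subset_left)
      ⟨hq1.le, not_lt.mp hneg⟩
    have hw1 : w (1 - i) < 0 := hw.2
    exact hoff w hw.1 hw1.ne hw0

/-! ### Return maps on the sliding branch -/

theorem eventually_abs_lt_of_hasDerivAt {f : ℝ → ℝ} {f' c : ℝ} (hf : HasDerivAt f f' 0)
    (h0 : f 0 = 0) :
    (|f'| < c → ∀ᶠ s in 𝓝 0, s ≠ 0 → |f s| < c * |s|) ∧
      (c < |f'| → ∀ᶠ s in 𝓝 0, s ≠ 0 → c * |s| < |f s|) := by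
  have h1 := (hasDerivAt_iff_tendsto_slope.mp hf).abs
  have h2 : ∀ s, s ≠ 0 → |slope f 0 s| * |s| = |f s| := fun s hs => by
    rw [slope_def_field, h0, sub_zero, sub_zero, ← abs_mul, div_mul_cancel₀ _ hs]
  constructor <;> intro hlt
  · have := h1.eventually_lt_const hlt
    rw [eventually_nhdsWithin_iff] at this
    filter_upwards [this] with s hs hs0
    rw [← h2 s hs0]
    exact mul_lt_mul_of_pos_right (hs hs0) (abs_pos.mpr hs0)
  · have := h1.eventually_const_lt hlt
    rw [eventually_nhdsWithin_iff] at this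
    filter_upwards [this] with s hs hs0
    rw [← h2 s hs0]
    exact mul_lt_mul_of_pos_right (hs hs0) (abs_pos.mpr hs0)

theorem Slope.hasDerivAt_ell_zero (G : Slope) : HasDerivAt G.ell (-G.g 0) 0 := by
  have := G.hasJet3_ell.hasDerivAt
  exact this

/-- `F` sends the end of a leaf on the side of `Y` to its end on the side of `X`. -/
structure IsReturn (GX GY : Slope) (F : ℝ → ℝ) : Prop where
  continuous : Continuous F
  zero : F 0 = 0
  strictAnti : StrictAnti F
  ell_eq : ∀ s, GX.ell (F s) = GY.ell s

theorem exists_return {GX GY : Slope} {cX cY η : ℝ} (hGX : GX.Near cX η) (hGY : GY.Near cY η)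
    (hη : η < 1) (hX : cX < 0) (hY : 0 < cY) :
    Function.Injective GX.ell ∧ ∃ F, IsReturn GX GY F := by
  obtain ⟨A, hA, -⟩ := hGX.exists_transition hη (Or.inl rfl) (by linarith)
  obtain ⟨B, hB, -⟩ := hGY.exists_transition hη (Or.inr rfl) (by linarith)
  have hA' : ∀ s, GX.ell s = A s := fun s => by rw [hA]; ring
  have hB' : ∀ s, GY.ell s = -B s := fun s => by rw [hB]; ring
  refine ⟨fun s t hst => A.injective (by rwa [← hA', ← hA']), fun s => A.symm (-B s),
    A.symm.continuous.comp B.continuous.neg, ?_, fun s t hst => ?_, fun s => ?_⟩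
  · rw [← hB', Slope.ell_zero, A.symm_apply_eq, ← hA', Slope.ell_zero]
  · exact A.symm.strictMono (neg_lt_neg (B.strictMono hst))
  · rw [hA', A.apply_symm_apply, hB']

namespace IsReturn

variable {GX GY : Slope} {F : ℝ → ℝ} (hF : IsReturn GX GY F)
include hF

theorem pos {s : ℝ} (hs : s < 0) : 0 < F s := by
  rw [← hF.zero]; exact hF.strictAnti hs

theorem neg {s : ℝ} (hs : 0 < s) : F s < 0 := by
  rw [← hF.zero]; exact hF.strictAnti hs

theorem tendsto : Tendsto F (𝓝 0) (𝓝 0) := by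
  simpa [hF.zero] using hF.continuous.tendsto 0

theorem ne_zero {s : ℝ} (hs : s ≠ 0) : F s ≠ 0 := by
  rcases hs.lt_or_gt with h | h
  · exact (hF.pos h).ne'
  · exact (hF.neg h).ne

/-- Comparing the derivatives of the two transition maps at the origin gives `|F s| < |s|`; applying
this twice removes the change of sign. -/
theorem eventually_lt (h : |GY.g 0| < |GX.g 0|) : ∀ᶠ s in 𝓝[>] 0, F (F s) < s := by
  obtain ⟨c, hc1, hc2⟩ := exists_between h
  have hc : 0 < c := (abs_nonneg _).trans_lt hc1
  have h1 := (eventually_abs_lt_of_hasDerivAt GY.hasDerivAt_ell_zero GY.ell_zero).1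
    (by rwa [abs_neg])
  have h2 := (eventually_abs_lt_of_hasDerivAt GX.hasDerivAt_ell_zero GX.ell_zero).2
    (by rwa [abs_neg])
  have h3 : ∀ᶠ s in 𝓝 0, s ≠ 0 → |F s| < |s| := by
    filter_upwards [h1, hF.tendsto.eventually h2] with s hs hs' hs0
    have a1 := hs hs0
    have a2 := hs' (hF.ne_zero hs0)
    rw [hF.ell_eq] at a2
    exact lt_of_mul_lt_mul_left (a2.trans a1) hc.le
  filter_upwards [nhdsWithin_le_nhds h3, nhdsWithin_le_nhds (hF.tendsto.eventually h3),
    self_mem_nhdsWithin] with s hs hs' hs0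
  have hs0 : 0 < s := hs0
  have := (hs' (hF.ne_zero hs0.ne')).trans (hs hs0.ne')
  rwa [abs_of_pos hs0, abs_of_pos (hF.pos (hF.neg hs0))] at this

theorem eventually_gt (h : |GX.g 0| < |GY.g 0|) : ∀ᶠ s in 𝓝[>] 0, s < F (F s) := by
  obtain ⟨c, hc1, hc2⟩ := exists_between h
  have hc : 0 < c := (abs_nonneg _).trans_lt hc1
  have h1 := (eventually_abs_lt_of_hasDerivAt GY.hasDerivAt_ell_zero GY.ell_zero).2
    (by rwa [abs_neg])
  have h2 := (eventually_abs_lt_of_hasDerivAt GX.hasDerivAt_ell_zero GX.ell_zero).1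
    (by rwa [abs_neg])
  have h3 : ∀ᶠ s in 𝓝 0, s ≠ 0 → |s| < |F s| := by
    filter_upwards [h1, hF.tendsto.eventually h2] with s hs hs' hs0
    have a1 := hs hs0
    have a2 := hs' (hF.ne_zero hs0)
    rw [hF.ell_eq] at a2
    exact lt_of_mul_lt_mul_left (a1.trans a2) hc.le
  filter_upwards [nhdsWithin_le_nhds h3, nhdsWithin_le_nhds (hF.tendsto.eventually h3),
    self_mem_nhdsWithin] with s hs hs' hs0
  have hs0 : 0 < s := hs0
  have := (hs hs0.ne').trans (hs' (hF.ne_zero hs0.ne'))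
  rwa [abs_of_pos hs0, abs_of_pos (hF.pos (hF.neg hs0))] at this

end IsReturn

end

section

variable {U : OriginNhd} {r : ℕ}

/-! ### Instability at the resonance -/

theorem Slope.mul_ell_neg {G : Slope} (hG : ∀ p, 0 < G.g p) {s : ℝ} (hs : s ≠ 0) :
    s * G.ell s < 0 := by
  have h2 : StrictMono (G.flow s 0) := strictMono_of_deriv_pos fun t => by
    rw [(G.hasDerivAt_flow s 0 t).deriv]; exact hG _
  have hself : G.flow s 0 s = 0 := Slope.flow_self ..
  rcases hs.lt_or_gt with h | h
  · have := h2 h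
    rw [hself] at this
    exact mul_neg_of_neg_of_pos h this
  · have := h2 h
    rw [hself] at this
    exact mul_neg_of_pos_of_neg h this

theorem Slope.mul_ell_pos {G : Slope} (hG : ∀ p, G.g p < 0) {s : ℝ} (hs : s ≠ 0) :
    0 < s * G.ell s := by
  have h2 : StrictAnti (G.flow s 0) := strictAnti_of_deriv_neg fun t => by
    rw [(G.hasDerivAt_flow s 0 t).deriv]; exact hG _
  have hself : G.flow s 0 s = 0 := Slope.flow_self ..
  rcases hs.lt_or_gt with h | h
  · have := h2 h
    rw [hself] at this
    exact mul_pos_of_neg_of_neg h this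
  · have := h2 h
    rw [hself] at this
    exact mul_pos h this

theorem LocalModel.g_zero {Z : Omega U r} {i : Fin 2} {σ δ : ℝ} {GX GY : Slope}
    {SX SY : Plane → ℝ} (hM : LocalModel Z i σ δ GX GY SX SY) :
    GX.g 0 = Z.1 0 (1 - i) / Z.1 0 i ∧ GY.g 0 = Z.2 0 (1 - i) / Z.2 0 i := by
  have h1 := hM.eq_X 0 hM.zero_mem_ball
  have h2 := hM.eq_Y 0 hM.zero_mem_ball
  have p1 : SX 0 ≠ 0 := fun h => by have := hM.SX_pos 0; simp [h] at this
  have p2 : SY 0 ≠ 0 := fun h => by have := hM.SY_pos 0; simp [h] at this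
  rw [h1.1, h1.2, h2.1, h2.2]
  exact ⟨(mul_div_cancel_left₀ _ p1).symm, (mul_div_cancel_left₀ _ p2).symm⟩

/-- The conjugacy `k` is the restriction of the equivalence to the axis. The two ends of a leaf of
`Z'` are sent to the ends of one leaf of `Z`, and preservation of the half planes tells which end is
on the side of `X` and which on the side of `Y`. -/
theorem LocallyEquivalent.exists_conj_return {Z Z' : Omega U r} (he : LocallyEquivalent Z' Z)
    {i : Fin 2} {σ δ δ' : ℝ} {GX GY HX HY : Slope} {SX SY SX' SY' : Plane → ℝ}
    (hM : LocalModel Z i σ δ GX GY SX SY) (hM' : LocalModel Z' i σ δ' HX HY SX' SY')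
    {F F' : ℝ → ℝ} (hF : IsReturn GX GY F) (hF' : IsReturn HX HY F')
    (hinj : Function.Injective GX.ell) :
    ∃ (k : ℝ → ℝ) (ρ : ℝ), 0 < ρ ∧ ContinuousOn k (Ioo (-ρ) ρ) ∧ StrictMonoOn k (Ioo (-ρ) ρ) ∧
      k 0 = 0 ∧ ∀ᶠ s in 𝓝 0, F (k s) = k (F' s) := by
  obtain ⟨h, -, -, -, h0s, h0, ho, -, hmap, hmap'⟩ := he
  have h0t : (0 : Plane) ∈ h.target := by
    have := h.map_source h0s
    rwa [h0] at this
  have h0' : h.symm 0 = 0 := by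
    have := h.left_inv h0s
    rwa [h0] at this
  obtain ⟨ρ₂, hρ₂, hb₂⟩ : ∃ ρ₂ > 0, ∀ p ∈ Metric.ball (0 : Plane) ρ₂, p ∈ h.target ∧
      p ∈ Metric.ball (0 : Plane) δ ∧ h.symm p ∈ Metric.ball (0 : Plane) δ' := by
    refine Metric.nhds_basis_ball.eventually_iff.mp
      (Filter.Eventually.and (h.open_target.mem_nhds h0t)
      (Filter.Eventually.and (Metric.isOpen_ball.mem_nhds hM.zero_mem_ball) ?_))
    refine (h.symm.continuousAt h0t).eventually (Metric.isOpen_ball.mem_nhds ?_)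
    rw [h0']
    exact hM'.zero_mem_ball
  obtain ⟨ρ₁, hρ₁, hb₁⟩ : ∃ ρ₁ > 0, ∀ p ∈ Metric.ball (0 : Plane) ρ₁, p ∈ h.source ∧
      h p ∈ Metric.ball (0 : Plane) ρ₂ := by
    refine Metric.nhds_basis_ball.eventually_iff.mp
      (Filter.Eventually.and (h.open_source.mem_nhds h0s) ?_)
    refine (h.continuousAt h0s).eventually (Metric.isOpen_ball.mem_nhds ?_)
    rw [h0]
    exact Metric.mem_ball_self hρ₂
  set ρ := min ρ₁ δ' with hρdef
  have hρ : 0 < ρ := lt_min hρ₁ hM'.hδ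
  have hρδ : ρ ≤ δ' := min_le_right _ _
  have hb : ∀ p ∈ Metric.ball (0 : Plane) ρ, p ∈ h.source ∧ h p ∈ Metric.ball (0 : Plane) ρ₂ :=
    fun p hp => hb₁ p (Metric.ball_subset_ball (min_le_left _ _) hp)
  have hsrc : Metric.ball 0 ρ ⊆ h.source := fun p hp => (hb p hp).1
  have himg : ∀ p ∈ Metric.ball (0 : Plane) ρ, h p ∈ Metric.ball (0 : Plane) δ :=
    fun p hp => (hb₂ _ (hb p hp).2).2.1
  have hc : ContinuousOn h (Metric.ball 0 ρ) := h.continuousOn.mono hsrc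
  have haxis : ∀ s, |s| < ρ → h (pt i s 0) (1 - i) = 0 := fun s hs =>
    hM'.image_axis hM hmap hρδ hsrc himg h0 hs
  have hmono := hM'.strictMonoOn_axis hM hmap hρδ hsrc himg h0 h.injOn
  set k : ℝ → ℝ := fun s => h (pt i s 0) i with hk
  have hk0 : k 0 = 0 := by rw [hk]; simp [h0]
  have h0ρ : (0 : ℝ) ∈ Ioo (-ρ) ρ := ⟨by linarith, hρ⟩
  -- A point off the axis cannot be sent into it, because the inverse equivalence also maps the axis
  -- into the axis.
  have hoff : ∀ p ∈ Metric.ball (0 : Plane) ρ, p (1 - i) ≠ 0 → h p (1 - i) ≠ 0 := by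
    intro p hp hp0 hz
    set ρ₃ := min ρ₂ δ
    have hlt : |h p i| < ρ₃ := by
      refine lt_min ?_ ?_
      · exact ((mem_ball_zero_iff_coord i hρ₂).mp (hb p hp).2).1
      · exact ((mem_ball_zero_iff_coord i hM.hδ).mp (himg p hp)).1
    have hsub : ∀ q ∈ Metric.ball (0 : Plane) ρ₃, q ∈ Metric.ball (0 : Plane) ρ₂ := fun q hq =>
      Metric.ball_subset_ball (min_le_left _ _) hq
    have := hM.image_axis hM' hmap' (min_le_right _ _) (fun q hq => (hb₂ q (hsub q hq)).1)
      (fun q hq => (hb₂ q (hsub q hq)).2.2) h0' hlt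
    have e : pt i (h p i) 0 = h p := by rw [← hz, pt_eta]
    rw [e, h.left_inv (hsrc hp)] at this
    exact hp0 this
  have hkpos : ∀ s, 0 < s → s < ρ → 0 < k s := fun s hs hs' => by
    rw [← hk0]
    exact hmono h0ρ ⟨by linarith, hs'⟩ hs
  have hkneg : ∀ s, s < 0 → -ρ < s → k s < 0 := fun s hs hs' => by
    rw [← hk0]
    exact hmono ⟨hs', by linarith⟩ h0ρ hs
  obtain ⟨hpos, hneg⟩ := preserves_half_planes hc hoff
    (ho.exists_same_side h0 i hρ haxis hkpos hoff)
  refine ⟨k, ρ, hρ, ?_, hmono, hk0, ?_⟩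
  · have h1 : ContinuousOn (fun s : ℝ => h (pt i s 0)) (Ioo (-ρ) ρ) := by
      refine hc.comp ((continuous_pt i).comp
        (by fun_prop : Continuous fun s : ℝ => (s, (0 : ℝ)))).continuousOn fun s hs => ?_
      exact pt_mem_ball i (abs_lt.mpr hs) (by simpa using hρ)
    exact (continuous_apply i).comp_continuousOn h1
  · have hell : Tendsto HY.ell (𝓝 0) (𝓝 0) := by
      have := HY.hasDerivAt_ell_zero.continuousAt.tendsto
      rwa [HY.ell_zero] at this
    have e1 : ∀ᶠ s in 𝓝 (0 : ℝ), |s| < ρ :=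
      (continuous_abs.tendsto (0 : ℝ)).eventually_lt_const (by simpa using hρ)
    filter_upwards [e1, hF'.tendsto.eventually e1, hell.eventually e1] with s hs hFs hys
    rcases eq_or_ne s 0 with rfl | hs0
    · rw [hF'.zero, hk0, hF.zero]
    -- The leaf of `Z'` with this label ends at `s` on the side of `Y` and at `F' s` on the side of
    -- `X`.
    set y := HY.ell s with hy
    have hsy : s * y < 0 := Slope.mul_ell_neg hM'.hY hs0
    have hF0 := hF'.ne_zero hs0
    have hFy : 0 < F' s * y := by
      rw [hy, ← hF'.ell_eq]
      exact Slope.mul_ell_pos hM'.hX hF0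
    have hy0 : y ≠ 0 := fun h => by simp [h] at hsy
    have hksign : ∀ t, |t| < ρ → ((0 < k t ↔ 0 < t) ∧ (k t < 0 ↔ t < 0)) := by
      intro t ht
      have ht' := abs_lt.mp ht
      have e2 := hmono.lt_iff_lt h0ρ ht'
      have e3 := hmono.lt_iff_lt ht' h0ρ
      change k 0 < k t ↔ _ at e2
      change k t < k 0 ↔ _ at e3
      rw [hk0] at e2 e3
      exact ⟨e2, e3⟩
    have hkne : ∀ t, |t| < ρ → t ≠ 0 → k t ≠ 0 := by
      intro t ht ht0
      rcases ht0.lt_or_gt with h | h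
      · exact ((hksign t ht).2.mpr h).ne
      · exact ((hksign t ht).1.mpr h).ne'
    have f1 := hM'.image_foot hM hmap hρδ hsrc himg hc hpos hneg hy0 hys hs (hkne s hs hs0)
      (haxis s hs) (if_neg hsy.not_ge)
    have f2 := hM'.image_foot hM hmap hρδ hsrc himg hc hpos hneg hy0 hys hFs
      (hkne _ hFs hF0) (haxis _ hFs) (by rw [foot, if_pos hFy.le, hF'.ell_eq])
    have g1 : k s * y < 0 := by
      rw [mul_neg_iff, (hksign s hs).1, (hksign s hs).2]
      exact mul_neg_iff.mp hsy
    have g2 : 0 < k (F' s) * y := by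
      rw [mul_pos_iff, (hksign _ hFs).1, (hksign _ hFs).2]
      exact mul_pos_iff.mp hFy
    have f1' : GY.ell (k s) = label GX GY (h (pt i 0 y) i) (h (pt i 0 y) (1 - i)) := by
      rw [← f1]; exact (if_neg g1.not_ge).symm
    have f2' : GX.ell (k (F' s)) = label GX GY (h (pt i 0 y) i) (h (pt i 0 y) (1 - i)) := by
      rw [← f2]; exact (if_pos g2.le).symm
    exact hinj (by rw [hF.ell_eq, f1', f2'])

/-- The increasing continuous map `k` fixes `0` and covers a right neighbourhood of `0`, so germs of
properties can be transported along it. -/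
theorem eventually_of_eventually_comp {k : ℝ → ℝ} {ρ : ℝ} (hρ : 0 < ρ)
    (hc : ContinuousOn k (Ioo (-ρ) ρ)) (hm : StrictMonoOn k (Ioo (-ρ) ρ)) (h0 : k 0 = 0)
    {P : ℝ → Prop} (hP : ∀ᶠ z in 𝓝[>] 0, P (k z)) : ∀ᶠ x in 𝓝[>] 0, P x := by
  obtain ⟨b, hb, hsub⟩ := mem_nhdsGT_iff_exists_Ioc_subset.mp (inter_mem hP (Ioo_mem_nhdsGT hρ))
  have hb : 0 < b := hb
  have hbρ : b < ρ := (hsub ⟨hb, le_rfl⟩).2.2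
  have hIcc : Icc 0 b ⊆ Ioo (-ρ) ρ := fun s hs => ⟨by linarith [hs.1], hs.2.trans_lt hbρ⟩
  have hkb : 0 < k b := by
    rw [← h0]
    exact hm (hIcc ⟨le_rfl, hb.le⟩) (hIcc ⟨hb.le, le_rfl⟩) hb
  filter_upwards [Ioo_mem_nhdsGT hkb] with x hx
  obtain ⟨z, hz, rfl⟩ := intermediate_value_Icc hb.le (hc.mono hIcc)
    (show x ∈ Icc (k 0) (k b) by rw [h0]; exact ⟨hx.1.le, hx.2.le⟩)
  refine (hsub ⟨lt_of_le_of_ne hz.1 ?_, hz.2⟩).1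
  rintro rfl
  rw [h0] at hx
  exact lt_irrefl _ hx.1

/-- The sign of `slopeSum` decides whether the second iterate of the return map of `Z'` contracts or
expands on the positive half axis. The increasing conjugacy carries this order relation to the fixed
map `F` of `Z`. -/
theorem LocallyEquivalent.eventually_return {Z Z' : Omega U r} (he : LocallyEquivalent Z' Z)
    (hr : 2 ≤ r) {i : Fin 2} {σ δ : ℝ} {GX GY : Slope} {SX SY : Plane → ℝ}
    (hM : LocalModel Z i σ δ GX GY SX SY) (hZ' : SignConfig Z' i σ) {F : ℝ → ℝ}
    (hF : IsReturn GX GY F) (hinj : Function.Injective GX.ell) :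
    (slopeSum i Z' < 0 → ∀ᶠ x in 𝓝[>] 0, F (F x) < x) ∧
      (0 < slopeSum i Z' → ∀ᶠ x in 𝓝[>] 0, x < F (F x)) := by
  obtain ⟨δ', HX, HY, SX', SY', hM', hHX, hHY⟩ :=
    hZ'.exists_model hr (η := 1 / 2) (by norm_num) (by norm_num)
  obtain ⟨-, F', hF'⟩ := exists_return hHX hHY (by norm_num) hZ'.slope_X hZ'.slope_Y
  obtain ⟨k, ρ, hρ, hc, hm, h0, hconj⟩ := he.exists_conj_return hM hM' hF hF' hinj
  have e1 : ∀ᶠ s in 𝓝 (0 : ℝ), s ∈ Ioo (-ρ) ρ := Ioo_mem_nhds (by linarith) hρ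
  have e2 : ∀ᶠ s in 𝓝[>] 0, F (F (k s)) = k (F' (F' s)) ∧ s ∈ Ioo (-ρ) ρ ∧
      F' (F' s) ∈ Ioo (-ρ) ρ := by
    refine nhdsWithin_le_nhds ?_
    filter_upwards [hconj, hF'.tendsto.eventually hconj, e1,
      (hF'.tendsto.comp hF'.tendsto).eventually e1] with s h1 h2 h3 h4
    exact ⟨by rw [h1, h2], h3, h4⟩
  have hX := hM'.hX 0
  have hY := hM'.hY 0
  have hsum : slopeSum i Z' = HY.g 0 + HX.g 0 := by
    rw [slopeSum, hM'.g_zero.1, hM'.g_zero.2]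
  constructor <;> intro hs
  · refine eventually_of_eventually_comp hρ hc hm h0 (P := fun x => F (F x) < x) ?_
    have := hF'.eventually_lt (by rw [abs_of_pos hY, abs_of_neg hX]; linarith)
    filter_upwards [this, e2] with s h1 h2
    rw [h2.1]
    exact hm h2.2.2 h2.2.1 h1
  · refine eventually_of_eventually_comp hρ hc hm h0 (P := fun x => x < F (F x)) ?_
    have := hF'.eventually_gt (by rw [abs_of_pos hY, abs_of_neg hX]; linarith)
    filter_upwards [this, e2] with s h1 h2
    rw [h2.1]
    exact hm h2.2.1 h2.2.2 h1

/-- A small constant field added to `X` in the direction `1 - i` gives `slopeSum` either sign. If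
all nearby fields were equivalent to `Z`, both `F (F x) < x` and `x < F (F x)` would hold for small
positive `x`. -/
theorem SignConfig.not_mem_Omega0 {Z : Omega U r} (hr : 2 ≤ r) {i : Fin 2} {σ : ℝ}
    (hZ : SignConfig Z i σ) (h0 : slopeSum i Z = 0) : Z ∉ Omega0 U r := by
  rintro ⟨V, hV, hZV, hloc⟩
  obtain ⟨δ, GX, GY, SX, SY, hM, hGX, hGY⟩ :=
    hZ.exists_model hr (η := 1 / 2) (by norm_num) (by norm_num)
  obtain ⟨hinj, F, hF⟩ := exists_return hGX hGY (by norm_num) hZ.slope_X hZ.slope_Y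
  set e := constField U r (pt i 0 1) with he
  set P : ℝ → Omega U r := fun t => (Z.1 + t • e, Z.2) with hP
  have hPc : Continuous P := by fun_prop
  have hP0 : P 0 = Z := by simp [hP]
  have hev : ∀ᶠ t in 𝓝 (0 : ℝ), P t ∈ V ∧ SignConfig (P t) i σ := by
    have h1 := (hV.inter (isOpen_signConfig i σ)).mem_nhds ⟨hZV, hZ⟩
    rw [← hP0] at h1
    exact hPc.tendsto 0 h1
  have hX0 := (hZ.ne_zero i).1
  have hsum : ∀ t, slopeSum i (P t) = t / Z.1 0 i := by
    intro t
    have e1 : (Z.1 + t • e) 0 (1 - i) = Z.1 0 (1 - i) + t := by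
      rw [eval_add, eval_smul, he, constField_zero]
      simp
    have e2 : (Z.1 + t • e) 0 i = Z.1 0 i := by
      rw [eval_add, eval_smul, he, constField_zero]
      simp
    simp only [slopeSum, hP] at h0 ⊢
    rw [e1, e2, add_div, ← add_assoc, h0, zero_add]
  -- With the parameter `u * Z.1 0 i` the sum of the slopes is exactly `u`, whatever the sign of
  -- `Z.1 0 i`.
  have hscale : Tendsto (fun u : ℝ => u * Z.1 0 i) (𝓝 0) (𝓝 0) := by
    have : Continuous fun u : ℝ => u * Z.1 0 i := by fun_prop
    simpa using this.tendsto 0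
  have hev2 := hscale.eventually hev
  have hval : ∀ u : ℝ, slopeSum i (P (u * Z.1 0 i)) = u := fun u => by
    rw [hsum, mul_div_cancel_right₀ _ hX0]
  obtain ⟨u, ⟨huV, huS⟩, hu⟩ := ((hev2.filter_mono (nhdsWithin_le_nhds (s := Iio 0))).and
    self_mem_nhdsWithin).exists
  obtain ⟨v, ⟨hvV, hvS⟩, hv⟩ := ((hev2.filter_mono (nhdsWithin_le_nhds (s := Ioi 0))).and
    self_mem_nhdsWithin).exists
  have a1 := ((hloc _ huV).eventually_return hr hM huS hF hinj).1 (by rw [hval]; exact hu)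
  have a2 := ((hloc _ hvV).eventually_return hr hM hvS hF hinj).2 (by rw [hval]; exact hv)
  obtain ⟨x, hx1, hx2⟩ := (a1.and a2).exists
  exact lt_asymm hx1 hx2

end

section

/-! ### Transition maps between the branches -/

theorem Joins.symm {V : Plane → Plane} {R : Set Plane} {p q : Plane} (h : Joins V R p q) :
    Joins V R q p := by
  obtain ⟨t, γ, h0, h1, hγ⟩ := h
  have hmaps : MapsTo (fun s => t + s) (uIcc 0 (-t)) (uIcc 0 t) := fun s hs => by
    rcases mem_uIcc.mp hs with h | h
    · exact mem_uIcc.mpr (Or.inr ⟨by linarith, by linarith⟩)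
    · exact mem_uIcc.mpr (Or.inl ⟨by linarith, by linarith⟩)
  refine ⟨-t, fun s => γ (t + s), by simpa using h1, by simpa using h0, fun s hs => ?_⟩
  obtain ⟨h2, h3⟩ := hγ (t + s) (hmaps hs)
  refine ⟨h2, ?_⟩
  have h4 : HasDerivWithinAt (fun s => t + s) 1 (uIcc 0 (-t)) s :=
    ((hasDerivAt_id s).const_add t).hasDerivWithinAt
  have h5 := h3.scomp s h4 hmaps
  rwa [one_smul] at h5

namespace Slope

variable (G : Slope)

theorem flow_ell (s : ℝ) : G.flow 0 (G.ell s) s = 0 := by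
  rw [ell, flow_flow, flow_self]

/-- The solution is monotone and vanishes only at `s`, so the product of the coordinates has the
sign of the closed region exactly between `0` and `s`. -/
theorem mem_uIcc_iff_of_sign {ε : ℝ} (hG : ∀ p, ε * G.g p < 0) (s t : ℝ) :
    0 ≤ ε * (t * G.flow 0 (G.ell s) t) ↔ t ∈ uIcc 0 s := by
  have hanti : StrictAnti fun t => ε * G.flow 0 (G.ell s) t := strictAnti_of_deriv_neg fun t => by
    rw [((G.hasDerivAt_flow 0 (G.ell s) t).const_mul ε).deriv]
    exact hG _
  have hs : ε * G.flow 0 (G.ell s) s = 0 := by rw [flow_ell, mul_zero]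
  have e : ε * (t * G.flow 0 (G.ell s) t) = t * (ε * G.flow 0 (G.ell s) t) := by ring
  have e1 : 0 ≤ ε * G.flow 0 (G.ell s) t ↔ t ≤ s := by
    have := hanti.le_iff_ge (a := s) (b := t)
    rwa [hs] at this
  have e2 : ε * G.flow 0 (G.ell s) t ≤ 0 ↔ s ≤ t := by
    have := hanti.le_iff_ge (a := t) (b := s)
    rwa [hs] at this
  rw [e, mul_nonneg_iff, e1, e2, mem_uIcc]
  tauto

theorem abs_flow_le {ε : ℝ} (hε : ε = 1 ∨ ε = -1) (hG : ∀ p, ε * G.g p < 0) {s t : ℝ}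
    (ht : t ∈ uIcc 0 s) : |G.flow 0 (G.ell s) t| ≤ |G.ell s| := by
  have hanti : StrictAnti fun t => ε * G.flow 0 (G.ell s) t := strictAnti_of_deriv_neg fun t => by
    rw [((G.hasDerivAt_flow 0 (G.ell s) t).const_mul ε).deriv]
    exact hG _
  have hs : ε * G.flow 0 (G.ell s) s = 0 := by rw [flow_ell, mul_zero]
  have h0 : ε * G.flow 0 (G.ell s) 0 = ε * G.ell s := by rw [flow_self]
  have habs : |ε| = 1 := by rcases hε with rfl | rfl <;> simp
  have key : |ε * G.flow 0 (G.ell s) t| ≤ |ε * G.ell s| := by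
    rcases mem_uIcc.mp ht with h | h
    · have a1 := hanti.antitone h.1
      have a2 := hanti.antitone h.2
      simp only [hs, h0] at a1 a2
      rw [abs_of_nonneg a2, abs_of_nonneg (a2.trans a1)]
      exact a1
    · have a1 := hanti.antitone h.1
      have a2 := hanti.antitone h.2
      simp only [hs, h0] at a1 a2
      rw [abs_of_nonpos a1, abs_of_nonpos (a2.trans a1)]
      linarith
  rwa [abs_mul, abs_mul, habs, one_mul, one_mul] at key

end Slope

/-- This gives uniqueness of the transition, for curves that might a priori leave the ball where the
slope describes the field. The label is constant until the first exit time; constancy and the sign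
of the region confine the curve to a smaller box, so there is no exit. The factor `c` allows both
directions of time. -/
theorem label_eq_of_solution {V : Plane → Plane} {i : Fin 2} {G : Slope} {δ ε : ℝ} (hδ : 0 < δ)
    (hV : ∀ p ∈ Metric.ball (0 : Plane) δ, V p (1 - i) = V p i * G.g (p i, p (1 - i)))
    (hε : ε = 1 ∨ ε = -1) (hG : ∀ p, ε * G.g p < 0) {s c : ℝ} (hs : |s| < δ) (hl : |G.ell s| < δ)
    {γ : ℝ → Plane} (h0 : γ 0 = pt i s 0)
    (hγ : ∀ τ ∈ Icc (0 : ℝ) 1, 0 ≤ ε * (γ τ i * γ τ (1 - i)) ∧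
      HasDerivWithinAt γ (c • V (γ τ)) (Icc 0 1) τ) :
    G.flow (γ 1 i) (γ 1 (1 - i)) 0 = G.ell s := by
  have hγc : ContinuousOn γ (Icc 0 1) := fun τ hτ => (hγ τ hτ).2.continuousWithinAt
  set L : ℝ → ℝ := fun τ => G.flow (γ τ i) (γ τ (1 - i)) 0 with hL
  have hLc : ContinuousOn L (Icc 0 1) := by
    have hf : Continuous fun p : Plane => G.flow (p i) (p (1 - i)) 0 :=
      G.continuous_flow.comp (by fun_prop : Continuous fun p : Plane => (p i, p (1 - i), (0 : ℝ)))
    exact hf.comp_continuousOn hγc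
  have hL0 : L 0 = G.ell s := by simp [hL, h0, Slope.ell]
  have hconst : ∀ b ∈ Icc (0 : ℝ) 1, (∀ τ ∈ Ico 0 b, γ τ ∈ Metric.ball (0 : Plane) δ) →
      L b = G.ell s := by
    intro b hb hball
    rw [← hL0]
    refine constant_of_has_deriv_right_zero (hLc.mono (Icc_subset_Icc le_rfl hb.2))
      (fun τ hτ => ?_) b ⟨hb.1, le_rfl⟩
    have hτ1 : τ ∈ Ico (0 : ℝ) 1 := ⟨hτ.1, hτ.2.trans_le hb.2⟩
    have hd := ((hγ τ ⟨hτ1.1, hτ1.2.le⟩).2).mono_of_mem_nhdsWithin (Icc_mem_nhdsGE_of_mem hτ1)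
    have h1 : HasDerivWithinAt (fun τ => (γ τ i, γ τ (1 - i)))
        (c * V (γ τ) i, c * V (γ τ) (1 - i)) (Ici τ) τ :=
      (HasDerivWithinAt.coord hd i).prodMk (HasDerivWithinAt.coord hd (1 - i))
    refine ((G.hasFDerivAt_flow (γ τ i) (γ τ (1 - i)) 0).comp_hasDerivWithinAt τ h1).congr_deriv ?_
    simp only [smul_apply, sub_apply,
      ContinuousLinearMap.coe_snd', ContinuousLinearMap.coe_fst', smul_eq_mul]
    rw [hV _ (hball τ hτ)]
    ring
  have hbox : ∀ τ ∈ Icc (0 : ℝ) 1, L τ = G.ell s → |γ τ i| ≤ |s| ∧ |γ τ (1 - i)| ≤ |G.ell s| := by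
    intro τ hτ hLτ
    have hu : G.flow 0 (G.ell s) (γ τ i) = γ τ (1 - i) := by
      rw [← hLτ, hL, Slope.flow_flow, Slope.flow_self]
    have hmem : γ τ i ∈ uIcc 0 s := by
      rw [← G.mem_uIcc_iff_of_sign hG, hu]
      exact (hγ τ hτ).1
    constructor
    · rcases mem_uIcc.mp hmem with h | h
      · rw [abs_of_nonneg h.1, abs_of_nonneg (h.1.trans h.2)]; exact h.2
      · rw [abs_of_nonpos h.2, abs_of_nonpos (h.1.trans h.2)]; linarith
    · rw [← hu]
      exact G.abs_flow_le hε hG hmem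
  refine hconst 1 ⟨zero_le_one, le_rfl⟩ ?_
  -- The first exit time is the least element of a compact set of times.
  by_contra! hcon
  obtain ⟨τ0, hτ0, hτ0'⟩ := hcon
  have hcomp : IsCompact (Icc (0 : ℝ) 1 ∩ γ ⁻¹' (Metric.ball (0 : Plane) δ)ᶜ) :=
    isCompact_Icc.of_isClosed_subset
      (hγc.preimage_isClosed_of_isClosed isClosed_Icc Metric.isOpen_ball.isClosed_compl)
      inter_subset_left
  obtain ⟨b, ⟨hb, hb'⟩, hmin⟩ := hcomp.exists_isLeast ⟨τ0, ⟨hτ0.1, hτ0.2.le⟩, hτ0'⟩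
  have hin : ∀ τ ∈ Ico 0 b, γ τ ∈ Metric.ball (0 : Plane) δ := fun τ hτ => by
    by_contra h'
    exact hτ.2.not_ge (hmin ⟨⟨hτ.1, hτ.2.le.trans hb.2⟩, h'⟩)
  have hLb := hconst b hb hin
  obtain ⟨h1, h2⟩ := hbox b hb hLb
  exact hb' ((mem_ball_zero_iff_coord i hδ).mpr ⟨h1.trans_lt hs, h2.trans_lt hl⟩)

/-- Near the origin the transition inside the closed region exists and is unique, and it is `ell`
for the slope of the field. Existence comes from running the solution with its true speed, backwards
if necessary; uniqueness is `label_eq_of_solution`. -/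
theorem exists_passage {V : Plane → Plane} (hV : ContDiffAt ℝ 2 V 0) (i : Fin 2) {ε : ℝ}
    (hε : ε = 1 ∨ ε = -1) (hsign : ε * (V 0 0 * V 0 1) < 0) {U : OriginNhd} {R : Set Plane}
    (hR : ∀ p, p ∈ R ↔ p ∈ U.carrier ∧ 0 ≤ ε * (p 0 * p 1)) :
    ∃ G : Slope, (G.g =ᶠ[𝓝 0] fun q => V (pt i q.1 q.2) (1 - i) / V (pt i q.1 q.2) i) ∧
      ∀ᶠ s in 𝓝 0, ∀ x, Joins V R (pt i s 0) (pt i 0 x) ↔ x = G.ell s := by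
  rw [mul_eq_mul i] at hsign
  have hVi : V 0 i ≠ 0 := fun h => by simp [h] at hsign
  have hVj : V 0 (1 - i) ≠ 0 := fun h => by simp [h] at hsign
  obtain ⟨σ, hσ, hσV⟩ : ∃ σ : ℝ, (σ = 1 ∨ σ = -1) ∧ 0 < σ * V 0 i := by
    rcases hVi.lt_or_gt with h | h
    · exact ⟨-1, Or.inr rfl, by linarith⟩
    · exact ⟨1, Or.inl rfl, by linarith⟩
  obtain ⟨G, S, hN, hS, ⟨m, M, hm, hbd⟩, hev⟩ :=
    exists_model_field hV hσV hVj (η := 1 / 2) (by norm_num)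
  have hS0 : ∀ p, S p ≠ 0 := fun p h => by
    have := (hbd p).1
    rw [h, mul_zero] at this
    linarith
  have hc : ε * (V 0 (1 - i) / V 0 i) < 0 := by
    have : ε * (V 0 (1 - i) / V 0 i) = ε * (V 0 i * V 0 (1 - i)) / (V 0 i) ^ 2 := by
      field_simp
    rw [this]
    exact div_neg_of_neg_of_pos hsign (by positivity)
  have hG : ∀ p, ε * G.g p < 0 := by
    intro p
    rcases hε with rfl | rfl
    · rw [one_mul]
      exact hN.neg (by norm_num) (by linarith) p
    · have := hN.pos (by norm_num) (by linarith) p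
      linarith
  obtain ⟨δ, hδ, hball⟩ := Metric.nhds_basis_ball.eventually_iff.mp
    (hev.and (U.isOpen'.mem_nhds U.zero_mem'))
  refine ⟨G, ?_, ?_⟩
  · have hpt : Tendsto (fun q : ℝ × ℝ => pt i q.1 q.2) (𝓝 0) (𝓝 0) := by
      have := (continuous_pt i).tendsto (0, 0)
      rwa [pt_zero] at this
    filter_upwards [hpt.eventually hev] with q hq
    rw [hq.1, hq.2, pt_self, pt_other]
    field_simp [hS0]
  · have hell : Tendsto G.ell (𝓝 0) (𝓝 0) := by
      have := G.hasDerivAt_ell_zero.continuousAt.tendsto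
      rwa [G.ell_zero] at this
    have e1 : ∀ᶠ s in 𝓝 (0 : ℝ), |s| < δ :=
      (continuous_abs.tendsto (0 : ℝ)).eventually_lt_const (by simpa using hδ)
    filter_upwards [e1, hell.eventually e1] with s hs hl
    have hbox : ∀ t ∈ uIcc 0 s, pt i t (G.flow 0 (G.ell s) t) ∈ Metric.ball (0 : Plane) δ :=
      fun t ht => pt_mem_ball i (abs_lt_of_mem_uIcc (by simpa using hδ) hs ht)
        ((G.abs_flow_le hε hG ht).trans_lt hl)
    have hRbox : ∀ t ∈ uIcc 0 s, pt i t (G.flow 0 (G.ell s) t) ∈ R := fun t ht => by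
      rw [hR, mul_eq_mul i, pt_self, pt_other]
      exact ⟨(hball (hbox t ht)).2, (G.mem_uIcc_iff_of_sign hG s t).mpr ht⟩
    have hjoin : ∀ a b : ℝ, uIcc a b ⊆ uIcc 0 s → σ * a ≤ σ * b →
        Joins V R (pt i a (G.flow 0 (G.ell s) a)) (pt i b (G.flow 0 (G.ell s) b)) := by
      intro a b hsub hab
      set v : ℝ → ℝ := fun t => S (pt i t (G.flow 0 (G.ell s) t)) with hv
      have hvc : Continuous v := hS.comp ((continuous_pt i).comp
        (continuous_id.prodMk (G.continuous_flow_right 0 (G.ell s))))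
      obtain ⟨T, hT, θ, hθ0, hθT, hθc, hθi, hθinj, hθd⟩ := exists_time_change hσ hvc.measurable hm
        (fun t => hbd _) hab
      refine ⟨T, fun t => pt i (θ t) (G.flow 0 (G.ell s) (θ t)), by simp only [hθ0],
        by simp only [hθT], fun t ht => ?_⟩
      rw [uIcc_of_le hT] at ht
      have hmem : θ t ∈ uIcc 0 s := hsub (hθi ▸ mem_image_of_mem θ ht)
      refine ⟨hRbox _ hmem, (hasDerivAt_pt ?_ ?_).hasDerivWithinAt⟩
      · rw [(hball (hbox _ hmem)).1.1]
        exact hθd t hvc.continuousAt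
      · rw [(hball (hbox _ hmem)).1.2, pt_self, pt_other]
        refine ((G.hasDerivAt_flow 0 (G.ell s) (θ t)).comp t (hθd t hvc.continuousAt)).congr_deriv ?_
        rw [mul_comm]
    intro x
    constructor
    · rintro ⟨t, γ, h0, h1, hγ⟩
      -- Rescaling to `[0, 1]` absorbs the length and the sign of the time `t` into the factor `c =
      -- t`.
      have hmaps : MapsTo (fun τ => t * τ) (Icc 0 1) (uIcc 0 t) := fun τ hτ => by
        rcases le_total 0 t with h | h
        · exact mem_uIcc.mpr (Or.inl ⟨mul_nonneg h hτ.1, by nlinarith [hτ.2]⟩)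
        · exact mem_uIcc.mpr (Or.inr ⟨by nlinarith [hτ.2], mul_nonpos_of_nonpos_of_nonneg h hτ.1⟩)
      have := label_eq_of_solution (V := V) (i := i) (G := G) (c := t) hδ (fun p hp => by
        rw [(hball hp).1.1]; exact (hball hp).1.2) hε hG hs hl (γ := fun τ => γ (t * τ))
        (by simpa using h0) fun τ hτ => by
          obtain ⟨a1, a2⟩ := hγ _ (hmaps hτ)
          refine ⟨?_, ?_⟩
          · rw [← mul_eq_mul]; exact ((hR _).mp a1).2
          · have h4 : HasDerivWithinAt (fun τ => t * τ) t (Icc 0 1) τ := by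
              simpa using ((hasDerivAt_id τ).const_mul t).hasDerivWithinAt
            exact a2.scomp τ h4 hmaps
      simpa [h1] using this
    · rintro rfl
      have e0 : pt i 0 (G.flow 0 (G.ell s) 0) = pt i 0 (G.ell s) := by rw [Slope.flow_self]
      have es : pt i s (G.flow 0 (G.ell s) s) = pt i s 0 := by rw [G.flow_ell]
      rw [← e0]
      nth_rewrite 1 [← es]
      rcases le_total (σ * s) (σ * 0) with h | h
      · exact hjoin s 0 (by rw [uIcc_comm]) h
      · exact (hjoin 0 s le_rfl h).symm

end

section

variable {U : OriginNhd} {r : ℕ}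

/-! ### Jets of slopes -/

/-- The parametrization `pt` as a linear equivalence. -/
def ptEquiv (i : Fin 2) : (ℝ × ℝ) ≃L[ℝ] Plane :=
  LinearEquiv.toContinuousLinearEquiv
    { toFun := fun q => pt i q.1 q.2
      invFun := fun p => (p i, p (1 - i))
      map_add' := fun p q => plane_ext (i := i) (by simp) (by simp)
      map_smul' := fun c p => plane_ext (i := i) (by simp) (by simp)
      left_inv := fun q => by simp
      right_inv := fun p => pt_eta i p }

/-- The component of index `k` of a field in the coordinates of `pt`. -/
def coordField (i : Fin 2) (V : CrField U r) (k : Fin 2) (q : ℝ × ℝ) : ℝ := V (pt i q.1 q.2) k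

theorem coordField_zero (i : Fin 2) (V : CrField U r) (k : Fin 2) :
    coordField i V k 0 = V 0 k := by
  simp [coordField]

theorem contDiffAt_coordField (hr : 2 ≤ r) (i : Fin 2) (V : CrField U r) (k : Fin 2) :
    ContDiffAt ℝ 2 (coordField i V k) 0 := by
  have h1 : ContDiffAt ℝ 2 (fun p => V p k) (ptEquiv i 0) := by
    rw [map_zero]
    exact contDiffAt_pi.mp (V.contDiffAt_zero hr) k
  exact h1.comp (0 : ℝ × ℝ) (ptEquiv i).contDiff.contDiffAt

theorem iteratedFDeriv_coordField {n : ℕ} (hn : n ≤ 2) (hr : 2 ≤ r) (i : Fin 2) (V : CrField U r)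
    (k : Fin 2) (m : Fin n → ℝ × ℝ) : iteratedFDeriv ℝ n (coordField i V k) 0 m =
      iteratedFDeriv ℝ n V 0 (fun l => ptEquiv i (m l)) k := by
  have h1 : coordField i V k = (fun p => V p k) ∘ ptEquiv i := rfl
  have h2 : (fun p => V p k) = (ContinuousLinearMap.proj (R := ℝ) (φ := fun _ : Fin 2 => ℝ) k) ∘
      (V : Plane → Plane) := rfl
  have h3 : iteratedFDeriv ℝ n ((fun p => V p k) ∘ ptEquiv i) 0 =
      (iteratedFDeriv ℝ n (fun p => V p k) (ptEquiv i 0)).compContinuousLinearMap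
        fun _ => (ptEquiv i : ℝ × ℝ →L[ℝ] Plane) := by
    simp only [← iteratedFDerivWithin_univ]
    exact (ptEquiv i).iteratedFDerivWithin_comp_right _ uniqueDiffOn_univ (mem_univ _) n
  rw [h1, h3, map_zero, h2,
    ContinuousLinearMap.iteratedFDeriv_comp_left _ (V.contDiffAt_zero hr) (by exact_mod_cast hn)]
  rfl

theorem continuous_iteratedFDeriv_coordField {n : ℕ} (hn : n ≤ 2) (hr : 2 ≤ r) (i k : Fin 2)
    (m : Fin n → ℝ × ℝ) :
    Continuous fun V : CrField U r => iteratedFDeriv ℝ n (coordField i V k) 0 m := by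
  simp only [iteratedFDeriv_coordField hn hr]
  have h1 := CrField.continuous_jet_zero (U := U) (hn.trans hr)
  have h2 := (ContinuousMultilinearMap.apply ℝ (fun _ : Fin n => Plane) Plane
    (fun l => ptEquiv i (m l))).continuous.comp h1
  exact (continuous_apply k).comp h2

/-- The first derivatives at the origin of a component. -/
def jetOne (i : Fin 2) (V : CrField U r) (k : Fin 2) (e : ℝ × ℝ) : ℝ :=
  fderiv ℝ (coordField i V k) 0 e

/-- The second derivatives at the origin of a component. -/
def jetTwo (i : Fin 2) (V : CrField U r) (k : Fin 2) (e e' : ℝ × ℝ) : ℝ :=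
  fderiv ℝ (fderiv ℝ (coordField i V k)) 0 e' e

theorem continuous_jetOne (hr : 2 ≤ r) (i k : Fin 2) (e : ℝ × ℝ) :
    Continuous fun V : CrField U r => jetOne i V k e := by
  have := continuous_iteratedFDeriv_coordField (U := U) (n := 1) (by norm_num) hr i k fun _ => e
  simp only [iteratedFDeriv_one_apply] at this
  exact this

theorem continuous_jetTwo (hr : 2 ≤ r) (i k : Fin 2) (e e' : ℝ × ℝ) :
    Continuous fun V : CrField U r => jetTwo i V k e e' := by
  have := continuous_iteratedFDeriv_coordField (U := U) (n := 2) le_rfl hr i k ![e', e]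
  simp only [iteratedFDeriv_two_apply] at this
  exact this

/-- The value at the origin of the slope of a field. -/
def slopeZero (i : Fin 2) (V : CrField U r) : ℝ := V 0 (1 - i) / V 0 i

/-- The first derivatives at the origin of the slope of a field. -/
def slopeOne (i : Fin 2) (V : CrField U r) (e : ℝ × ℝ) : ℝ :=
  (jetOne i V (1 - i) e - slopeZero i V * jetOne i V i e) / V 0 i

/-- The second derivatives at the origin of the slope of a field. -/
def slopeTwo (i : Fin 2) (V : CrField U r) (e e' : ℝ × ℝ) : ℝ :=
  (jetTwo i V (1 - i) e e' - slopeZero i V * jetTwo i V i e e'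
    - slopeOne i V e' * jetOne i V i e - slopeOne i V e * jetOne i V i e') / V 0 i

theorem continuousAt_slopeZero (i : Fin 2) {V : CrField U r} (hV : V 0 i ≠ 0) :
    ContinuousAt (slopeZero (U := U) (r := r) i) V :=
  (continuous_eval_zero _).continuousAt.div (continuous_eval_zero _).continuousAt hV

theorem continuousAt_slopeOne (hr : 2 ≤ r) (i : Fin 2) {V : CrField U r} (hV : V 0 i ≠ 0)
    (e : ℝ × ℝ) : ContinuousAt (fun V : CrField U r => slopeOne i V e) V :=
  ((continuous_jetOne hr _ _ _).continuousAt.sub ((continuousAt_slopeZero i hV).mul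
    (continuous_jetOne hr _ _ _).continuousAt)).div (continuous_eval_zero _).continuousAt hV

theorem continuousAt_slopeTwo (hr : 2 ≤ r) (i : Fin 2) {V : CrField U r} (hV : V 0 i ≠ 0)
    (e e' : ℝ × ℝ) : ContinuousAt (fun V : CrField U r => slopeTwo i V e e') V :=
  ((((continuous_jetTwo hr _ _ _ _).continuousAt.sub ((continuousAt_slopeZero i hV).mul
    (continuous_jetTwo hr _ _ _ _).continuousAt)).sub ((continuousAt_slopeOne hr i hV e').mul
    (continuous_jetOne hr _ _ _).continuousAt)).sub ((continuousAt_slopeOne hr i hV e).mul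
    (continuous_jetOne hr _ _ _).continuousAt)).div (continuous_eval_zero _).continuousAt hV

/-- Leibniz's rule for the identity `component = slope * component`. It is stated for the product
rather than the quotient, so that the derivatives of the slope are obtained by solving linear
equations. -/
theorem fderiv_of_eventuallyEq_mul {A B g : ℝ × ℝ → ℝ} (hB : ContDiffAt ℝ 2 B 0)
    (hg : ContDiff ℝ 2 g) (hA : A =ᶠ[𝓝 0] fun q => g q * B q) (e e' : ℝ × ℝ) :
    fderiv ℝ A 0 e = g 0 * fderiv ℝ B 0 e + fderiv ℝ g 0 e * B 0 ∧
    fderiv ℝ (fderiv ℝ A) 0 e' e = g 0 * fderiv ℝ (fderiv ℝ B) 0 e' e +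
      fderiv ℝ g 0 e' * fderiv ℝ B 0 e + fderiv ℝ (fun q => fderiv ℝ g q e) 0 e' * B 0 +
      fderiv ℝ g 0 e * fderiv ℝ B 0 e' := by
  have hBe : ∀ᶠ q in 𝓝 (0 : ℝ × ℝ), DifferentiableAt ℝ B q :=
    (hB.eventually (by simp)).mono fun q hq => hq.differentiableAt (by norm_num)
  have hgd : Differentiable ℝ g := hg.differentiable (by norm_num)
  have h1 : fderiv ℝ A =ᶠ[𝓝 0] fun q => g q • fderiv ℝ B q + B q • fderiv ℝ g q := by
    refine hA.fderiv.trans ?_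
    filter_upwards [hBe] with q hq
    exact fderiv_fun_mul (hgd q) hq
  have hB' : DifferentiableAt ℝ (fderiv ℝ B) 0 :=
    (hB.fderiv_right (m := 1) (by norm_num)).differentiableAt (by norm_num)
  have hg' : DifferentiableAt ℝ (fderiv ℝ g) 0 :=
    ((hg.fderiv_right (m := 1) (by norm_num)).differentiable (by norm_num)) 0
  have hB0 := hB.differentiableAt (by norm_num)
  have h2 : HasFDerivAt (fun q => g q • fderiv ℝ B q + B q • fderiv ℝ g q) _ 0 :=
    ((hgd 0).hasFDerivAt.smul hB'.hasFDerivAt).add (hB0.hasFDerivAt.smul hg'.hasFDerivAt)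
  have h3 : fderiv ℝ (fun q => fderiv ℝ g q e) 0 e' = fderiv ℝ (fderiv ℝ g) 0 e' e := by
    rw [(hg'.hasFDerivAt.clm_apply (hasFDerivAt_const e 0)).fderiv]
    simp
  constructor
  · rw [h1.self_of_nhds]
    simp
    ring
  · rw [h1.fderiv_eq, h2.fderiv, h3]
    simp
    ring

theorem Slope.jets_of_eventuallyEq (hr : 2 ≤ r) {i : Fin 2} {V : CrField U r} (hV : V 0 i ≠ 0)
    {G : Slope} (hG : G.g =ᶠ[𝓝 0] fun q => V (pt i q.1 q.2) (1 - i) / V (pt i q.1 q.2) i) :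
    G.g 0 = slopeZero i V ∧ (∀ e, fderiv ℝ G.g 0 e = slopeOne i V e) ∧
      ∀ e e', fderiv ℝ (fun q => fderiv ℝ G.g q e) 0 e' = slopeTwo i V e e' := by
  have hB := contDiffAt_coordField hr i V i
  have hB0 : coordField i V i 0 ≠ 0 := by rwa [coordField_zero]
  have hA : coordField i V (1 - i) =ᶠ[𝓝 0] fun q => G.g q * coordField i V i q := by
    filter_upwards [hG, hB.continuousAt.eventually_ne hB0] with q hq hq0
    rw [hq]
    exact (div_mul_cancel₀ _ hq0).symm
  have h0 : G.g 0 = slopeZero i V := by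
    rw [hG.self_of_nhds, slopeZero]
    simp
  have h1 : ∀ e, fderiv ℝ G.g 0 e = slopeOne i V e := fun e => by
    have := (fderiv_of_eventuallyEq_mul hB G.contDiff hA e e).1
    rw [coordField_zero, h0] at this
    rw [slopeOne, eq_div_iff hV, jetOne, jetOne, this]
    ring
  refine ⟨h0, h1, fun e e' => ?_⟩
  have := (fderiv_of_eventuallyEq_mul hB G.contDiff hA e e').2
  rw [coordField_zero, h0, h1, h1] at this
  rw [slopeTwo, eq_div_iff hV, jetTwo, jetTwo, jetOne, jetOne, this]
  ring

/-! ### Jets of the transition maps -/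

/-- The derivative at the origin of the transition map. -/
def passOne (i : Fin 2) (V : CrField U r) : ℝ := -slopeZero i V

/-- The second derivative at the origin of the transition map. -/
def passTwo (i : Fin 2) (V : CrField U r) : ℝ :=
  -slopeOne i V (1, 0) + slopeZero i V * slopeOne i V (0, 1)

/-- The third derivative at the origin of the transition map. -/
def passThree (i : Fin 2) (V : CrField U r) : ℝ :=
  -slopeTwo i V (1, 0) (1, 0) + 2 * slopeOne i V (1, 0) * slopeOne i V (0, 1)
    + slopeZero i V * (slopeTwo i V (0, 1) (1, 0) - slopeZero i V * slopeTwo i V (0, 1) (0, 1))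
    - slopeZero i V * slopeOne i V (0, 1) ^ 2

theorem continuousAt_passOne (i : Fin 2) {V : CrField U r} (hV : V 0 i ≠ 0) :
    ContinuousAt (passOne (U := U) (r := r) i) V := (continuousAt_slopeZero i hV).neg

theorem continuousAt_passTwo (hr : 2 ≤ r) (i : Fin 2) {V : CrField U r} (hV : V 0 i ≠ 0) :
    ContinuousAt (passTwo (U := U) (r := r) i) V :=
  (continuousAt_slopeOne hr i hV _).neg.add
    ((continuousAt_slopeZero i hV).mul (continuousAt_slopeOne hr i hV _))

theorem continuousAt_passThree (hr : 2 ≤ r) (i : Fin 2) {V : CrField U r} (hV : V 0 i ≠ 0) :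
    ContinuousAt (passThree (U := U) (r := r) i) V := by
  have h0 := continuousAt_slopeZero i hV
  have h1 := continuousAt_slopeOne hr i hV
  have h2 := continuousAt_slopeTwo hr i hV
  exact (((h2 _ _).neg.add ((continuousAt_const.mul (h1 _)).mul (h1 _))).add
    (h0.mul ((h2 _ _).sub (h0.mul (h2 _ _))))).sub (h0.mul ((h1 _).pow 2))

theorem Slope.hasJet3_pass (hr : 2 ≤ r) {i : Fin 2} {V : CrField U r} (hV : V 0 i ≠ 0)
    {G : Slope} (hG : G.g =ᶠ[𝓝 0] fun q => V (pt i q.1 q.2) (1 - i) / V (pt i q.1 q.2) i) :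
    HasJet3 G.ell (passOne i V) (passTwo i V) (passThree i V) := by
  obtain ⟨h0, h1, h2⟩ := Slope.jets_of_eventuallyEq hr hV hG
  have hs : G.gs 0 = slopeOne i V (1, 0) := h1 _
  have hu : G.gu 0 = slopeOne i V (0, 1) := h1 _
  have hss : G.gss 0 = slopeTwo i V (1, 0) (1, 0) := h2 _ _
  have hus : G.gus 0 = slopeTwo i V (0, 1) (1, 0) := h2 _ _
  have huu : G.guu 0 = slopeTwo i V (0, 1) (0, 1) := h2 _ _
  have := G.hasJet3_ell
  rwa [h0, hs, hu, hss, hus, huu] at this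

/-- The index is `1` whichever branch crosses: `phiX` starts on `x₁ = 0` at height `y` and ends on
`x₂ = 0`, so `x₂` plays the role of the time `s`. For `phiY` the roles are exchanged. -/
theorem hasJet3_phiX (hr : 2 ≤ r) {Z : Omega U r} (h : Z.1 0 0 * Z.1 0 1 < 0) :
    HasJet3 (phiX Z) (passOne 1 Z.1) (passTwo 1 Z.1) (passThree 1 Z.1) := by
  obtain ⟨G, hG, hev⟩ := exists_passage (Z.1.contDiffAt_zero hr) 1 (Or.inl rfl)
    (by rwa [one_mul]) (U := U) (R := regionPos U ∪ switching U) fun p => by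
      rw [one_mul]
      constructor
      · rintro (⟨h1, h2⟩ | ⟨h1, h2⟩)
        exacts [⟨h1, h2.le⟩, ⟨h1, h2.ge⟩]
      · rintro ⟨h1, h2⟩
        rcases h2.lt_or_eq with h3 | h3
        exacts [Or.inl ⟨h1, h3⟩, Or.inr ⟨h1, h3.symm⟩]
  refine (Slope.hasJet3_pass hr (fun h0 => ?_) hG).congr ?_
  · rw [h0, mul_zero] at h
    exact lt_irrefl _ h
  · filter_upwards [hev] with y hy
    have e1 : pt 1 y 0 = ![0, y] := by funext k; fin_cases k <;> simp [pt]
    have e2 : ∀ x, pt 1 0 x = ![x, 0] := fun x => by funext k; fin_cases k <;> simp [pt]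
    simp only [e1, e2] at hy
    have hex : ∃ x : ℝ, Joins Z.1 (regionPos U ∪ switching U) ![0, y] ![x, 0] :=
      ⟨G.ell y, (hy _).mpr rfl⟩
    rw [phiX, dif_pos hex]
    exact (hy _).mp hex.choose_spec

theorem hasJet3_phiY (hr : 2 ≤ r) {Z : Omega U r} (h : 0 < Z.2 0 0 * Z.2 0 1) :
    HasJet3 (phiY Z) (passOne 0 Z.2) (passTwo 0 Z.2) (passThree 0 Z.2) := by
  obtain ⟨G, hG, hev⟩ := exists_passage (Z.2.contDiffAt_zero hr) 0 (Or.inr rfl)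
    (by linarith) (U := U) (R := regionNeg U ∪ switching U) fun p => by
      constructor
      · rintro (⟨h1, h2⟩ | ⟨h1, h2⟩)
        exacts [⟨h1, by linarith⟩, ⟨h1, by linarith⟩]
      · rintro ⟨h1, h2⟩
        have h2 : p 0 * p 1 ≤ 0 := by linarith
        rcases h2.lt_or_eq with h3 | h3
        exacts [Or.inl ⟨h1, h3⟩, Or.inr ⟨h1, h3⟩]
  refine (Slope.hasJet3_pass hr (fun h0 => ?_) hG).congr ?_
  · rw [h0, zero_mul] at h
    exact lt_irrefl _ h
  · filter_upwards [hev] with x hx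
    have e1 : pt 0 x 0 = ![x, 0] := by funext k; fin_cases k <;> simp [pt]
    have e2 : ∀ y, pt 0 0 y = ![0, y] := fun y => by funext k; fin_cases k <;> simp [pt]
    simp only [e1, e2] at hx
    have hex : ∃ y : ℝ, Joins Z.2 (regionNeg U ∪ switching U) ![x, 0] ![0, y] :=
      ⟨G.ell x, (hx _).mpr rfl⟩
    rw [phiY, dif_pos hex]
    exact (hx _).mp hex.choose_spec

/-- The set of fields with the signs of the pseudo-Hopf fields. -/
def signSet (U : OriginNhd) (r : ℕ) : Set (Omega U r) :=
  {Z | (∃ i : Fin 2, 0 < Z.1 0 i * Z.2 0 i ∧ Z.1 0 (1 - i) * Z.2 0 (1 - i) < 0) ∧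
    Z.1 0 0 * Z.1 0 1 < 0}

theorem exists_signConfig {Z : Omega U r} (hZ : Z ∈ signSet U r) : ∃ i σ, SignConfig Z i σ := by
  obtain ⟨⟨i, h1, h2⟩, h3⟩ := hZ
  rw [mul_eq_mul i] at h3
  have hX : Z.1 0 i ≠ 0 := fun h => by simp [h] at h1
  rcases hX.lt_or_gt with h | h
  · have a1 := neg_of_mul_pos_right h1 h.le
    have a2 := pos_of_mul_neg_right h3 h.le
    have a3 := neg_of_mul_neg_right h2 a2.le
    exact ⟨i, -1, Or.inr rfl, by linarith, by linarith, by linarith, by linarith⟩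
  · have a1 := pos_of_mul_pos_right h1 h.le
    have a2 := neg_of_mul_neg_right h3 h.le
    have a3 := pos_of_mul_neg_right h2 a2.le
    exact ⟨i, 1, Or.inl rfl, by linarith, by linarith, by linarith, by linarith⟩

theorem mul_pos_of_signSet {Z : Omega U r} (hZ : Z ∈ signSet U r) : 0 < Z.2 0 0 * Z.2 0 1 := by
  obtain ⟨i, σ, h⟩ := exists_signConfig hZ
  rw [mul_eq_mul i]
  have h1 := mul_pos h.Y_pos h.Y_pos'
  have hσ : σ * σ = 1 := by rcases h.hσ with rfl | rfl <;> norm_num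
  rwa [mul_mul_mul_comm, hσ, one_mul] at h1

theorem isOpen_signSet : IsOpen (signSet U r) := by
  have e1 : ∀ k, Continuous fun Z : Omega U r => Z.1 0 k := fun k =>
    (continuous_eval_zero k).comp continuous_fst
  have e2 : ∀ k, Continuous fun Z : Omega U r => Z.2 0 k := fun k =>
    (continuous_eval_zero k).comp continuous_snd
  have : signSet U r = (⋃ i : Fin 2, {Z | 0 < Z.1 0 i * Z.2 0 i} ∩
      {Z | Z.1 0 (1 - i) * Z.2 0 (1 - i) < 0}) ∩ {Z | Z.1 0 0 * Z.1 0 1 < 0} := by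
    ext Z
    simp [signSet]
  rw [this]
  refine (isOpen_iUnion fun i => ?_).inter (isOpen_lt ((e1 _).mul (e1 _)) continuous_const)
  exact (isOpen_lt continuous_const ((e1 _).mul (e2 _))).inter
    (isOpen_lt ((e1 _).mul (e2 _)) continuous_const)

/-- On the sign set `beta` is an expression in the jets of the transition maps, which depend
continuously on the 2-jets of the fields at the origin; the nonvanishing components allow the
divisions. -/
theorem continuousOn_beta (hr : 2 ≤ r) : ContinuousOn (beta (U := U) (r := r)) (signSet U r) := by
  have heq : EqOn beta (fun Z : Omega U r => passTwo 1 Z.1 / 2 * passOne 0 Z.2 ^ 2 +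
      passOne 1 Z.1 * (passTwo 0 Z.2 / 2)) (signSet U r) := fun Z hZ => by
    have hX := hasJet3_phiX hr hZ.2
    have hY := hasJet3_phiY hr (mul_pos_of_signSet hZ)
    simp only [beta]
    rw [hX.iteratedDeriv_two, hX.deriv_eq, hY.iteratedDeriv_two, hY.deriv_eq]
  refine ContinuousOn.congr (fun Z hZ => ContinuousAt.continuousWithinAt ?_) heq
  obtain ⟨i, σ, h⟩ := exists_signConfig hZ
  have x1 := (continuousAt_passOne 1 (h.ne_zero 1).1).comp (f := Prod.fst) continuousAt_fst
  have x2 := (continuousAt_passTwo hr 1 (h.ne_zero 1).1).comp (f := Prod.fst) continuousAt_fst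
  have y1 := (continuousAt_passOne 0 (h.ne_zero 0).2).comp (f := Prod.snd) continuousAt_snd
  have y2 := (continuousAt_passTwo hr 0 (h.ne_zero 0).2).comp (f := Prod.snd) continuousAt_snd
  exact ((x2.div_const 2).mul (y1.pow 2)).add (x1.mul (y2.div_const 2))

/-- The derivatives of orders one, two and three of a composition at a common fixed point. -/
def jetComp (p q : ℝ × ℝ × ℝ) : ℝ × ℝ × ℝ :=
  (p.1 * q.1, p.2.1 * q.1 ^ 2 + p.1 * q.2.1,
    p.2.2 * q.1 ^ 3 + 3 * p.2.1 * q.1 * q.2.1 + p.1 * q.2.2)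

theorem continuous_jetComp :
    Continuous fun p : (ℝ × ℝ × ℝ) × (ℝ × ℝ × ℝ) => jetComp p.1 p.2 := by
  unfold jetComp
  fun_prop

theorem continuousOn_eta (hr : 2 ≤ r) : ContinuousOn (eta (U := U) (r := r)) (signSet U r) := by
  have heq : EqOn eta (fun Z : Omega U r =>
      (jetComp (passOne 1 Z.1, passTwo 1 Z.1, passThree 1 Z.1)
        (jetComp (passOne 0 Z.2, passTwo 0 Z.2, passThree 0 Z.2)
          (jetComp (passOne 1 Z.1, passTwo 1 Z.1, passThree 1 Z.1)
            (passOne 0 Z.2, passTwo 0 Z.2, passThree 0 Z.2)))).2.2 / 6) (signSet U r) :=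
    fun Z hZ => by
      have hX := hasJet3_phiX hr hZ.2
      have hY := hasJet3_phiY hr (mul_pos_of_signSet hZ)
      have h3 : iteratedDeriv 3 (phiZ Z) 0 = _ :=
        (hX.comp (hY.comp (hX.comp hY))).iteratedDeriv_three
      rw [eta, h3]
      rfl
  refine ContinuousOn.congr (fun Z hZ => ContinuousAt.continuousWithinAt ?_) heq
  obtain ⟨i, σ, h⟩ := exists_signConfig hZ
  have x1 := (continuousAt_passOne 1 (h.ne_zero 1).1).comp (f := Prod.fst) continuousAt_fst
  have x2 := (continuousAt_passTwo hr 1 (h.ne_zero 1).1).comp (f := Prod.fst) continuousAt_fst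
  have x3 := (continuousAt_passThree hr 1 (h.ne_zero 1).1).comp (f := Prod.fst) continuousAt_fst
  have y1 := (continuousAt_passOne 0 (h.ne_zero 0).2).comp (f := Prod.snd) continuousAt_snd
  have y2 := (continuousAt_passTwo hr 0 (h.ne_zero 0).2).comp (f := Prod.snd) continuousAt_snd
  have y3 := (continuousAt_passThree hr 0 (h.ne_zero 0).2).comp (f := Prod.snd) continuousAt_snd
  have x := x1.prodMk (x2.prodMk x3)
  have y := y1.prodMk (y2.prodMk y3)
  have hc : ∀ p, ContinuousAt (fun p : (ℝ × ℝ × ℝ) × (ℝ × ℝ × ℝ) => jetComp p.1 p.2) p := fun p =>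
    continuous_jetComp.continuousAt
  have a1 := (hc _).comp (x.prodMk y)
  have a2 := (hc _).comp (y.prodMk a1)
  have a3 := (hc _).comp (x.prodMk a2)
  exact a3.snd.snd.div_const 6

end

section

variable {U : OriginNhd} {r : ℕ}

/-! ### The pseudo-Hopf fields -/

/-- Clearing denominators gives `X₁ Y₂ + X₂ Y₁ = 0` at the origin, whichever branch is the crossing
one. -/
theorem SignConfig.slopeSum_eq_zero_iff {Z : Omega U r} {i : Fin 2} {σ : ℝ}
    (h : SignConfig Z i σ) : slopeSum i Z = 0 ↔ alpha Z = -1 := by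
  obtain ⟨x0, y0⟩ := h.ne_zero 0
  obtain ⟨x1, y1⟩ := h.ne_zero 1
  rw [alpha, div_eq_iff (mul_ne_zero x1 y0), slopeSum]
  fin_cases i
  · simp only [Fin.zero_eta, sub_zero]
    rw [div_add_div _ _ y0 x0, div_eq_zero_iff, or_iff_left (mul_ne_zero y0 x0)]
    constructor <;> intro h <;> linarith
  · simp only [Fin.mk_one, sub_self]
    rw [div_add_div _ _ y1 x1, div_eq_zero_iff, or_iff_left (mul_ne_zero y1 x1)]
    constructor <;> intro h <;> linarith

/-- The fields that satisfy the conditions defining the pseudo-Hopf fields, except for the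
equation `alpha Z = -1`. -/
def pseudoHopfDomain (U : OriginNhd) (r : ℕ) : Set (Omega U r) :=
  {Z | Z ∈ signSet U r ∧ beta Z ≠ 0 ∧ eta Z ≠ 0}

theorem isOpen_pseudoHopfDomain (hr : 2 ≤ r) : IsOpen (pseudoHopfDomain U r) := by
  have h1 := (continuousOn_beta (U := U) hr).isOpen_inter_preimage isOpen_signSet
    (isOpen_compl_singleton (x := (0 : ℝ)))
  have h2 := (continuousOn_eta (U := U) hr).isOpen_inter_preimage isOpen_signSet
    (isOpen_compl_singleton (x := (0 : ℝ)))
  convert h1.inter h2 using 1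
  ext Z
  constructor
  · rintro ⟨hs, hb, he⟩
    exact ⟨⟨hs, hb⟩, hs, he⟩
  · rintro ⟨⟨hs, hb⟩, -, he⟩
    exact ⟨hs, hb, he⟩

theorem mem_pseudoHopf_iff {Z : Omega U r} :
    Z ∈ pseudoHopf U r ↔ Z ∈ pseudoHopfDomain U r ∧ alpha Z = -1 := by
  constructor
  · rintro ⟨h1, h2, h3, h4, h5⟩
    exact ⟨⟨⟨h1, h2⟩, h4, h5⟩, h3⟩
  · rintro ⟨⟨⟨h1, h2⟩, h4, h5⟩, h3⟩
    exact ⟨h1, h2, h3, h4, h5⟩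

/-- Stability away from the resonance and instability at the resonance together identify the
bifurcation set inside the open domain. -/
theorem mem_Omega1_iff (hr : 2 ≤ r) {Z : Omega U r} (hZ : Z ∈ pseudoHopfDomain U r) :
    Z ∈ Omega1 U r ↔ alpha Z = -1 := by
  obtain ⟨i, σ, h⟩ := exists_signConfig hZ.1
  rw [← h.slopeSum_eq_zero_iff]
  constructor
  · intro h1
    by_contra h2
    exact h1 (h.mem_Omega0 hr h2)
  · exact fun h1 => h.not_mem_Omega0 hr h1

theorem pseudoHopf_eq (hr : 2 ≤ r) : pseudoHopf U r = pseudoHopfDomain U r ∩ Omega1 U r := by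
  ext Z
  rw [mem_pseudoHopf_iff]
  exact and_congr_right fun h => (mem_Omega1_iff hr h).symm

/-- The quantity `X₂ Y₁ / Y₂` at the origin. -/
def shiftAmount (Z : Omega U r) : ℝ := Z.1 0 1 * Z.2 0 0 / Z.2 0 1

/-- The translation of the first component of `X` by `c X₂ Y₁ / Y₂ (0)`. -/
def shift (c : ℝ) (Z : Omega U r) : Omega U r :=
  (Z.1 + (c * shiftAmount Z) • constField U r (pt 0 1 0), Z.2)

theorem shift_apply_zero (c : ℝ) (Z : Omega U r) :
    (shift c Z).1 0 0 = Z.1 0 0 + c * shiftAmount Z ∧ (shift c Z).1 0 1 = Z.1 0 1 := by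
  simp only [shift, eval_add, eval_smul, constField_zero]
  simp [pt]

/-- The amount does not involve `X₁ (0)`, the only value at the origin that the shift changes; so
the opposite shift is the inverse. -/
theorem shiftAmount_shift (c : ℝ) (Z : Omega U r) : shiftAmount (shift c Z) = shiftAmount Z := by
  rw [shiftAmount, (shift_apply_zero c Z).2]
  rfl

theorem shift_shift {c d : ℝ} (h : c + d = 0) (Z : Omega U r) : shift c (shift d Z) = Z := by
  refine Prod.ext ?_ rfl
  change (Z.1 + (d * shiftAmount Z) • constField U r (pt 0 1 0)) +
    (c * shiftAmount (shift d Z)) • constField U r (pt 0 1 0) = Z.1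
  rw [shiftAmount_shift, add_assoc, ← add_smul, ← add_mul, add_comm d c, h, zero_mul, zero_smul,
    add_zero]

theorem contDiffOn_shift (c : ℝ) :
    ContDiffOn ℝ ∞ (shift c) {Z : Omega U r | Z.2 0 1 ≠ 0} := by
  have hX : ContDiff ℝ ∞ fun Z : Omega U r => Z.1 0 1 :=
    (evalZero U r 1).contDiff.comp contDiff_fst
  have hY : ∀ k, ContDiff ℝ ∞ fun Z : Omega U r => Z.2 0 k := fun k =>
    (evalZero U r k).contDiff.comp contDiff_snd
  have hq : ContDiffOn ℝ ∞ (shiftAmount (U := U) (r := r)) {Z : Omega U r | Z.2 0 1 ≠ 0} :=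
    (hX.contDiffOn.mul (hY 0).contDiffOn).div (hY 1).contDiffOn fun Z hZ => hZ
  exact (contDiff_fst.contDiffOn.add ((contDiffOn_const.mul hq).smul contDiffOn_const)).prodMk
    contDiff_snd.contDiffOn

theorem isOpen_ne_zero : IsOpen {Z : Omega U r | Z.2 0 1 ≠ 0} :=
  isOpen_ne_fun ((continuous_eval_zero 1).comp continuous_snd) continuous_const

/-- The smooth chart which carries the equation `alpha Z = -1` to a linear one. -/
def shiftChart (U : OriginNhd) (r : ℕ) : OpenPartialHomeomorph (Omega U r) (Omega U r) where
  toFun := shift 1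
  invFun := shift (-1)
  source := {Z | Z.2 0 1 ≠ 0}
  target := {Z | Z.2 0 1 ≠ 0}
  map_source' _ h := h
  map_target' _ h := h
  left_inv' _ _ := shift_shift (by norm_num) _
  right_inv' _ _ := shift_shift (by norm_num) _
  open_source := isOpen_ne_zero
  open_target := isOpen_ne_zero
  continuousOn_toFun := (contDiffOn_shift 1).continuousOn
  continuousOn_invFun := (contDiffOn_shift (-1)).continuousOn

/-- Dividing `X₁ Y₂ = -X₂ Y₁` by `Y₂` gives `X₁ + X₂ Y₁ / Y₂ = 0` at the origin, and the left side
is the value of `X₁` after the shift. The chart is restricted to the open domain on which the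
remaining conditions hold. -/
theorem isEmbeddedHypersurface_pseudoHopf (hr : 2 ≤ r) :
    IsEmbeddedHypersurface (pseudoHopf U r) := by
  intro Z hZ
  have hdom : ∀ W ∈ pseudoHopfDomain U r, W.2 0 1 ≠ 0 := fun W hW h => by
    have := mul_pos_of_signSet hW.1
    rw [h, mul_zero] at this
    exact lt_irrefl _ this
  have hZ' := (mem_pseudoHopf_iff.mp hZ).1
  refine ⟨(shiftChart U r).restrOpen _ (isOpen_pseudoHopfDomain hr),
    (evalZero U r 0).comp (ContinuousLinearMap.fst ℝ _ _), ⟨hdom Z hZ', hZ'⟩,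
    (contDiffOn_shift 1).mono fun W hW => hW.1, (contDiffOn_shift (-1)).mono fun W hW => hW.1,
    fun h => ?_, fun W hW => ?_⟩
  -- The linear form is nonzero since it takes the value `1` on a constant horizontal field.
  · have h1 := congrArg (fun l => l (constField U r (pt 0 1 0), 0)) h
    have h2 : constField U r (pt 0 1 0) 0 0 = 0 := h1
    rw [constField_zero] at h2
    simp [pt] at h2
  · have hWd : W ∈ pseudoHopfDomain U r := hW.2
    obtain ⟨i, σ, h⟩ := exists_signConfig hWd.1
    obtain ⟨x0, y0⟩ := h.ne_zero 0
    obtain ⟨x1, y1⟩ := h.ne_zero 1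
    have e : ((evalZero U r 0).comp (ContinuousLinearMap.fst ℝ (CrField U r) (CrField U r)))
        (shift 1 W) = W.1 0 0 + 1 * shiftAmount W := (shift_apply_zero 1 W).1
    have e' : (((evalZero U r 0).comp (ContinuousLinearMap.fst ℝ (CrField U r) (CrField U r)))
        (shift 1 W) = 0) ↔ alpha W = -1 := by
      rw [e, one_mul, alpha, div_eq_iff (mul_ne_zero x1 y0), shiftAmount]
      constructor
      · intro h
        field_simp at h
        linarith
      · intro h
        field_simp
        linarith
    rw [mem_pseudoHopf_iff, and_iff_right hWd]
    exact e'.symm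

end

end PseudoHopf

end

theorem mainTheorem4 (U : PseudoHopf.OriginNhd) (r : ℕ) (hr : 3 ≤ r) :
    PseudoHopf.pseudoHopf U r ⊆ PseudoHopf.Omega1 U r ∧
    PseudoHopf.IsEmbeddedHypersurface (PseudoHopf.pseudoHopf U r) ∧
    ∃ O : Set (PseudoHopf.Omega U r), IsOpen O ∧
      PseudoHopf.pseudoHopf U r = O ∩ PseudoHopf.Omega1 U r := by
  have hr2 : 2 ≤ r := by omega
  refine ⟨?_, PseudoHopf.isEmbeddedHypersurface_pseudoHopf hr2, PseudoHopf.pseudoHopfDomain U r,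
    PseudoHopf.isOpen_pseudoHopfDomain hr2, PseudoHopf.pseudoHopf_eq hr2⟩
  rw [PseudoHopf.pseudoHopf_eq hr2]
  exact Set.inter_subset_right
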